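/- Conventions. Let $\epsilon,\dot\epsilon\in\{1,-1\}$. An $(\epsilon,\dot\epsilon)$-space is a finite dimensional complex vector space $\mathbf V$ with a non-degenerate $\epsilon$-symmetric bilinear form $\langle\cdot,\cdot\rangle$, a conjugate linear automorphism $J$ with $J^2=\epsilon\dot\epsilon$ and $\langle Ju,Jv\rangle=\overline{\langle u,v\rangle}$, and a linear isometry $L$ with $L^2=\dot\epsilon$, such that $LJ=JL$ and $(u,v)\mapsto\langle Lu,Jv\rangle$ is positive definite. Let $\mathbf G$ be the isometry group of $\mathbf V$, $\mathfrak g$ its Lie algebra, $G=\mathbf G^J$, $\mathbf K=\mathbf G^L$, and $\mathfrak g=\mathfrak k\oplus\mathfrak p$ the decomposition into the $\pm1$-eigenspaces of conjugation by $L$. Thus $G$ is real orthogonal, real symplectic, quaternionic orthogonal or quaternionic symplectic for $(\epsilon,\dot\epsilon)=(1,1),(-1,-1),(1,-1),(-1,1)$ respectively. The signature $(n^+,n^-)$ of $\mathbf V$ consists of the dimensions of the $\pm1$-eigenspaces of $L$ if $\dot\epsilon=1$, and of its $\pm\mathbf i$-eigenspaces if $\dot\epsilon=-1$. If $\dot\epsilon=-1$,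 let $\mathcal X_{\mathbf V}$ be the $\mathbf i$-eigenspace of $L$. Put $\widetilde{\mathbf K}=\{(g,c)\in\mathbf K\times\mathbb C^\times:\det(g|_{\mathcal X_{\mathbf V}})=c^2\}$ if $G$ is real symplectic, and $\widetilde{\mathbf K}=\mathbf K$ otherwise. Fix $\mathbb p\in\mathbb Z/2\mathbb Z$. A $\widetilde{\mathbf K}$-representation or bundle is $\mathbb p$-genuine if, in the real symplectic case, $(1,-1)$ acts by $(-1)^{\mathbb p}$ (no condition otherwise). $\mathrm{Nil}^{\mathbb p}_{\mathbf G}(\mathfrak g)$ is the set of nilpotent $\mathbf G$-orbits in $\mathfrak g$ whose Young diagram, with columns $c_0\ge\dots\ge c_k>0$, has all $c_l$ of parity $\mathbb p$ and satisfies $c_l\ge c_{l+1}+2$ whenever $0\le l\le k-1$ and $\epsilon(-1)^l=1$. For a nilpotent $\mathbf K$-orbit $\mathscr O\subset\mathfrak p$, an admissible orbit datum over $\mathscr O$ is an irreducible $\mathbb p$-genuine $\widetilde{\mathbf K}$-equivariant algebraic vector bundle $\mathcal E$ on $\mathscr O$ such that, for $X\in\mathscr O$ with stabilizer Lie algebra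 $\mathfrak k_X$, the $\mathfrak k_X$-module $\mathcal E_X$ is a multiple of $(\bigwedge^{\rm top}\mathfrak k_X)^{1/2}$, the one-dimensional module in which $x$ acts by $\frac12\operatorname{tr}(\operatorname{ad}x|_{\mathfrak k_X})$. Let $\mathcal K^{\rm aod}_{\mathscr O}(\widetilde{\mathbf K})$ be the set of isomorphism classes of admissible orbit data over $\mathscr O$. Let $\mathbf V'$ be a $(-\epsilon,-\dot\epsilon)$-space, with associated objects marked by a prime. For $T\in\operatorname{Hom}(\mathbf V,\mathbf V')$ define $T^\star$ by $\langle Tv,v'\rangle=\langle v,T^\star v'\rangle$. Let $\mathcal X^\circ$ be the set of surjective $T$ with $\dot\epsilon L'TL^{-1}=\mathbf i\,T$. A nilpotent $\mathbf K'$-orbit $\mathscr O'\subset\mathfrak p'$ is the descent of $\mathscr O$ if there is $T\in\mathcal X^\circ$ with $X:=T^\star T\in\mathscr O$ and $X':=TT^\star\in\mathscr O'$. Then every $k\in\mathbf K_X$ determines a unique $\alpha(k)\in\mathbf K'_{X'}$ with $\alpha(k)T=Tk$. Let $\varsigma$ be the character of $\widetilde{\mathbf K}$ equal to $c^{\,n'^+-n'^-}$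 if $G$ is real symplectic, to $\det(g|_{\mathcal X_{\mathbf V}})^{(n'^+-n'^-)/2}$ if $G$ is quaternionic orthogonal, and trivial otherwise; let $\varsigma'$ be the character of $\widetilde{\mathbf K}'$ defined in the same way from $G'$, with $n'^+-n'^-$ replaced by $n^--n^+$. For a $\mathbb p$-genuine $\widetilde{\mathbf K}'$-equivariant bundle $\mathcal E'$ on $\mathscr O'$, let $\vartheta_{\mathscr O',\mathscr O}(\mathcal E')$ be the bundle on $\mathscr O$ whose isotropy representation at $X$ is $\varsigma|_{\widetilde{\mathbf K}_X}\otimes(\varsigma'|_{\widetilde{\mathbf K}'_{X'}}\otimes\mathcal E'_{X'})\circ\alpha$. (This makes sense when $\mathbb p$ is the parity of $\dim\mathbf V$ if $\epsilon=1$, and of $\dim\mathbf V'$ if $\epsilon=-1$; it does not depend on $T$.) Statement. Let $\mathcal O\in\mathrm{Nil}^{\mathbb p}_{\mathbf G}(\mathfrak g)$ and let $\mathscr O$ be a $\mathbf K$-orbit in $\mathcal O\cap\mathfrak p$. Let $A$ be the component group of $G$, identified with that of $\mathbf K$, and $\widehat A$ its group of characters. (1) Let $\mathbf V'$ be a $(-\epsilon,-\dot\epsilon)$-space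 and let $\mathscr O'\subset\mathfrak p'$ be the descent of $\mathscr O$. Assume that $\mathbb p$ is the parity of $\dim\mathbf V$ if $\epsilon=1$, and the parity of $\dim\mathbf V'$ if $\epsilon=-1$. Then $$\widehat A\times\mathcal K^{\rm aod}_{\mathscr O'}(\widetilde{\mathbf K}')\to\mathcal K^{\rm aod}_{\mathscr O}(\widetilde{\mathbf K}),\qquad(\chi,\mathcal E')\mapsto\chi\otimes\vartheta_{\mathscr O',\mathscr O}(\mathcal E')$$ is a well-defined surjective map. (2) If $G$ is a quaternionic group, i.e. $\epsilon\dot\epsilon=-1$, then $\mathcal K^{\rm aod}_{\mathscr O}(\widetilde{\mathbf K})$ has exactly one element. -/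

import Mathlib

open Module

universe u v

noncomputable section

/-! ## Formed spaces and classical groups -/

/-- A finite dimensional complex `ε`-symmetric bilinear space `V` together with a `δ`-Cartan form
`L`, i.e. an isometry with `L ^ 2 = δ` (here `ε, δ ∈ {1, -1}`). -/
structure CartanSpace (ε δ : ℤˣ) (V : Type v) [AddCommGroup V] [Module ℂ V] where
  form : LinearMap.BilinForm ℂ V
  nondeg : form.Nondegenerate
  form_symm : ∀ x y, form x y = ((ε : ℤ) : ℂ) * form y x
  L : End ℂ V
  L_sq : ∀ x, L (L x) = ((δ : ℤ) : ℂ) • x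
  L_form : ∀ x y, form (L x) (L y) = form x y

/-- An `(ε, δ)`-space `(V, J, L)`: moreover `J` is a `δ`-real form (conjugate linear, with
`J ^ 2 = ε δ` and `⟨J x, J y⟩ = conj ⟨x, y⟩`), commuting with `L`, such that the Hermitian form
`(x, y) ↦ ⟨L x, J y⟩` is positive definite. The real classical group is `G = G_V ^ J`:
a real orthogonal group for `(ε, δ) = (1, 1)`, a real symplectic group for `(-1, -1)`, a
quaternionic orthogonal group for `(1, -1)`, a quaternionic symplectic group for `(-1, 1)`. -/
structure EESpace (ε δ : ℤˣ) (V : Type v) [AddCommGroup V] [Module ℂ V]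
    extends CartanSpace ε δ V where
  J : V →ₛₗ[starRingEnd ℂ] V
  J_sq : ∀ x, J (J x) = (((ε * δ : ℤˣ) : ℤ) : ℂ) • x
  J_form : ∀ x y, form (J x) (J y) = starRingEnd ℂ (form x y)
  L_J : ∀ x, L (J x) = J (L x)
  herm_pos : ∀ x, x ≠ 0 → 0 < (form (L x) (J x)).re

namespace CartanSpace

variable {ε δ : ℤˣ} {V : Type v} [AddCommGroup V] [Module ℂ V]

/-- The complex isometry group `G_V`. -/
def isom (S : CartanSpace ε δ V) : Subgroup (V ≃ₗ[ℂ] V) where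
  carrier := {g | ∀ x y, S.form (g x) (g y) = S.form x y}
  one_mem' := fun _ _ => rfl
  mul_mem' := by
    intro a b ha hb x y
    simp only [LinearEquiv.mul_apply]
    rw [ha, hb]
  inv_mem' := by
    intro a ha x y
    rw [← ha (a⁻¹ x) (a⁻¹ y)]
    change S.form (a (a.symm x)) (a (a.symm y)) = _
    simp

/-- The complexified maximal compact subgroup `K = G_V ^ L`. -/
def K (S : CartanSpace ε δ V) : Subgroup (V ≃ₗ[ℂ] V) where
  carrier := {g | g ∈ S.isom ∧ ∀ x, g (S.L x) = S.L (g x)}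
  one_mem' := ⟨S.isom.one_mem, fun _ => rfl⟩
  mul_mem' := by
    rintro a b ⟨ha, ha'⟩ ⟨hb, hb'⟩
    refine ⟨S.isom.mul_mem ha hb, fun x => ?_⟩
    simp only [LinearEquiv.mul_apply]
    rw [hb', ha']
  inv_mem' := by
    rintro a ⟨ha, ha'⟩
    refine ⟨S.isom.inv_mem ha, fun x => a.injective ?_⟩
    change a (a.symm (S.L x)) = a (S.L (a.symm x))
    rw [ha']
    simp

/-- The complex Lie algebra `𝔤` of `G_V`, as a set of endomorphisms. -/
def lieG (S : CartanSpace ε δ V) : Set (End ℂ V) :=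
  {X | ∀ x y, S.form (X x) y + S.form x (X y) = 0}

/-- The `-1`-eigenspace `𝔭` of conjugation by `L` on `𝔤`. -/
def lieP (S : CartanSpace ε δ V) : Set (End ℂ V) :=
  {X | X ∈ S.lieG ∧ ∀ x, S.L (X x) = -X (S.L x)}

/-- The Lie algebra `𝔨_X` of the stabilizer `K_X` of `X` in `K`: the skew endomorphisms which
commute with `L` and with `X`. -/
def lieStab (S : CartanSpace ε δ V) (X : End ℂ V) : Submodule ℂ (End ℂ V) where
  carrier := {x | x ∈ S.lieG ∧ x * S.L = S.L * x ∧ x * X = X * x}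
  zero_mem' := ⟨fun _ _ => by simp, by simp, by simp⟩
  add_mem' := by
    rintro a b ⟨ha, ha', ha''⟩ ⟨hb, hb', hb''⟩
    refine ⟨fun x y => ?_, by rw [add_mul, mul_add, ha', hb'], by rw [add_mul, mul_add, ha'', hb'']⟩
    have h1 := ha x y
    have h2 := hb x y
    simp only [LinearMap.add_apply, map_add]
    linear_combination h1 + h2
  smul_mem' := by
    rintro c a ⟨ha, ha', ha''⟩
    refine ⟨fun x y => ?_, by rw [smul_mul_assoc, mul_smul_comm, ha'],
      by rw [smul_mul_assoc, mul_smul_comm, ha'']⟩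
    have h1 := ha x y
    simp only [LinearMap.smul_apply, map_smul, smul_eq_mul]
    linear_combination c * h1

lemma commutator_mem_lieStab (S : CartanSpace ε δ V) {X a b : End ℂ V} (ha : a ∈ S.lieStab X)
    (hb : b ∈ S.lieStab X) : a * b - b * a ∈ S.lieStab X := by
  obtain ⟨ha, ha', ha''⟩ := ha
  obtain ⟨hb, hb', hb''⟩ := hb
  have key : ∀ Z : End ℂ V, a * Z = Z * a → b * Z = Z * b →
      (a * b - b * a) * Z = Z * (a * b - b * a) := by
    intro Z h1 h2
    rw [sub_mul, mul_sub, mul_assoc, h2, ← mul_assoc, h1, mul_assoc b a, h1,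
      ← mul_assoc b, h2, mul_assoc, mul_assoc]
  refine ⟨fun x y => ?_, key _ ha' hb', key _ ha'' hb''⟩
  simp only [LinearMap.sub_apply, map_sub, Module.End.mul_apply]
  have h1 := ha (b x) y
  have h2 := hb x (a y)
  have h3 := hb (a x) y
  have h4 := ha x (b y)
  linear_combination h1 - h2 - h3 + h4

/-- The adjoint action `y ↦ x y - y x` of `x ∈ 𝔨_X` on `𝔨_X`. -/
def adStab (S : CartanSpace ε δ V) (X : End ℂ V) (x : S.lieStab X) : End ℂ (S.lieStab X) :=
  (LinearMap.mulLeft ℂ x.1 - LinearMap.mulRight ℂ x.1).restrict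
    fun _ hy => S.commutator_mem_lieStab x.2 hy

/-! ## Nilpotent orbits -/

/-- The set `Nil_G(𝔤)` of nilpotent `G_V`-orbits in `𝔤`. -/
def complexNilOrbits (S : CartanSpace ε δ V) : Set (Set (End ℂ V)) :=
  {𝒪 | ∃ X ∈ S.lieG, IsNilpotent X ∧ 𝒪 = {Y | ∃ g ∈ S.isom, Y = g.conj X}}

/-- The set `Nil_K(𝔭)` of nilpotent `K`-orbits in `𝔭`. -/
def nilOrbits (S : CartanSpace ε δ V) : Set (Set (End ℂ V)) :=
  {O | ∃ X ∈ S.lieP, IsNilpotent X ∧ O = {Y | ∃ k ∈ S.K, Y = k.conj X}}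

/-- The length `c_l = dim (Ker X ^ (l + 1) / Ker X ^ l)` of the `l`-th column (starting from
`l = 0`) of the Young diagram of a nilpotent `X`; it vanishes exactly for `l > depth X`. -/
def column (X : End ℂ V) (l : ℕ) : ℕ :=
  finrank ℂ (LinearMap.ker (X ^ (l + 1))) - finrank ℂ (LinearMap.ker (X ^ l))

/-- The set `Nil^p_G(𝔤)`: nilpotent orbits whose Young diagram `[c_0, …, c_k]` has all columns of
parity `p` and satisfies `c_l ≥ c_{l+1} + 2` whenever `0 ≤ l ≤ k - 1` and `ε (-1) ^ l = 1`. -/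
def complexNilOrbitsP (S : CartanSpace ε δ V) (p : ZMod 2) : Set (Set (End ℂ V)) :=
  {𝒪 | 𝒪 ∈ S.complexNilOrbits ∧ ∀ X ∈ 𝒪,
    (∀ l, 0 < column X l → (column X l : ZMod 2) = p) ∧
    (∀ l, 0 < column X (l + 1) → ε * (-1) ^ l = 1 → column X (l + 1) + 2 ≤ column X l)}

/-! ## Eigenspaces of `L`, signature, and the covering group -/

/-- The eigenspace `𝒳_V` of `L` for the eigenvalue `i`. -/
abbrev eigI (S : CartanSpace ε δ V) : Submodule ℂ V := Module.End.eigenspace S.L Complex.I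

/-- The signature of `(V, L)`: the dimensions of the eigenspaces of `L` for `1, -1` (if `δ = 1`)
or for `i, -i` (if `δ = -1`). -/
def signPos (S : CartanSpace ε δ V) : ℕ :=
  finrank ℂ (Module.End.eigenspace S.L (if δ = 1 then 1 else Complex.I))

/-- The second component of the signature, see `signPos`. -/
def signNeg (S : CartanSpace ε δ V) : ℕ :=
  finrank ℂ (Module.End.eigenspace S.L (if δ = 1 then -1 else -Complex.I))

lemma mem_eigI_of_commute (S : CartanSpace ε δ V) {f : End ℂ V}
    (hf : ∀ x, f (S.L x) = S.L (f x)) : ∀ x ∈ S.eigI, f x ∈ S.eigI := by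
  intro x hx
  rw [Module.End.mem_eigenspace_iff] at hx ⊢
  rw [← hf, hx, map_smul]

/-- The restriction of an element of `K` to `𝒳_V`. -/
def resI (S : CartanSpace ε δ V) : S.K →* End ℂ S.eigI where
  toFun k := (k.1 : V →ₗ[ℂ] V).restrict (S.mem_eigI_of_commute (f := (k.1 : V →ₗ[ℂ] V)) k.2.2)
  map_one' := by ext x; rfl
  map_mul' a b := by ext x; rfl

/-- The character `det_{𝒳_V}` of `K`. -/
def detI (S : CartanSpace ε δ V) : S.K →* ℂˣ := (LinearMap.det.comp S.resI).toHomUnits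

/-- `G` is a real symplectic group. -/
def IsRealSymplectic (_ : CartanSpace ε δ V) : Prop := ε = -1 ∧ δ = -1

instance (S : CartanSpace ε δ V) : Decidable S.IsRealSymplectic :=
  inferInstanceAs (Decidable (_ ∧ _))

/-- The group `K̃`: the double cover `{(g, c) | det (g | 𝒳_V) = c ^ 2}` of `K` for a real symplectic
group, and `K` (embedded as `{(g, 1)}`) in all other cases. -/
def Kt (S : CartanSpace ε δ V) : Subgroup (S.K × ℂˣ) where
  carrier := {k | if S.IsRealSymplectic then S.detI k.1 = k.2 ^ 2 else k.2 = 1}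
  one_mem' := by
    change if S.IsRealSymplectic then S.detI 1 = 1 ^ 2 else (1 : ℂˣ) = 1
    split_ifs <;> simp
  mul_mem' := by
    intro a b ha hb
    simp only [Set.mem_ofPred_eq, Prod.fst_mul, Prod.snd_mul] at *
    split_ifs at * with h
    · rw [map_mul, ha, hb, mul_pow]
    · rw [ha, hb, mul_one]
  inv_mem' := by
    intro a ha
    simp only [Set.mem_ofPred_eq, Prod.fst_inv, Prod.snd_inv] at *
    split_ifs at * with h
    · rw [map_inv, ha, inv_pow]
    · rw [ha, inv_one]

/-- The covering map `K̃ → K`. -/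
def toK (S : CartanSpace ε δ V) : S.Kt →* S.K := (MonoidHom.fst _ _).comp S.Kt.subtype

/-- The underlying linear automorphism of an element of `K̃`. -/
def toGL (S : CartanSpace ε δ V) : S.Kt →* (V ≃ₗ[ℂ] V) := S.K.subtype.comp S.toK

/-- The second coordinate `(g, c) ↦ c` on `K̃`, written `det_{𝒳_V} ^ {1/2}` for a real symplectic
group and trivial otherwise. -/
def toC (S : CartanSpace ε δ V) : S.Kt →* ℂˣ := (MonoidHom.snd _ _).comp S.Kt.subtype

/-- The adjoint action of `K̃` on endomorphisms of `V`. -/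
def Ad (S : CartanSpace ε δ V) (k : S.Kt) (X : End ℂ V) : End ℂ V := (S.toGL k).conj X

lemma Ad_one (S : CartanSpace ε δ V) (X : End ℂ V) : S.Ad 1 X = X := by
  ext x
  simp [Ad, LinearEquiv.conj_apply]
  rfl

lemma Ad_mul (S : CartanSpace ε δ V) (a b : S.Kt) (X : End ℂ V) :
    S.Ad (a * b) X = S.Ad a (S.Ad b X) := by
  ext x
  simp only [Ad, map_mul]
  rfl

/-- The stabilizer `K̃_X`. -/
def stab (S : CartanSpace ε δ V) (X : End ℂ V) : Subgroup S.Kt where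
  carrier := {k | S.Ad k X = X}
  one_mem' := S.Ad_one X
  mul_mem' := by
    intro a b ha hb
    simp only [Set.mem_ofPred_eq] at *
    rw [Ad_mul, hb, ha]
  inv_mem' := by
    intro a ha
    simp only [Set.mem_ofPred_eq] at *
    conv_lhs => rw [← ha]
    rw [← Ad_mul, inv_mul_cancel, Ad_one]

/-- The algebra of regular functions on a closed subgroup `H` of `K̃`, viewed as a closed subgroup of
`GL(V) × ℂˣ`: it is generated by the linear coordinates of `g` and of `g⁻¹`, by `c` and by `c⁻¹`. -/
def regularFunctions (S : CartanSpace ε δ V) (H : Subgroup S.Kt) : Subalgebra ℂ (H → ℂ) :=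
  Algebra.adjoin ℂ
    ({f | ∃ φ : Dual ℂ (End ℂ V), f = fun k => φ (S.toGL k.1 : V →ₗ[ℂ] V)} ∪
     {f | ∃ φ : Dual ℂ (End ℂ V), f = fun k => φ (S.toGL k.1⁻¹ : V →ₗ[ℂ] V)} ∪
     {(fun k => (S.toC k.1 : ℂ)), (fun k => (S.toC k.1⁻¹ : ℂ))})

/-- `G` is a real symplectic group and `k = (1, -1)` is the nontrivial element of the kernel of
`K̃ → K`. -/
def IsCoverSign (S : CartanSpace ε δ V) (k : S.Kt) : Prop :=
  S.IsRealSymplectic ∧ S.toK k = 1 ∧ S.toC k = -1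

/-! ## The component group -/

section Topology

variable [FiniteDimensional ℂ V]

/-- The matrix of an endomorphism in a fixed basis of `V`. -/
def mat (X : End ℂ V) : Matrix (Fin (finrank ℂ V)) (Fin (finrank ℂ V)) ℂ :=
  LinearMap.toMatrix (finBasis ℂ V) (finBasis ℂ V) X

/-- The usual topology of the complex Lie group `K`. -/
@[reducible]
def topK (S : CartanSpace ε δ V) : TopologicalSpace S.K :=
  TopologicalSpace.induced (fun k => mat (k.1 : V →ₗ[ℂ] V)) inferInstance

/-- The characters of the component group `A` of `K` (which is also the component group of `G`),
viewed as characters of `K` which are trivial on the identity component. -/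
def componentDual (S : CartanSpace ε δ V) : Subgroup (S.K →* ℂˣ) where
  carrier := {χ | ∀ k ∈ @connectedComponent S.K S.topK 1, χ k = 1}
  one_mem' := fun _ _ => rfl
  mul_mem' := by
    intro a b ha hb k hk
    rw [MonoidHom.mul_apply, ha k hk, hb k hk, mul_one]
  inv_mem' := by
    intro a ha k hk
    rw [MonoidHom.inv_apply, ha k hk, inv_one]

/-- The exponential of an endomorphism of `V`. -/
def expEnd (X : End ℂ V) : End ℂ V :=
  Matrix.toLin (finBasis ℂ V) (finBasis ℂ V) (NormedSpace.exp (mat X))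

/-- The restriction of an element of `𝔨_X` to `𝒳_V`. -/
def lieResI (S : CartanSpace ε δ V) {X : End ℂ V} (x : S.lieStab X) : End ℂ S.eigI :=
  x.1.restrict (S.mem_eigI_of_commute fun y => LinearMap.congr_fun x.2.2.1 y)

/-- `k = exp x` in `K̃`, for `x ∈ 𝔨_X`. In the double cover the exponential map is
`x ↦ (exp x, exp (tr (x | 𝒳_V) / 2))`. -/
def IsExp (S : CartanSpace ε δ V) {X : End ℂ V} (k : S.Kt) (x : S.lieStab X) : Prop :=
  (S.toGL k : V →ₗ[ℂ] V) = expEnd x.1 ∧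
  (S.IsRealSymplectic → (S.toC k : ℂ) = Complex.exp (LinearMap.trace ℂ _ (S.lieResI x) / 2))

/-- The differential `dγ_X` of the character `γ_X = ⋀^top 𝔨_X` of `K_X`, i.e. `x ↦ tr (ad x | 𝔨_X)`. -/
def dgamma (S : CartanSpace ε δ V) (X : End ℂ V) (x : S.lieStab X) : ℂ :=
  LinearMap.trace ℂ (S.lieStab X) (S.adStab X x)

end Topology

/-! ## Equivariant vector bundles on an orbit -/

/-- A `K̃`-homogeneous family of complex vector spaces on a set `O` of endomorphisms of `V`: a vector
space `fiber Y` for each `Y ∈ O`, and linear maps `fiber Y → fiber Z` for each `k ∈ K̃` carrying `Y`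
to `Z`. On a single orbit `O`, a `K̃`-equivariant algebraic vector bundle is such a family whose
isotropy representations are finite dimensional algebraic, see `EquivFamily.IsAlgebraic`. -/
structure EquivFamily (S : CartanSpace ε δ V) (O : Set (End ℂ V)) where
  fiber : O → Type u
  [addCommGroup : ∀ Y, AddCommGroup (fiber Y)]
  [module : ∀ Y, Module ℂ (fiber Y)]
  act : ∀ (k : S.Kt) {Y Z : O}, S.Ad k Y.1 = Z.1 → (fiber Y →ₗ[ℂ] fiber Z)
  act_one : ∀ {Y : O} (h : S.Ad 1 Y.1 = Y.1) (e : fiber Y), act 1 h e = e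
  act_mul : ∀ (a b : S.Kt) {Y Z W : O} (hb : S.Ad b Y.1 = Z.1) (ha : S.Ad a Z.1 = W.1)
    (hab : S.Ad (a * b) Y.1 = W.1) (e : fiber Y), act (a * b) hab e = act a ha (act b hb e)

namespace EquivFamily

attribute [instance] EquivFamily.addCommGroup EquivFamily.module

variable {S : CartanSpace ε δ V} {O : Set (End ℂ V)}

/-- The isotropy representations are finite dimensional and algebraic (their matrix coefficients
are regular functions on the stabilizer). Since the bundle is canonically trivial after pull back
along the orbit maps `K̃ → O`, this is what it means for it to be an algebraic vector bundle. -/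
def IsAlgebraic (E : EquivFamily.{u} S O) : Prop :=
  ∀ Y : O, FiniteDimensional ℂ (E.fiber Y) ∧
    ∀ (e : E.fiber Y) (φ : Dual ℂ (E.fiber Y)),
      (fun k : S.stab Y.1 => φ (E.act k.1 k.2 e)) ∈ S.regularFunctions (S.stab Y.1)

/-- Nonzero, without proper nonzero equivariant subbundle. -/
def IsIrreducible (E : EquivFamily.{u} S O) : Prop :=
  (∃ Y, Nontrivial (E.fiber Y)) ∧
  ∀ F : ∀ Y, Submodule ℂ (E.fiber Y),
    (∀ (k : S.Kt) (Y Z : O) (h : S.Ad k Y.1 = Z.1), ∀ e ∈ F Y, E.act k h e ∈ F Z) →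
      (∀ Y, F Y = ⊥) ∨ (∀ Y, F Y = ⊤)

/-- `p`-genuine: if `G` is a real symplectic group, the nontrivial element of the kernel of `K̃ → K`
acts by `(-1) ^ p`; no condition otherwise. -/
def IsGenuine (E : EquivFamily.{u} S O) (p : ZMod 2) : Prop :=
  ∀ (k : S.Kt) (Y : O) (h : S.Ad k Y.1 = Y.1), S.IsCoverSign k →
    ∀ e : E.fiber Y, E.act k h e = ((-1 : ℂ) ^ p.val) • e

/-- For each `X ∈ O`, the Lie algebra `𝔨_X` acts on the fiber at `X` by a multiple of
`(⋀^top 𝔨_X) ^ {1/2}`, i.e. `exp x` acts by the scalar `exp (dγ_X (x) / 2)`. -/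
def IsHalfCanonical [FiniteDimensional ℂ V] (E : EquivFamily.{u} S O) : Prop :=
  ∀ (X : O) (x : S.lieStab X.1) (k : S.Kt) (h : S.Ad k X.1 = X.1), S.IsExp k x →
    ∀ e : E.fiber X, E.act k h e = Complex.exp (S.dgamma X.1 x / 2) • e

/-- `E` is an admissible orbit datum over the orbit `O`. -/
structure IsAOD [FiniteDimensional ℂ V] (E : EquivFamily.{u} S O) (p : ZMod 2) : Prop where
  algebraic : E.IsAlgebraic
  irreducible : E.IsIrreducible
  halfCanonical : E.IsHalfCanonical
  genuine : E.IsGenuine p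

/-- Equivariant isomorphism. -/
def Equivalent (E F : EquivFamily.{u} S O) : Prop :=
  ∃ Φ : ∀ Y, E.fiber Y ≃ₗ[ℂ] F.fiber Y,
    ∀ (k : S.Kt) (Y Z : O) (h : S.Ad k Y.1 = Z.1) (e : E.fiber Y),
      Φ Z (E.act k h e) = F.act k h (Φ Y e)

/-- The tensor product of `E` with a character of the component group. -/
def twist [FiniteDimensional ℂ V] (χ : S.componentDual) (E : EquivFamily.{u} S O) :
    EquivFamily.{u} S O where
  fiber := E.fiber
  act k _ _ h := (χ.1 (S.toK k) : ℂ) • E.act k h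
  act_one h e := by simp [E.act_one]
  act_mul a b _ _ _ hb ha hab e := by
    simp [E.act_mul a b hb ha hab, mul_smul, smul_comm (χ.1 (S.toK a) : ℂ)]

end EquivFamily

/-- Isomorphism of admissible orbit data over `O`. -/
def aodSetoid [FiniteDimensional ℂ V] (S : CartanSpace ε δ V) (O : Set (End ℂ V)) (p : ZMod 2) :
    Setoid {E : EquivFamily.{u} S O // E.IsAOD p} where
  r E F := E.1.Equivalent F.1
  iseqv :=
    { refl := fun _ => ⟨fun _ => LinearEquiv.refl _ _, fun _ _ _ _ _ => rfl⟩
      symm := by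
        rintro E F ⟨Φ, hΦ⟩
        refine ⟨fun Y => (Φ Y).symm, fun k Y Z h e => ?_⟩
        rw [LinearEquiv.symm_apply_eq, hΦ, LinearEquiv.apply_symm_apply]
      trans := by
        rintro E F H ⟨Φ, hΦ⟩ ⟨Ψ, hΨ⟩
        refine ⟨fun Y => (Φ Y).trans (Ψ Y), fun k Y Z h e => ?_⟩
        simp [hΦ, hΨ] }

/-- The set `K^aod_O(K̃)` of isomorphism classes of admissible orbit data over `O`. -/
def AOD [FiniteDimensional ℂ V] (S : CartanSpace ε δ V) (O : Set (End ℂ V)) (p : ZMod 2) :=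
  Quotient (aodSetoid.{u} S O p)

/-- The isomorphism class of an admissible orbit datum. -/
def AOD.mk [FiniteDimensional ℂ V] {S : CartanSpace ε δ V} {O : Set (End ℂ V)} {p : ZMod 2}
    (E : EquivFamily.{u} S O) (hE : E.IsAOD p) : AOD.{u} S O p :=
  Quotient.mk (aodSetoid.{u} S O p) ⟨E, hE⟩

/-! ## Dual pairs, moment maps and descent -/

section DualPair

variable [FiniteDimensional ℂ V] {V' : Type v} [AddCommGroup V'] [Module ℂ V']

/-- The adjoint `T^⋆ : V' → V` of `T : V → V'`, with `⟨T x, y⟩ = ⟨x, T^⋆ y⟩`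
(see `form_adj`). -/
def adj (S : CartanSpace ε δ V) (S' : CartanSpace (-ε) (-δ) V') (T : V →ₗ[ℂ] V') : V' →ₗ[ℂ] V :=
  (S.form.flip.toDual S.nondeg.flip).symm.toLinearMap ∘ₗ T.dualMap ∘ₗ S'.form.flip

lemma form_adj (S : CartanSpace ε δ V) (S' : CartanSpace (-ε) (-δ) V') (T : V →ₗ[ℂ] V')
    (x : V) (y : V') : S.form x (S.adj S' T y) = S'.form (T x) y := by
  exact LinearMap.BilinForm.apply_toDual_symm_apply (hB := S.nondeg.flip)
    (T.dualMap (S'.form.flip y)) x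

lemma eq_adj (S : CartanSpace ε δ V) (S' : CartanSpace (-ε) (-δ) V') (T : V →ₗ[ℂ] V')
    (y : V') (z : V) (h : ∀ x, S.form x z = S'.form (T x) y) : z = S.adj S' T y := by
  rw [← sub_eq_zero]
  refine S.nondeg.2 _ fun x => ?_
  rw [map_sub, h, form_adj, sub_self]

/-- The moment map `M(T) = T^⋆ T`. -/
def moment (S : CartanSpace ε δ V) (S' : CartanSpace (-ε) (-δ) V') (T : V →ₗ[ℂ] V') : End ℂ V :=
  S.adj S' T ∘ₗ T

/-- The moment map `M'(T) = T T^⋆`. -/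
def moment' (S : CartanSpace ε δ V) (S' : CartanSpace (-ε) (-δ) V') (T : V →ₗ[ℂ] V') : End ℂ V' :=
  T ∘ₗ S.adj S' T

/-- The set `𝒳°` of surjective maps `T : V → V'` in the `i`-eigenspace `𝒳` of
`T ↦ δ L' T L⁻¹` on `Hom(V, V')`. -/
def Xcirc (S : CartanSpace ε δ V) (S' : CartanSpace (-ε) (-δ) V') : Set (V →ₗ[ℂ] V') :=
  {T | Function.Surjective T ∧
    ∀ x, ((δ : ℤ) : ℂ) • S'.L (T x) = Complex.I • T (S.L x)}

/-- The orbit `O'` is the descent of the orbit `O`. -/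
def IsDescent (S : CartanSpace ε δ V) (S' : CartanSpace (-ε) (-δ) V')
    (O : Set (End ℂ V)) (O' : Set (End ℂ V')) : Prop :=
  ∃ T ∈ S.Xcirc S', S.moment S' T ∈ O ∧ S.moment' S' T ∈ O'

lemma adj_comp (S : CartanSpace ε δ V) (S' : CartanSpace (-ε) (-δ) V') (T : V →ₗ[ℂ] V')
    (k : S.Kt) : S.adj S' (T ∘ₗ (S.toGL k : V →ₗ[ℂ] V)) =
      ((S.toGL k).symm : V →ₗ[ℂ] V) ∘ₗ S.adj S' T := by
  ext y
  refine (S.eq_adj S' _ _ _ fun x => ?_).symm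
  have h := (S.toK k).2.1 x ((S.toGL k).symm (S.adj S' T y))
  change S.form (S.toGL k x) (S.toGL k ((S.toGL k).symm (S.adj S' T y))) = _ at h
  rw [LinearEquiv.apply_symm_apply, form_adj] at h
  simpa using h.symm

lemma adj_comp' (S : CartanSpace ε δ V) (S' : CartanSpace (-ε) (-δ) V') (T : V →ₗ[ℂ] V')
    (k : S'.Kt) : S.adj S' ((S'.toGL k : V' →ₗ[ℂ] V') ∘ₗ T) =
      S.adj S' T ∘ₗ ((S'.toGL k).symm : V' →ₗ[ℂ] V') := by
  ext y
  refine (S.eq_adj S' _ _ _ fun x => ?_).symm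
  have h := (S'.toK k).2.1 (T x) ((S'.toGL k).symm y)
  change S'.form (S'.toGL k (T x)) (S'.toGL k ((S'.toGL k).symm y)) = _ at h
  rw [LinearEquiv.apply_symm_apply] at h
  simpa [form_adj] using h.symm

lemma moment_comp (S : CartanSpace ε δ V) (S' : CartanSpace (-ε) (-δ) V') (T : V →ₗ[ℂ] V')
    (k : S.Kt) : S.Ad k (S.moment S' (T ∘ₗ (S.toGL k : V →ₗ[ℂ] V))) = S.moment S' T := by
  ext x
  simp [Ad, moment, adj_comp, LinearEquiv.conj_apply]

lemma moment'_comp (S : CartanSpace ε δ V) (S' : CartanSpace (-ε) (-δ) V') (T : V →ₗ[ℂ] V')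
    (k : S.Kt) : S.moment' S' (T ∘ₗ (S.toGL k : V →ₗ[ℂ] V)) = S.moment' S' T := by
  ext x
  simp [moment', adj_comp]

lemma moment'_comp' (S : CartanSpace ε δ V) (S' : CartanSpace (-ε) (-δ) V') (T : V →ₗ[ℂ] V')
    (k : S'.Kt) :
    S'.Ad k (S.moment' S' T) = S.moment' S' ((S'.toGL k : V' →ₗ[ℂ] V') ∘ₗ T) := by
  ext x
  simp [Ad, moment', adj_comp', LinearEquiv.conj_apply]

/-! ## Lift of equivariant bundles -/

/-- For an integer `m`, the character of `K̃` given by `(det_{𝒳_V} ^ {1/2}) ^ m` for a real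
symplectic group, by `det_{𝒳_V} ^ (m / 2)` for a quaternionic orthogonal group (where `m` will be
even), and trivial otherwise. -/
def varsigma (S : CartanSpace ε δ V) (m : ℤ) : S.Kt →* ℂˣ :=
  if S.IsRealSymplectic then (zpowGroupHom m).comp S.toC
  else if ε = 1 ∧ δ = -1 then (zpowGroupHom (m / 2)).comp (S.detI.comp S.toK)
  else 1

/-- The restriction to `K̃` of the character `ς_{V,V'}`. -/
def varsigmaK (S : CartanSpace ε δ V) (S' : CartanSpace (-ε) (-δ) V') : S.Kt →* ℂˣ :=
  S.varsigma ((S'.signPos : ℤ) - S'.signNeg)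

/-- The restriction to `K̃'` of the character `ς_{V,V'}`. -/
def varsigmaK' [FiniteDimensional ℂ V'] (S : CartanSpace ε δ V) (S' : CartanSpace (-ε) (-δ) V') :
    S'.Kt →* ℂˣ :=
  S'.varsigma ((S.signNeg : ℤ) - S.signPos)

/-- The elements `T ∈ 𝒳°` with `M(T) = Y` and `M'(T) ∈ O'`. -/
def DescFiber (S : CartanSpace ε δ V) (S' : CartanSpace (-ε) (-δ) V') (O' : Set (End ℂ V'))
    (Y : End ℂ V) : Type v :=
  {T : V →ₗ[ℂ] V' // T ∈ S.Xcirc S' ∧ S.moment S' T = Y ∧ S.moment' S' T ∈ O'}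

namespace DescFiber

variable {S : CartanSpace ε δ V} {S' : CartanSpace (-ε) (-δ) V'} {O' : Set (End ℂ V')}

/-- The point `M'(T)` of `O'`. -/
def target {Y : End ℂ V} (T : DescFiber S S' O' Y) : O' := ⟨S.moment' S' T.1, T.2.2.2⟩

/-- The element `k⁻¹ · T = T ∘ k`, for `k ∈ K̃` carrying `Y` to `Z`. -/
def pull {Y Z : End ℂ V} (k : S.Kt) (h : S.Ad k Y = Z) (T : DescFiber S S' O' Z) :
    DescFiber S S' O' Y :=
  ⟨T.1 ∘ₗ (S.toGL k : V →ₗ[ℂ] V), by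
    obtain ⟨T, ⟨hT, hL⟩, hM, hM'⟩ := T
    refine ⟨⟨?_, fun x => ?_⟩, ?_, ?_⟩
    · exact hT.comp (S.toGL k).surjective
    · have h2 : S.toGL k (S.L x) = S.L (S.toGL k x) := (S.toK k).2.2 x
      simp only [LinearMap.comp_apply, LinearEquiv.coe_coe]
      rw [hL, h2]
    · apply (S.toGL k).conj.injective
      change S.Ad k _ = S.Ad k _
      rw [moment_comp, h, hM]
    · rw [moment'_comp]
      exact hM'⟩

lemma target_pull {Y Z : End ℂ V} (k : S.Kt) (h : S.Ad k Y = Z) (T : DescFiber S S' O' Z) :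
    S'.Ad 1 (T.pull k h).target.1 = T.target.1 := by
  rw [Ad_one]
  exact moment'_comp S S' T.1 k

lemma target_translate {Y : End ℂ V} (k : S'.Kt) {T T₂ : DescFiber S S' O' Y}
    (h : T₂.1 = (S'.toGL k : V' →ₗ[ℂ] V') ∘ₗ T.1) : S'.Ad k T.target.1 = T₂.target.1 := by
  change S'.Ad k (S.moment' S' T.1) = S.moment' S' T₂.1
  rw [h, moment'_comp']

end DescFiber

variable {S : CartanSpace ε δ V} {S' : CartanSpace (-ε) (-δ) V'} {O : Set (End ℂ V)}
  {O' : Set (End ℂ V')}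

/-- The fiber at `Y` of the lift of `E'`: the `K̃'`-equivariant sections over `M⁻¹(Y)` of the
bundle `ς ⊗ M'^* E'`. -/
def liftFiber [FiniteDimensional ℂ V'] (S : CartanSpace ε δ V) {S' : CartanSpace (-ε) (-δ) V'}
    (E' : EquivFamily.{v} S' O') (Y : End ℂ V) :
    Submodule ℂ (∀ T : DescFiber S S' O' Y, E'.fiber T.target) where
  carrier := {s | ∀ (k : S'.Kt) (T T₂ : DescFiber S S' O' Y)
    (h : T₂.1 = (S'.toGL k : V' →ₗ[ℂ] V') ∘ₗ T.1),
    s T₂ = (S.varsigmaK' S' k : ℂ) • E'.act k (DescFiber.target_translate k h) (s T)}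
  zero_mem' := by intro k T T₂ h; simp
  add_mem' := by
    intro a b ha hb k T T₂ h
    simp only [Pi.add_apply, map_add, smul_add]
    rw [← ha k T T₂ h, ← hb k T T₂ h]
  smul_mem' := by
    intro c a ha k T T₂ h
    simp only [Pi.smul_apply, map_smul]
    rw [smul_comm, ← ha k T T₂ h]

lemma act_congr (E' : EquivFamily.{v} S' O') (a : S'.Kt) {Y Z : O'} (h : S'.Ad a Y.1 = Z.1)
    (b : S'.Kt) (hab : a = b) (h2 : S'.Ad b Y.1 = Z.1) (e : E'.fiber Y) :
    E'.act a h e = E'.act b h2 e := by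
  subst hab
  rfl

/-- The lift `ϑ_{O', O}(E')` of a bundle `E'` from `O'` to `O`. An element `k ∈ K̃` acts on
sections by `(k s)(T) = ς(k) s(k⁻¹ T)` (the map `E'.act 1` only identifies the fibers of `E'` at the
equal points `M'(k⁻¹ T)` and `M'(T)`). Its isotropy representation is computed
in `thetaLift_isotropy`. -/
def thetaLift [FiniteDimensional ℂ V'] (S : CartanSpace ε δ V) {S' : CartanSpace (-ε) (-δ) V'}
    (O : Set (End ℂ V)) (E' : EquivFamily.{v} S' O') : EquivFamily.{v} S O where
  fiber Y := liftFiber S E' Y.1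
  act k Y Z h :=
    { toFun := fun s => ⟨fun T => (S.varsigmaK S' k : ℂ) •
          E'.act 1 (T.target_pull k h) (s.1 (T.pull k h)), by
        intro k' T T₂ hT
        have h1 : (T₂.pull k h).1 = (S'.toGL k' : V' →ₗ[ℂ] V') ∘ₗ (T.pull k h).1 := by
          change T₂.1 ∘ₗ _ = _ ∘ₗ (T.1 ∘ₗ _)
          rw [hT, LinearMap.comp_assoc]
        have h2 := s.2 k' (T.pull k h) (T₂.pull k h) h1
        simp only [map_smul]
        rw [h2, map_smul, smul_comm (S.varsigmaK S' k : ℂ)]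
        congr 2
        have h3 : S'.Ad k' (T.pull k h).target.1 = T₂.target.1 := by
          have e1 := T.target_pull k h
          rw [Ad_one] at e1
          rw [e1]
          exact DescFiber.target_translate k' hT
        rw [← E'.act_mul 1 k' _ _ (by rw [one_mul]; exact h3),
          ← E'.act_mul k' 1 _ _ (by rw [mul_one]; exact h3)]
        exact act_congr E' _ _ _ (by rw [one_mul, mul_one]) _ _⟩
      map_add' := by
        intro a b
        ext T
        simp
      map_smul' := by
        intro c a
        ext T
        change (S.varsigmaK S' k : ℂ) • E'.act 1 _ (c • a.1 (T.pull k h)) =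
          c • ((S.varsigmaK S' k : ℂ) • E'.act 1 _ (a.1 (T.pull k h)))
        rw [map_smul, smul_comm] }
  act_one := by
    intro Y h e
    ext T
    have h1 : T.pull 1 h = T := Subtype.ext (by ext x; rfl)
    have key : ∀ (T' : DescFiber S S' O' Y.1) (hT : T' = T)
        (h2 : S'.Ad 1 T'.target.1 = T.target.1), E'.act 1 h2 (e.1 T') = e.1 T := by
      rintro T' rfl h2
      exact E'.act_one _ _
    change (S.varsigmaK S' 1 : ℂ) • _ = _
    rw [map_one, Units.val_one, one_smul]
    exact key _ h1 _
  act_mul := by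
    intro a b Y Z W hb ha hab e
    ext T
    change (S.varsigmaK S' (a * b) : ℂ) • E'.act 1 _ (e.1 (T.pull (a * b) hab)) =
      (S.varsigmaK S' a : ℂ) • E'.act 1 _ ((S.varsigmaK S' b : ℂ) • E'.act 1 _
        (e.1 ((T.pull a ha).pull b hb)))
    rw [map_mul, Units.val_mul, mul_smul, map_smul]
    congr 2
    have h1 : (T.pull a ha).pull b hb = T.pull (a * b) hab := Subtype.ext (by ext x; rfl)
    have e1 := T.target_pull (a * b) hab
    have key : ∀ (T' : DescFiber S S' O' Y.1) (hT : T' = T.pull (a * b) hab)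
        (h2 : S'.Ad 1 T'.target.1 = (T.pull a ha).target.1)
        (h3 : S'.Ad 1 (T.pull a ha).target.1 = T.target.1),
        E'.act 1 e1 (e.1 (T.pull (a * b) hab)) = E'.act 1 h3 (E'.act 1 h2 (e.1 T')) := by
      rintro T' rfl h2 h3
      rw [← E'.act_mul 1 1 _ _ (by rw [mul_one]; exact e1)]
      exact act_congr E' _ _ _ (by rw [mul_one]) _ _
    exact key _ h1 _ _

/-- Evaluation at `T` identifies the isotropy representation of the lift with `ϑ_T` of the isotropy
representation `ρ'` of `E'` at `M'(T)`: if `k ∈ K̃` and `k' ∈ K̃'` satisfy `T k = k' T`, then `k` acts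
as `ς(k) ς(k') ρ'(k')`. -/
theorem thetaLift_isotropy [FiniteDimensional ℂ V'] (E' : EquivFamily.{v} S' O') {X : O}
    (T : DescFiber S S' O' X.1) (k : S.Kt) (hk : S.Ad k X.1 = X.1) (k' : S'.Kt)
    (hT : T.1 ∘ₗ (S.toGL k : V →ₗ[ℂ] V) = (S'.toGL k' : V' →ₗ[ℂ] V') ∘ₗ T.1)
    (hk' : S'.Ad k' T.target.1 = T.target.1) (s : (thetaLift S O E').fiber X) :
    ((thetaLift S O E').act k hk s).1 T =
      (S.varsigmaK S' k : ℂ) • (S.varsigmaK' S' k' : ℂ) • E'.act k' hk' (s.1 T) := by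
  have h2 := s.2 k' T (T.pull k hk) hT
  change (S.varsigmaK S' k : ℂ) • E'.act 1 _ (s.1 (T.pull k hk)) = _
  rw [h2, map_smul, ← E'.act_mul 1 k' _ _ (by rw [one_mul]; exact hk')]
  congr 2
  exact act_congr E' _ _ _ (by rw [one_mul]) _ _

end DualPair

end CartanSpace

end

/-!
The theorem is a statement about isotropy representations. An equivariant bundle on an orbit is
determined by the representation of `K̃_X` on its fiber at a point `X`, and for `X = T^⋆ T`,
`X' = T T^⋆` the lift has the isotropy representation `ς ⊗ (ς' ⊗ ρ') ∘ α` (`isLiftOf_thetaLift`).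
What has to be shown is that `ρ' ↦ χ ⊗ ς ⊗ (ς' ⊗ ρ') ∘ α` carries admissible representations to
admissible ones and that it reaches all of them. Three facts about `α : K_X → K'_{X'}` carry this.

* `α` is surjective (`exists_lift_K`), and so is its differential `𝔨_X → 𝔨'_{X'}`. Skew
  endomorphisms of `V'` lift by linear algebra. An element of `K'_{X'}` is the product of the
  exponential of a skew endomorphism and of an involution, both commuting with whatever the element
  commutes with (`exists_expEnd_mul_involution`); this replaces the topological arguments by
  polynomials in one endomorphism, and allows lifting the two factors separately.

* The half canonical characters of `𝔨_X` and `𝔨'_{X'}` differ by `ς` and `ς'`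
  (`exp_half_dgamma_eq`). The kernel of `𝔨_X → 𝔨'_{X'}` is the space of tensors in
  `ker T ⊗ ker T` with prescribed symmetry under the swap and under `L ⊗ L`, so that the trace of
  `ad x` on it is an explicit expression in traces of `x L` and of `L` (`dgamma_eq`).

* The kernel of `α` is generated by exponentials, except that for a real orthogonal group the
  determinants on the two eigenspaces of `L` have to be `1` (`mem_expMonoid_of_fixes`). Hence an
  admissible representation restricts to the kernel as `ς` times a product of such determinants,
  that is, times a character of the component group (`IsAdmissible.exists_componentDual`). After
  dividing by these characters it factors through `K'_{X'}` (`IsAdmissible.exists_descent`).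

Algebraicity needs no separate treatment. Every nilpotent `X ∈ 𝔭` is of the form `T^⋆ T` with `T`
the corestriction of `X` to its range (`exists_moment_eq`), descent removes the first column of the
Young diagram, and a lift of an algebraic representation is algebraic; so iterated descent down to
`V = 0` shows that admissible representations are algebraic (`IsAdmissible.isRegularRep`). The
parity condition on the columns is what makes the genuineness conditions match at each step.

The same induction gives the second part: for a quaternionic group the component group has no
nontrivial characters, so that lifting is a surjection from a one-element set.
-/

noncomputable section

set_option linter.unusedSectionVars false

/-! ### The exponential of an endomorphism -/

namespace Matrix

variable {n : Type*} [Fintype n] [DecidableEq n]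

open scoped Matrix.Norms.Operator in
/-- Every linear functional of `exp A` is the sum of the exponential series. -/
lemma hasSum_exp_apply (A : Matrix n n ℂ) (Λ : Matrix n n ℂ →ₗ[ℂ] ℂ) :
    HasSum (fun k : ℕ => ((k.factorial : ℂ)⁻¹) * Λ (A ^ k)) (Λ (NormedSpace.exp A)) := by
  have h := NormedSpace.exp_series_hasSum_exp' (𝕂 := ℂ) A
  have h2 := (LinearMap.toContinuousLinearMap Λ).hasSum h
  have h3 : (fun k : ℕ => ((k.factorial : ℂ)⁻¹) * Λ (A ^ k)) =
      fun k : ℕ => LinearMap.toContinuousLinearMap Λ ((k.factorial : ℂ)⁻¹ • A ^ k) := by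
    funext k
    change _ = Λ _
    rw [map_smul, smul_eq_mul]
  rw [h3]
  exact h2

open scoped Matrix.Norms.Operator in
/-- Jacobi's formula `det (exp A) = exp (tr A)`: both sides solve the same linear differential
equation along `t ↦ t A`. -/
theorem det_exp_eq_exp_trace (A : Matrix n n ℂ) :
    (NormedSpace.exp A).det = Complex.exp A.trace := by
  have hdet : Differentiable ℂ (fun M : Matrix n n ℂ => M.det) := by
    simp only [Matrix.det_apply]
    refine Differentiable.fun_sum fun σ _ => ?_
    refine Differentiable.const_smul ?_ _
    let e : n → Matrix n n ℂ →L[ℂ] ℂ := fun i => LinearMap.toContinuousLinearMap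
      (Matrix.entryLinearMap ℂ ℂ (σ i) i : Matrix n n ℂ →ₗ[ℂ] ℂ)
    exact fun M => (HasFDerivAt.finsetProd (u := Finset.univ)
      (fun i _ => (e i).hasFDerivAt)).differentiableAt
  set D := fderiv ℂ (fun M : Matrix n n ℂ => M.det) 1 with hD
  have hD1 : HasFDerivAt (fun M : Matrix n n ℂ => M.det) D 1 := (hdet 1).hasFDerivAt
  have hDA : D A = A.trace := by
    have h1 : HasDerivAt (fun t : ℂ => (1 : Matrix n n ℂ) + t • A) A 0 := by
      have := ((hasDerivAt_id (0 : ℂ)).smul_const A).const_add (1 : Matrix n n ℂ)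
      rw [one_smul] at this
      exact this
    have h2 : HasDerivAt (fun t : ℂ => ((1 : Matrix n n ℂ) + t • A).det) (D A) 0 := by
      have h3 : HasFDerivAt (fun M : Matrix n n ℂ => M.det) D
          ((1 : Matrix n n ℂ) + (0 : ℂ) • A) := by simpa using hD1
      exact h3.comp_hasDerivAt (0 : ℂ) h1
    -- `det (1 + t A) = 1 + t tr A + t ^ 2 q(t)` for a polynomial `q`
    have h4 : HasDerivAt (fun t : ℂ => ((1 : Matrix n n ℂ) + t • A).det) A.trace 0 := by
      rw [funext fun t : ℂ => Matrix.det_one_add_smul t A]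
      set q := (Matrix.det (1 + (Polynomial.X : Polynomial ℂ) •
        A.map Polynomial.C)).divX.divX with hq
      have e1 : HasDerivAt (fun t : ℂ => 1 + A.trace * t) A.trace 0 := by
        simpa using ((hasDerivAt_id (0 : ℂ)).const_mul A.trace).const_add 1
      have e2 : HasDerivAt (fun t : ℂ => q.eval t * t ^ 2) 0 0 := by
        refine ((q.hasDerivAt (0 : ℂ)).mul ((hasDerivAt_id (0 : ℂ)).pow 2)).congr_deriv ?_
        simp
      exact (e1.add e2).congr_deriv (add_zero _)
    exact h2.unique h4
  have hE0 : HasDerivAt (fun t : ℂ => NormedSpace.exp (t • A)) A 0 := by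
    have h1 : HasDerivAt (fun t : ℂ => t • A) A 0 := by
      have := (hasDerivAt_id (0 : ℂ)).smul_const A
      rw [one_smul] at this
      exact this
    have h2 : HasFDerivAt (NormedSpace.exp : Matrix n n ℂ → Matrix n n ℂ)
        (1 : Matrix n n ℂ →L[ℂ] Matrix n n ℂ) ((0 : ℂ) • A) := by
      rw [zero_smul]; exact hasFDerivAt_exp_zero
    exact h2.comp_hasDerivAt (0 : ℂ) h1
  set F : ℂ → ℂ := fun t => (NormedSpace.exp (t • A)).det with hF
  have hF0 : HasDerivAt F A.trace 0 := by
    have h3 : HasFDerivAt (fun M : Matrix n n ℂ => M.det) D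
        (NormedSpace.exp ((0 : ℂ) • A)) := by
      rw [zero_smul, NormedSpace.exp_zero]; exact hD1
    rw [← hDA]
    exact h3.comp_hasDerivAt (0 : ℂ) hE0
  have hFadd : ∀ s t, F (s + t) = F s * F t := by
    intro s t
    simp only [hF, add_smul]
    rw [Matrix.exp_add_of_commute _ _ ((Commute.refl A).smul_left s |>.smul_right t), Matrix.det_mul]
  have hFd : ∀ t, HasDerivAt F (F t * A.trace) t := by
    intro t
    have h1 : HasDerivAt (fun s : ℂ => s - t) 1 t := (hasDerivAt_id t).sub_const t
    have h0 : HasDerivAt F A.trace (t - t) := by rw [sub_self]; exact hF0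
    have h2 := (HasDerivAt.comp (h₂ := F) (h := fun s : ℂ => s - t) t h0 h1).const_mul (F t)
    have h3 : F = fun s => F t * (F ∘ fun s => s - t) s := by
      funext s
      simp only [Function.comp_apply]
      rw [← hFadd]; congr 1; ring
    have h4 : HasDerivAt F (F t * (A.trace * 1)) t := (congrArg
      (fun G : ℂ → ℂ => HasDerivAt G (F t * (A.trace * 1)) t) h3).mpr h2
    exact h4.congr_deriv (by rw [mul_one])
  -- `t ↦ det (exp (t A)) exp (- t tr A)` has derivative zero
  have hG : ∀ t, HasDerivAt (fun t => F t * Complex.exp (-(t * A.trace))) 0 t := by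
    intro t
    have h1 : HasDerivAt (fun t : ℂ => Complex.exp (-(t * A.trace)))
        (Complex.exp (-(t * A.trace)) * (-(1 * A.trace))) t :=
      (((hasDerivAt_id t).mul_const A.trace).neg).cexp
    have h2 := (hFd t).mul h1
    exact h2.congr_deriv (by ring)
  have hc := is_const_of_deriv_eq_zero (fun t => (hG t).differentiableAt)
    (fun t => (hG t).deriv) 1 0
  simp only [hF, one_smul, zero_smul, NormedSpace.exp_zero, Matrix.det_one, one_mul, zero_mul,
    neg_zero, Complex.exp_zero] at hc
  rw [Complex.exp_neg] at hc
  field_simp at hc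
  exact hc

end Matrix

namespace CartanSpace

section Exp

variable {V : Type*} [AddCommGroup V] [Module ℂ V] [FiniteDimensional ℂ V]
  {V' : Type*} [AddCommGroup V'] [Module ℂ V'] [FiniteDimensional ℂ V']

/-- Every linear functional of `exp y` is the sum of the exponential series. Identities between
exponentials are reduced to identities between powers through this lemma. -/
lemma hasSum_expEnd (y : End ℂ V) (Λ : End ℂ V →ₗ[ℂ] ℂ) :
    HasSum (fun k : ℕ => ((k.factorial : ℂ)⁻¹) * Λ (y ^ k)) (Λ (expEnd y)) := by
  have h := Matrix.hasSum_exp_apply (mat y)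
    (Λ ∘ₗ (Matrix.toLin (finBasis ℂ V) (finBasis ℂ V)).toLinearMap)
  have hE : Λ (expEnd y) = (Λ ∘ₗ (Matrix.toLin (finBasis ℂ V) (finBasis ℂ V)).toLinearMap)
    (NormedSpace.exp (mat y)) := rfl
  rw [hE]
  convert h using 2 with k
  congr 1
  simp only [LinearMap.comp_apply, LinearEquiv.coe_coe]
  congr 1
  change y ^ k = Matrix.toLinAlgEquiv (finBasis ℂ V)
    ((LinearMap.toMatrixAlgEquiv (finBasis ℂ V) y) ^ k)
  rw [← map_pow, Matrix.toLinAlgEquiv_toMatrixAlgEquiv]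

lemma mat_expEnd (y : End ℂ V) : mat (expEnd y) = NormedSpace.exp (mat y) := by
  simp [mat, expEnd]

lemma expEnd_zero : expEnd (0 : End ℂ V) = 1 := by
  simp [expEnd, mat, NormedSpace.exp_zero, Module.End.one_eq_id]

lemma expEnd_add {a b : End ℂ V} (h : a * b = b * a) : expEnd (a + b) = expEnd a * expEnd b := by
  have hm : mat (a + b) = mat a + mat b := by simp [mat]
  have hc : Commute (mat a) (mat b) := by
    change mat a * mat b = mat b * mat a
    unfold mat
    rw [← LinearMap.toMatrix_mul, ← LinearMap.toMatrix_mul, h]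
  unfold expEnd
  rw [hm, Matrix.exp_add_of_commute _ _ hc, Matrix.toLin_mul _ (finBasis ℂ V)]
  rfl

lemma expEnd_neg_mul (a : End ℂ V) : expEnd (-a) * expEnd a = 1 := by
  rw [← expEnd_add (by simp), neg_add_cancel, expEnd_zero]

/-- Two families of powers with the same image under linear functionals have exponentials with the
same image. -/
lemma expEnd_functional_eq {a : End ℂ V} {b : End ℂ V'} (Λ : End ℂ V →ₗ[ℂ] ℂ)
    (Λ' : End ℂ V' →ₗ[ℂ] ℂ) (h : ∀ k : ℕ, Λ (a ^ k) = Λ' (b ^ k)) :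
    Λ (expEnd a) = Λ' (expEnd b) := by
  have h1 := hasSum_expEnd a Λ
  have h2 := hasSum_expEnd b Λ'
  simp only [h] at h1
  exact h1.unique h2

omit [FiniteDimensional ℂ V] [FiniteDimensional ℂ V'] in
lemma comp_pow_eq {T : V →ₗ[ℂ] V'} {a : End ℂ V} {b : End ℂ V'} (h : T ∘ₗ a = b ∘ₗ T) (k : ℕ) :
    T ∘ₗ (a ^ k) = (b ^ k) ∘ₗ T := by
  induction k with
  | zero => rfl
  | succ k ih =>
    rw [pow_succ, pow_succ, Module.End.mul_eq_comp, Module.End.mul_eq_comp,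
      ← LinearMap.comp_assoc, ih, LinearMap.comp_assoc, h, ← LinearMap.comp_assoc]

lemma comp_expEnd {T : V →ₗ[ℂ] V'} {a : End ℂ V} {b : End ℂ V'} (h : T ∘ₗ a = b ∘ₗ T) :
    T ∘ₗ expEnd a = expEnd b ∘ₗ T := by
  ext v
  rw [LinearMap.comp_apply, LinearMap.comp_apply, ← sub_eq_zero,
    ← Module.forall_dual_apply_eq_zero_iff ℂ]
  intro φ
  rw [map_sub, sub_eq_zero]
  have h1 := expEnd_functional_eq (a := a) (b := b)
    (φ ∘ₗ T ∘ₗ (LinearMap.applyₗ v : End ℂ V →ₗ[ℂ] V))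
    (φ ∘ₗ (LinearMap.applyₗ (T v) : End ℂ V' →ₗ[ℂ] V')) fun k => by
      have h2 := LinearMap.congr_fun (comp_pow_eq h k) v
      simp only [LinearMap.comp_apply, LinearMap.applyₗ_apply_apply] at h2 ⊢
      rw [h2]
  simpa only [LinearMap.comp_apply, LinearMap.applyₗ_apply_apply] using h1

lemma expEnd_commute {a b : End ℂ V} (h : b * a = a * b) : b * expEnd a = expEnd a * b :=
  comp_expEnd h

lemma expEnd_apply_of_eq_zero {a : End ℂ V} {v : V} (h : a v = 0) : expEnd a v = v := by
  rw [← sub_eq_zero, ← Module.forall_dual_apply_eq_zero_iff ℂ]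
  intro φ
  rw [map_sub, sub_eq_zero]
  have := expEnd_functional_eq (a := a) (b := (0 : End ℂ V)) (φ ∘ₗ LinearMap.applyₗ v)
    (φ ∘ₗ LinearMap.applyₗ v) fun k => by
      cases k with
      | zero => simp
      | succ k => simp [pow_succ, h]
  simpa [expEnd_zero] using this

lemma expEnd_apply_of_eq_smul {a : End ℂ V} {v : V} {c : ℂ} (h : a v = c • v) :
    expEnd a v = Complex.exp c • v := by
  have h1 : (a - c • 1) v = 0 := by simp [h]
  have h2 : expEnd (c • (1 : End ℂ V)) = Complex.exp c • 1 := by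
    have hm : mat (c • (1 : End ℂ V)) = Matrix.diagonal fun _ => c := by
      simp [mat, LinearMap.toMatrix_one, Matrix.smul_one_eq_diagonal]
    unfold expEnd
    rw [hm, Matrix.exp_diagonal]
    have : NormedSpace.exp (fun _ : Fin (finrank ℂ V) => c) = fun _ => Complex.exp c := by
      funext i
      rw [Pi.coe_exp, Complex.exp_eq_exp_ℂ]
    rw [this, ← Matrix.smul_one_eq_diagonal, map_smul, Matrix.toLin_one]
    rfl
  have h3 : a = c • 1 + (a - c • 1) := by abel
  rw [h3, expEnd_add (by ext; simp), Module.End.mul_apply, expEnd_apply_of_eq_zero h1, h2]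
  simp

lemma det_expEnd (y : End ℂ V) :
    LinearMap.det (expEnd y) = Complex.exp (LinearMap.trace ℂ V y) := by
  rw [← LinearMap.det_toMatrix (finBasis ℂ V), LinearMap.trace_eq_matrix_trace ℂ (finBasis ℂ V)]
  rw [← Matrix.det_exp_eq_exp_trace]
  congr 1
  exact mat_expEnd y

end Exp

end CartanSpace

/-! ### Logarithms of invertible endomorphisms -/

open Filter Topology

/-- In a finite dimensional commutative complex algebra every unit is an exponential: the
exponentials form an open subgroup of the units, and the units on the complex line through `1` and
`g` form a connected set, being the complement of a finite subset of that line. -/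
theorem NormedSpace.exists_exp_eq_of_isUnit {A : Type*} [NormedRing A] [NormedAlgebra ℂ A]
    [FiniteDimensional ℂ A] (hc : ∀ x y : A, Commute x y) {g : A} (hg : IsUnit g) :
    ∃ z : A, NormedSpace.exp z = g := by
  have : CompleteSpace A := FiniteDimensional.complete ℂ A
  let _ : NormedAlgebra ℚ A := NormedAlgebra.restrictScalars ℚ ℂ A
  -- the exponentials contain a neighbourhood of `1`
  have h1 : ∀ᶠ a in 𝓝 (1 : A), ∃ z : A, NormedSpace.exp z = a := by
    have hd : HasStrictFDerivAt (NormedSpace.exp : A → A)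
        ((ContinuousLinearEquiv.refl ℂ A : A ≃L[ℂ] A) : A →L[ℂ] A) 0 :=
      hasStrictFDerivAt_exp_zero
    have := hd.map_nhds_eq_of_equiv
    rw [NormedSpace.exp_zero] at this
    rw [← this, Filter.eventually_map]
    exact Filter.Eventually.of_forall fun z => ⟨z, rfl⟩
  set φ : ℂ → A := fun t => (1 - t) • (1 : A) + t • g with hφ
  have hφc : Continuous φ := by fun_prop
  set U : Set ℂ := {t | IsUnit (φ t)} with hU
  -- if `φ t` is not a unit, then `- (1 - t) / t` is an eigenvalue of multiplication by `g`
  have hUfin : Uᶜ.Finite := by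
    have hfin : (spectrum ℂ (LinearMap.mulLeft ℂ g)).Finite := Module.End.finite_spectrum _
    refine (hfin.image fun s => (1 - s)⁻¹).subset ?_
    intro t ht
    have ht0 : t ≠ 0 := by
      rintro rfl
      apply ht
      simp [hU, hφ]
    refine ⟨-(1 - t) / t, ?_, ?_⟩
    · rw [spectrum.mem_iff]
      intro h
      apply ht
      have hb : Function.Bijective (algebraMap ℂ (End ℂ A) (-(1 - t) / t) -
          LinearMap.mulLeft ℂ g) := (Module.End.isUnit_iff _).mp h
      obtain ⟨w, hw⟩ := hb.2 1
      have hw' : φ t * (-(t⁻¹ • w)) = 1 := by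
        rw [← hw]
        simp only [hφ, LinearMap.sub_apply, Module.algebraMap_end_apply, LinearMap.mulLeft_apply,
          add_mul, mul_neg, smul_mul_assoc, one_mul, mul_smul_comm]
        rw [smul_add, smul_smul, smul_smul, inv_mul_cancel₀ ht0, one_smul, neg_div,
          div_eq_inv_mul, neg_smul]
        abel
      exact ⟨⟨φ t, _, hw', by rw [← hw']; exact hc _ _⟩, rfl⟩
    · field_simp
      ring
  have hUconn : IsPreconnected U := by
    have := (hUfin.countable.isConnected_compl_of_one_lt_rank (by simp)).isPreconnected
    rwa [compl_compl] at this
  have hloc : ∀ t ∈ U, ∀ᶠ t' in 𝓝[U] t, ∃ z, φ t' = NormedSpace.exp z * φ t := by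
    intro t ht
    obtain ⟨u, hu⟩ := ht
    have hcont : Continuous fun t' => φ t' * (↑u⁻¹ : A) := hφc.mul continuous_const
    have h2 : Tendsto (fun t' => φ t' * (↑u⁻¹ : A)) (𝓝 t) (𝓝 1) := by
      have := hcont.tendsto t
      rwa [← hu, Units.mul_inv] at this
    refine nhdsWithin_le_nhds ((h2.eventually h1).mono fun t' h => ?_)
    obtain ⟨z, hz⟩ := h
    exact ⟨z, by rw [hz, ← hu, mul_assoc, Units.inv_mul, mul_one]⟩
  -- along `U` the points `φ t` stay in one class modulo exponentials; `φ 0 = 1` and `φ 1 = g`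
  have key := hUconn.induction₂ (fun t t' => ∃ z, φ t' = NormedSpace.exp z * φ t) hloc
    (by
      rintro x y z - - - ⟨a, ha⟩ ⟨b, hb⟩
      exact ⟨b + a, by rw [hb, ha, NormedSpace.exp_add_of_commute (hc b a), mul_assoc]⟩)
    (by
      rintro x y - - ⟨a, ha⟩
      refine ⟨-a, ?_⟩
      rw [ha, ← mul_assoc, ← NormedSpace.exp_add_of_commute (hc _ _), neg_add_cancel,
        NormedSpace.exp_zero, one_mul])
    (x := 0) (y := 1) (by simp [hU, hφ]) (by simpa [hU, hφ] using hg)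
  obtain ⟨z, hz⟩ := key
  exact ⟨z, by simpa [hφ] using hz.symm⟩


lemma NormedSpace.algHom_exp {A B : Type*} [NormedRing A] [NormedAlgebra ℂ A]
    [FiniteDimensional ℂ A] [NormedRing B] [NormedAlgebra ℂ B] (f : A →ₐ[ℂ] B) (z : A) :
    f (NormedSpace.exp z) = NormedSpace.exp (f z) := by
  let _ : NormedAlgebra ℚ A := NormedAlgebra.restrictScalars ℚ ℂ A
  let _ : NormedAlgebra ℚ B := NormedAlgebra.restrictScalars ℚ ℂ B
  have : CompleteSpace A := FiniteDimensional.complete ℂ A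
  exact NormedSpace.map_exp f (f.toLinearMap.continuous_of_finiteDimensional) z

open scoped Matrix.Norms.Operator in
/-- Every invertible complex matrix has a logarithm which is a polynomial in it. -/
theorem Matrix.exists_exp_aeval_eq {n : Type*} [Fintype n] [DecidableEq n] {M N : Matrix n n ℂ}
    (hMN : N * M = 1) : ∃ p : Polynomial ℂ, NormedSpace.exp (Polynomial.aeval M p) = M := by
  let B := Algebra.adjoin ℂ {M}
  have hcB : ∀ x y : B, Commute x y := by
    intro x y
    refine Subtype.ext ?_
    change (x : Matrix n n ℂ) * y = y * x
    exact Algebra.commute_of_mem_adjoin_singleton_of_commute y.2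
      (Algebra.commute_of_mem_adjoin_self x.2).symm
  let m : B := ⟨M, Algebra.self_mem_adjoin_singleton ℂ M⟩
  have hinj : Function.Injective (LinearMap.mulLeft ℂ m) := by
    intro x y hxy
    have h1 : M * x = M * y := congrArg Subtype.val hxy
    refine Subtype.ext ?_
    have h2 := congrArg (N * ·) h1
    simpa only [← mul_assoc, hMN, one_mul] using h2
  have hfin : FiniteDimensional ℂ B := inferInstanceAs (FiniteDimensional ℂ B.toSubmodule)
  obtain ⟨w, hw⟩ := LinearMap.surjective_of_injective hinj 1
  have hu : IsUnit m := ⟨⟨m, w, hw, by rw [← hw]; exact hcB _ _⟩, rfl⟩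
  obtain ⟨z, hz⟩ := NormedSpace.exists_exp_eq_of_isUnit hcB hu
  have hzmem : (z : Matrix n n ℂ) ∈ Algebra.adjoin ℂ {M} := z.2
  rw [Algebra.adjoin_singleton_eq_range_aeval] at hzmem
  obtain ⟨p, hp⟩ := hzmem
  refine ⟨p, ?_⟩
  have h1 := NormedSpace.algHom_exp B.val z
  rw [hz] at h1
  have hp' : Polynomial.aeval M p = (z : Matrix n n ℂ) := hp
  rw [hp']
  exact h1.symm

namespace CartanSpace

/-- Every automorphism of a finite dimensional complex vector space has a logarithm which is a
polynomial in it. -/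
theorem exists_expEnd_eq {V : Type*} [AddCommGroup V] [Module ℂ V] [FiniteDimensional ℂ V]
    (g : V ≃ₗ[ℂ] V) :
    ∃ p : Polynomial ℂ, expEnd (Polynomial.aeval (g : End ℂ V) p) = (g : End ℂ V) := by
  let e := LinearMap.toMatrixAlgEquiv (finBasis ℂ V)
  have h1 : e (g.symm : End ℂ V) * e (g : End ℂ V) = 1 := by
    rw [← map_mul, ← map_one e]
    congr 1
    ext x
    simp
  obtain ⟨p, hp⟩ := Matrix.exists_exp_aeval_eq h1
  refine ⟨p, ?_⟩
  apply e.injective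
  change mat (expEnd _) = _
  rw [mat_expEnd]
  change NormedSpace.exp (e _) = _
  rw [← Polynomial.aeval_algHom_apply] at *
  exact hp

end CartanSpace

/-! ### Adjoints and the Jordan decomposition of an isometry -/

namespace CartanSpace

variable {ε δ : ℤˣ} {V : Type v} [AddCommGroup V] [Module ℂ V] [FiniteDimensional ℂ V]

lemma unit_mul_self (a : ℤˣ) : ((a : ℤ) : ℂ) * ((a : ℤ) : ℂ) = 1 := by
  rcases Int.units_eq_one_or a with rfl | rfl <;> simp

/-- The adjoint `a^⋆` of an endomorphism `a`, with `⟨a x, y⟩ = ⟨x, a^⋆ y⟩`. -/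
def dagger (S : CartanSpace ε δ V) (a : End ℂ V) : End ℂ V :=
  (S.form.flip.toDual S.nondeg.flip).symm.toLinearMap ∘ₗ a.dualMap ∘ₗ S.form.flip

variable (S : CartanSpace ε δ V)

lemma form_dagger (a : End ℂ V) (x y : V) : S.form x (S.dagger a y) = S.form (a x) y := by
  exact LinearMap.BilinForm.apply_toDual_symm_apply (hB := S.nondeg.flip)
    (a.dualMap (S.form.flip y)) x

lemma eq_of_form_right {x y : V} (h : ∀ z, S.form z x = S.form z y) : x = y := by
  rw [← sub_eq_zero]
  refine S.nondeg.2 _ fun z => ?_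
  rw [map_sub, h, sub_self]

lemma eq_of_form_left {x y : V} (h : ∀ z, S.form x z = S.form y z) : x = y := by
  rw [← sub_eq_zero]
  refine S.nondeg.1 _ fun z => ?_
  rw [map_sub, LinearMap.sub_apply, h, sub_self]

lemma eq_dagger {a b : End ℂ V} (h : ∀ x y, S.form x (b y) = S.form (a x) y) :
    b = S.dagger a := by
  ext y
  exact S.eq_of_form_right fun x => by rw [h, form_dagger]

lemma form_dagger_left (a : End ℂ V) (x y : V) : S.form (S.dagger a x) y = S.form x (a y) := by
  rw [S.form_symm, form_dagger, S.form_symm (a y), ← mul_assoc, unit_mul_self, one_mul]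

lemma dagger_dagger (a : End ℂ V) : S.dagger (S.dagger a) = a :=
  (S.eq_dagger fun x y => (S.form_dagger_left a x y).symm).symm

lemma dagger_mul (a b : End ℂ V) : S.dagger (a * b) = S.dagger b * S.dagger a :=
  (S.eq_dagger fun x y => by simp [form_dagger]).symm

lemma dagger_add (a b : End ℂ V) : S.dagger (a + b) = S.dagger a + S.dagger b :=
  (S.eq_dagger fun x y => by simp [form_dagger]).symm

lemma dagger_sub (a b : End ℂ V) : S.dagger (a - b) = S.dagger a - S.dagger b :=
  (S.eq_dagger fun x y => by simp [form_dagger]).symm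

lemma dagger_smul (c : ℂ) (a : End ℂ V) : S.dagger (c • a) = c • S.dagger a :=
  (S.eq_dagger fun x y => by simp [form_dagger]).symm

lemma dagger_one : S.dagger 1 = 1 :=
  (S.eq_dagger fun x y => by simp).symm

lemma dagger_zero : S.dagger 0 = 0 :=
  (S.eq_dagger fun x y => by simp).symm

lemma dagger_pow (a : End ℂ V) (k : ℕ) : S.dagger (a ^ k) = S.dagger a ^ k := by
  induction k with
  | zero => simp [dagger_one]
  | succ k ih => rw [pow_succ, dagger_mul, ih, ← pow_succ']

lemma dagger_aeval (a : End ℂ V) (p : Polynomial ℂ) :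
    S.dagger (Polynomial.aeval a p) = Polynomial.aeval (S.dagger a) p := by
  induction p using Polynomial.induction_on' with
  | add p q hp hq => rw [map_add, map_add, dagger_add, hp, hq]
  | monomial n c =>
    rw [Polynomial.aeval_monomial, Polynomial.aeval_monomial, dagger_mul, dagger_pow,
      Algebra.algebraMap_eq_smul_one, dagger_smul, dagger_one]
    simp

lemma dagger_expEnd (a : End ℂ V) : S.dagger (expEnd a) = expEnd (S.dagger a) := by
  refine (S.eq_dagger fun x y => ?_).symm
  have h := expEnd_functional_eq (a := S.dagger a) (b := a)
    (S.form x ∘ₗ (LinearMap.applyₗ y : End ℂ V →ₗ[ℂ] V))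
    (S.form.flip y ∘ₗ (LinearMap.applyₗ x : End ℂ V →ₗ[ℂ] V)) fun k => by
      simp [← dagger_pow, form_dagger]
  simpa using h

lemma dagger_L : S.dagger S.L = ((δ : ℤ) : ℂ) • S.L := by
  refine (S.eq_dagger fun x y => ?_).symm
  rw [← S.L_form (S.L x) y, S.L_sq]
  simp

lemma L_mul_L : S.L * S.L = ((δ : ℤ) : ℂ) • 1 := by
  ext x
  simp [S.L_sq]

lemma mem_lieG_iff {a : End ℂ V} : a ∈ S.lieG ↔ S.dagger a = -a := by
  constructor
  · intro h
    refine (S.eq_dagger fun x y => ?_).symm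
    have := h x y
    rw [LinearMap.neg_apply, map_neg]
    linear_combination -this
  · intro h x y
    rw [← form_dagger, h]
    simp

lemma mem_isom_iff {g : V ≃ₗ[ℂ] V} :
    g ∈ S.isom ↔ S.dagger (g : End ℂ V) = (g.symm : V →ₗ[ℂ] V) := by
  constructor
  · intro h
    refine (S.eq_dagger fun x y => ?_).symm
    have := h x (g.symm y)
    rw [LinearEquiv.apply_symm_apply] at this
    exact this.symm
  · intro h x y
    change S.form ((g : End ℂ V) x) _ = _
    rw [← form_dagger, h]
    simp

lemma trace_dagger (a : End ℂ V) : LinearMap.trace ℂ V (S.dagger a) = LinearMap.trace ℂ V a := by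
  have h : S.dagger a = (S.form.flip.toDual S.nondeg.flip).symm.conj a.dualMap := by
    ext x
    rfl
  rw [h, LinearMap.trace_conj']
  exact LinearMap.trace_transpose' a

lemma trace_eq_zero_of_dagger_eq_neg {a : End ℂ V} (h : S.dagger a = -a) :
    LinearMap.trace ℂ V a = 0 := by
  have h1 := S.trace_dagger a
  rw [h, map_neg] at h1
  linear_combination -h1 / 2

/-- An endomorphism `a` with `a^⋆ a = 1` commuting with `L` is (the underlying map of) an element
of `K`. -/
lemma exists_mem_K {a : End ℂ V} (h : S.dagger a * a = 1) (hL : a * S.L = S.L * a) :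
    ∃ k ∈ S.K, (k : End ℂ V) = a := by
  have hinj : Function.Injective a := by
    intro x y hxy
    have := congrArg (S.dagger a) hxy
    rwa [← Module.End.mul_apply, ← Module.End.mul_apply, h] at this
  refine ⟨LinearEquiv.ofInjectiveEndo a hinj, ⟨fun x y => ?_, fun x => ?_⟩, rfl⟩
  · change S.form (a x) (a y) = _
    rw [← form_dagger, ← Module.End.mul_apply, h]
    rfl
  · exact LinearMap.congr_fun hL x

lemma dagger_mul_self_of_mem_isom {g : V ≃ₗ[ℂ] V} (hg : g ∈ S.isom) :
    S.dagger (g : End ℂ V) * (g : End ℂ V) = 1 := by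
  rw [S.mem_isom_iff.mp hg]
  ext x
  simp

lemma mul_dagger_self_of_mem_isom {g : V ≃ₗ[ℂ] V} (hg : g ∈ S.isom) :
    (g : End ℂ V) * S.dagger (g : End ℂ V) = 1 := by
  rw [S.mem_isom_iff.mp hg]
  ext x
  simp

lemma aeval_apply_of_apply_eq_self {a : End ℂ V} {w : V} (h : a w = w) (p : Polynomial ℂ) :
    Polynomial.aeval a p w = p.eval 1 • w := by
  have h1 : a.HasEigenvector 1 w ∨ w = 0 := by
    by_cases hw : w = 0
    · exact Or.inr hw
    · exact Or.inl ⟨by simpa using h, hw⟩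
  rcases h1 with h1 | rfl
  · exact Module.End.aeval_apply_of_hasEigenvector h1
  · simp

/-- An isometry `g` is a product `exp(y) s` with `y` skew and `s` an isometric involution, where `y`
and `s` inherit the commutation relations of `g`. If `z` is a polynomial in `g` with `exp z = g`,
then `exp (z + z^⋆) = g g^⋆ = 1`, so that `y = (z - z^⋆) / 2` and `s = exp ((z + z^⋆) / 2)` work. -/
theorem exists_expEnd_mul_involution {g : V ≃ₗ[ℂ] V} (hg : g ∈ S.isom) :
    ∃ y s : End ℂ V, y ∈ S.lieG ∧ expEnd y * s = (g : End ℂ V) ∧ s * s = 1 ∧ S.dagger s = s ∧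
      (∀ c : End ℂ V, c * g = g * c → S.dagger c * g = g * S.dagger c →
        c * y = y * c ∧ c * s = s * c) ∧
      ∀ w, g w = w → y w = 0 ∧ s w = w := by
  obtain ⟨p, hp⟩ := exists_expEnd_eq g
  set G : End ℂ V := (g : End ℂ V) with hG
  set z := Polynomial.aeval G p with hz
  have hz' : S.dagger z = Polynomial.aeval (S.dagger G) p := S.dagger_aeval G p
  have hGG := S.dagger_mul_self_of_mem_isom hg
  have hGG' := S.mul_dagger_self_of_mem_isom hg
  rw [← hG] at hGG hGG'
  have haev : ∀ b c : End ℂ V, c * b = b * c →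
      c * Polynomial.aeval b p = Polynomial.aeval b p * c := by
    intro b c h
    exact Algebra.commute_of_mem_adjoin_singleton_of_commute
      (Polynomial.aeval_mem_adjoin_singleton ℂ b) h
  have hcz : ∀ c : End ℂ V, c * G = G * c → c * z = z * c := fun c => haev G c
  have hcz' : ∀ c : End ℂ V, S.dagger c * G = G * S.dagger c →
      c * S.dagger z = S.dagger z * c := by
    intro c h
    have h1 := congrArg S.dagger (hcz _ h)
    rw [dagger_mul, dagger_mul, dagger_dagger] at h1
    exact h1.symm
  have hzz : z * S.dagger z = S.dagger z * z := by
    apply hcz'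
    rw [hz']
    exact (haev _ _ (by rw [hGG, hGG'])).symm
  set y := (1 / 2 : ℂ) • (z - S.dagger z) with hy
  set m := (1 / 2 : ℂ) • (z + S.dagger z) with hm
  have hyz : y + m = z := by
    rw [hy, hm, ← smul_add]
    simp only [sub_add_add_cancel, ← two_smul ℂ z, smul_smul]
    norm_num
  have hym : y * m = m * y := by
    rw [hy, hm]
    rw [smul_mul_smul_comm, smul_mul_smul_comm, sub_mul, mul_add, mul_add, add_mul, mul_sub,
      mul_sub, hzz]
    congr 1
    abel
  refine ⟨y, expEnd m, ?_, ?_, ?_, ?_, ?_, ?_⟩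
  · rw [mem_lieG_iff, hy, dagger_smul, dagger_sub, dagger_dagger, ← smul_neg, neg_sub]
  · rw [← expEnd_add hym, hyz, hp]
  · rw [← expEnd_add rfl]
    have : m + m = z + S.dagger z := by
      rw [hm, ← two_smul ℂ, smul_smul]
      norm_num
    rw [this, expEnd_add hzz, ← dagger_expEnd, hp, hGG']
  · rw [dagger_expEnd, hm, dagger_smul, dagger_add, dagger_dagger, add_comm]
  · intro c h1 h2
    have h3 := hcz c h1
    have h4 := hcz' c h2
    refine ⟨?_, expEnd_commute ?_⟩
    · rw [hy, mul_smul_comm, smul_mul_assoc, mul_sub, sub_mul, h3, h4]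
    · rw [hm, mul_smul_comm, smul_mul_assoc, mul_add, add_mul, h3, h4]
  · intro w hw
    -- `w` is an eigenvector of `z` and of `z^⋆` for the same eigenvalue, so `y` kills it
    have e1 : z w = p.eval 1 • w := aeval_apply_of_apply_eq_self hw p
    have e2 : S.dagger z w = p.eval 1 • w := by
      rw [hz']
      refine aeval_apply_of_apply_eq_self ?_ p
      rw [S.mem_isom_iff.mp hg]
      exact g.symm_apply_eq.mpr hw.symm
    have e3 : y w = 0 := by simp [hy, e1, e2]
    refine ⟨e3, ?_⟩
    have e4 : expEnd (-y) (g w) = expEnd m w := by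
      have : expEnd (-y) * G = expEnd m := by
        rw [← hp, ← hyz, expEnd_add hym, ← mul_assoc, expEnd_neg_mul, one_mul]
      rw [← this]
      rfl
    rw [← e4, hw, expEnd_apply_of_eq_zero (by simp [e3])]

end CartanSpace

/-! ### Transfer of endomorphisms along a map in `𝒳°` -/

namespace CartanSpace

variable {ε δ : ℤˣ} {V : Type v} [AddCommGroup V] [Module ℂ V] [FiniteDimensional ℂ V]
  {V' : Type v} [AddCommGroup V'] [Module ℂ V'] [FiniteDimensional ℂ V']

section Basic

variable (S : CartanSpace ε δ V) (S' : CartanSpace (-ε) (-δ) V') {T : V →ₗ[ℂ] V'}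

lemma neg_unit_cast (a : ℤˣ) : (((-a : ℤˣ) : ℤ) : ℂ) = -((a : ℤ) : ℂ) := by simp

/-- Taking adjoints turns `T a = b T` into `a^⋆ T^⋆ = T^⋆ b^⋆`. -/
lemma dagger_comp_adj {a : End ℂ V} {b : End ℂ V'} (h : T ∘ₗ a = b ∘ₗ T) :
    S.dagger a ∘ₗ S.adj S' T = S.adj S' T ∘ₗ S'.dagger b := by
  ext y
  refine S.eq_of_form_right fun x => ?_
  simp only [LinearMap.comp_apply]
  rw [form_dagger, form_adj, form_adj, form_dagger]
  exact congrArg (fun z => S'.form z y) (LinearMap.congr_fun h x)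

/-- Taking adjoints turns `a T^⋆ = T^⋆ b` into `T a^⋆ = b^⋆ T`. -/
lemma comp_dagger_of_comp_adj {a : End ℂ V} {b : End ℂ V'}
    (h : a ∘ₗ S.adj S' T = S.adj S' T ∘ₗ b) : T ∘ₗ S.dagger a = S'.dagger b ∘ₗ T := by
  ext x
  refine S'.eq_of_form_left fun y => ?_
  simp only [LinearMap.comp_apply]
  rw [form_dagger_left, ← form_adj, ← form_adj, form_dagger_left]
  have h1 : a (S.adj S' T y) = S.adj S' T (b y) := LinearMap.congr_fun h y
  rw [h1]

lemma adj_injective (hT : Function.Surjective T) : Function.Injective (S.adj S' T) := by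
  intro x y h
  refine S'.eq_of_form_right fun z => ?_
  obtain ⟨z, rfl⟩ := hT z
  rw [← form_adj, ← form_adj, h]

lemma ker_moment (hT : Function.Surjective T) :
    LinearMap.ker (S.moment S' T) = LinearMap.ker T := by
  ext x
  simp only [LinearMap.mem_ker, moment, LinearMap.comp_apply]
  constructor
  · intro h
    exact S.adj_injective S' hT (by rw [h, map_zero])
  · intro h
    rw [h, map_zero]

lemma form_moment (x y : V) : S.form x (S.moment S' T y) = S'.form (T x) (T y) := by
  simp [moment, form_adj]

lemma dagger_moment : S.dagger (S.moment S' T) = -S.moment S' T := by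
  refine (S.eq_dagger fun x y => ?_).symm
  rw [LinearMap.neg_apply, map_neg, form_moment, S.form_symm, form_moment, S'.form_symm (T x),
    neg_unit_cast]
  ring

lemma dagger_moment' : S'.dagger (S.moment' S' T) = -S.moment' S' T := by
  refine (S'.eq_dagger fun x y => ?_).symm
  rw [LinearMap.neg_apply, map_neg]
  simp only [moment', LinearMap.comp_apply]
  rw [← S.form_adj S', S'.form_symm x, ← S.form_adj S', S.form_symm, neg_unit_cast]
  linear_combination (S.form (S.adj S' T x) (S.adj S' T y)) * unit_mul_self ε

lemma T_comp_L (hT : T ∈ S.Xcirc S') :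
    T ∘ₗ S.L = (-(Complex.I * ((δ : ℤ) : ℂ))) • (S'.L ∘ₗ T) := by
  ext x
  have h := congrArg (fun z => (-Complex.I) • z) (hT.2 x)
  simp only [smul_smul] at h
  simp only [LinearMap.comp_apply, LinearMap.smul_apply]
  rw [← neg_mul, h]
  simp

lemma adj_comp_L (hT : T ∈ S.Xcirc S') :
    S.adj S' T ∘ₗ S'.L = (-(Complex.I * ((δ : ℤ) : ℂ))) • (S.L ∘ₗ S.adj S' T) := by
  have h1 : T ∘ₗ S.L = ((-(Complex.I * ((δ : ℤ) : ℂ))) • S'.L) ∘ₗ T := by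
    rw [S.T_comp_L S' hT, LinearMap.smul_comp]
  have h := S.dagger_comp_adj S' h1
  rw [dagger_smul, dagger_L, dagger_L, LinearMap.smul_comp, LinearMap.comp_smul,
    LinearMap.comp_smul, neg_unit_cast, smul_smul] at h
  have h2 : (-(Complex.I * ((δ : ℤ) : ℂ))) * -((δ : ℤ) : ℂ) = Complex.I := by
    linear_combination Complex.I * unit_mul_self δ
  rw [h2] at h
  rw [neg_smul, mul_smul, h, smul_smul, Complex.I_mul_I]
  simp

lemma moment'_mul_L (hT : T ∈ S.Xcirc S') :
    S.moment' S' T * S'.L = -(S'.L * S.moment' S' T) := by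
  change (T ∘ₗ S.adj S' T) ∘ₗ S'.L = -(S'.L ∘ₗ (T ∘ₗ S.adj S' T))
  rw [LinearMap.comp_assoc, S.adj_comp_L S' hT, LinearMap.comp_smul, ← LinearMap.comp_assoc,
    S.T_comp_L S' hT, LinearMap.smul_comp, smul_smul, LinearMap.comp_assoc]
  have : (-(Complex.I * ((δ : ℤ) : ℂ))) * (-(Complex.I * ((δ : ℤ) : ℂ))) = -1 := by
    linear_combination (((δ : ℤ) : ℂ) * ((δ : ℤ) : ℂ)) * Complex.I_mul_I - unit_mul_self δ
  rw [this, neg_one_smul]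

lemma moment'_mem_lieP (hT : T ∈ S.Xcirc S') : S.moment' S' T ∈ S'.lieP := by
  refine ⟨S'.mem_lieG_iff.mpr (S.dagger_moment' S'), fun x => ?_⟩
  have := LinearMap.congr_fun (S.moment'_mul_L S' hT) x
  simp only [Module.End.mul_apply, LinearMap.neg_apply] at this
  rw [this, neg_neg]

lemma commute_dagger_L {a : End ℂ V} (h : a * S.L = S.L * a) :
    S.dagger a * S.L = S.L * S.dagger a := by
  have h1 := congrArg S.dagger h
  rw [dagger_mul, dagger_mul, dagger_L, smul_mul_assoc, mul_smul_comm] at h1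
  have h2 := congrArg (fun z => ((δ : ℤ) : ℂ) • z) h1
  simp only [smul_smul, unit_mul_self, one_smul] at h2
  exact h2.symm

/-- An endomorphism commuting with `X = T^⋆ T` induces an endomorphism of `V'` through `T`. -/
lemma exists_descent_end (hT : Function.Surjective T) {a : End ℂ V}
    (h : a * S.moment S' T = S.moment S' T * a) : ∃ b : End ℂ V', T ∘ₗ a = b ∘ₗ T := by
  obtain ⟨σ, hσ⟩ := T.exists_rightInverse_of_surjective (LinearMap.range_eq_top.mpr hT)
  refine ⟨T ∘ₗ a ∘ₗ σ, ?_⟩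
  ext x
  simp only [LinearMap.comp_apply]
  rw [← sub_eq_zero, ← map_sub, ← map_sub, ← LinearMap.mem_ker, ← S.ker_moment S' hT,
    LinearMap.mem_ker, ← Module.End.mul_apply, ← h, Module.End.mul_apply]
  have h1 : x - σ (T x) ∈ LinearMap.ker (S.moment S' T) := by
    rw [S.ker_moment S' hT, LinearMap.mem_ker, map_sub, sub_eq_zero]
    exact (LinearMap.congr_fun hσ (T x)).symm
  rw [LinearMap.mem_ker.mp h1, map_zero]

lemma descent_dagger (hT : Function.Surjective T) {a : End ℂ V} {b c : End ℂ V'}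
    (h : a * S.moment S' T = S.moment S' T * a) (hb : T ∘ₗ a = b ∘ₗ T)
    (hc : T ∘ₗ S.dagger a = c ∘ₗ T) : c = S'.dagger b := by
  rw [← S'.dagger_dagger c]
  congr 1
  refine (S'.eq_dagger fun x y => ?_).symm
  obtain ⟨x, rfl⟩ := hT x
  obtain ⟨y, rfl⟩ := hT y
  have e1 : b (T y) = T (a y) := (LinearMap.congr_fun hb y).symm
  have e2 : c (T x) = T (S.dagger a x) := (LinearMap.congr_fun hc x).symm
  rw [e1, e2, ← form_moment, ← form_moment, form_dagger_left]
  exact congrArg (S.form x) (LinearMap.congr_fun h.symm y)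

lemma descent_unique (hT : Function.Surjective T) {a : End ℂ V} {b c : End ℂ V'}
    (hb : T ∘ₗ a = b ∘ₗ T) (hc : T ∘ₗ a = c ∘ₗ T) : b = c := by
  ext y
  obtain ⟨x, rfl⟩ := hT y
  exact LinearMap.congr_fun (hb.symm.trans hc) x

lemma descent_commute_L (hT : T ∈ S.Xcirc S') {a : End ℂ V} {b : End ℂ V'}
    (h : a * S.L = S.L * a) (hb : T ∘ₗ a = b ∘ₗ T) : b * S'.L = S'.L * b := by
  have hc : (-(Complex.I * ((δ : ℤ) : ℂ))) ≠ 0 := by simp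
  refine smul_right_injective _ hc ?_
  change (-(Complex.I * ((δ : ℤ) : ℂ))) • (b ∘ₗ S'.L) =
    (-(Complex.I * ((δ : ℤ) : ℂ))) • (S'.L ∘ₗ b)
  refine descent_unique (T := T) (a := a * S.L) hT.1 ?_ ?_
  · rw [LinearMap.smul_comp, LinearMap.comp_assoc, ← LinearMap.comp_smul, ← S.T_comp_L S' hT,
      ← LinearMap.comp_assoc, ← hb]
    rfl
  · rw [h, LinearMap.smul_comp, LinearMap.comp_assoc, ← hb, ← LinearMap.comp_assoc,
      ← LinearMap.smul_comp, ← S.T_comp_L S' hT]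
    rfl

lemma descent_commute_moment' (hT : Function.Surjective T) {a : End ℂ V} {b : End ℂ V'}
    (h : a * S.moment S' T = S.moment S' T * a) (hb : T ∘ₗ a = b ∘ₗ T) :
    b * S.moment' S' T = S.moment' S' T * b := by
  refine descent_unique (T := T) (a := a * S.moment S' T) hT ?_ ?_
  · change T ∘ₗ a ∘ₗ S.adj S' T ∘ₗ T = (b ∘ₗ T ∘ₗ S.adj S' T) ∘ₗ T
    rw [← LinearMap.comp_assoc, hb]
    rfl
  · rw [h]
    change (T ∘ₗ S.adj S' T) ∘ₗ T ∘ₗ a = ((T ∘ₗ S.adj S' T) ∘ₗ b) ∘ₗ T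
    rw [hb]
    rfl

/-- An endomorphism of `V'` commuting with `X' = T T^⋆` and with `L'` is induced by an endomorphism
of `V` commuting with `L`, which also restricts to it along `T^⋆`. -/
lemma exists_lift_end (hT : T ∈ S.Xcirc S') {b : End ℂ V'}
    (hb : b * S.moment' S' T = S.moment' S' T * b) (hL : b * S'.L = S'.L * b) :
    ∃ a : End ℂ V, T ∘ₗ a = b ∘ₗ T ∧ a ∘ₗ S.adj S' T = S.adj S' T ∘ₗ b ∧ a * S.L = S.L * a := by
  obtain ⟨σ, hσ⟩ := T.exists_rightInverse_of_surjective (LinearMap.range_eq_top.mpr hT.1)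
  obtain ⟨π, hπ⟩ := (S.adj S' T).exists_leftInverse_of_injective
    (LinearMap.ker_eq_bot.mpr (S.adj_injective S' hT.1))
  set c : ℂ := -(Complex.I * ((δ : ℤ) : ℂ)) with hc
  have hσ' : ∀ y, T (σ y) = y := fun y => LinearMap.congr_fun hσ y
  have hπ' : ∀ y, π (S.adj S' T y) = y := fun y => LinearMap.congr_fun hπ y
  have hbX : ∀ y, b (T (S.adj S' T y)) = T (S.adj S' T (b y)) := fun y =>
    LinearMap.congr_fun hb y
  have hbL : ∀ y, b (S'.L y) = S'.L (b y) := fun y => LinearMap.congr_fun hL y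
  have hTL : ∀ x, T (S.L x) = c • S'.L (T x) := fun x => LinearMap.congr_fun (S.T_comp_L S' hT) x
  have hAL : ∀ y, S.adj S' T (S'.L y) = c • S.L (S.adj S' T y) := fun y =>
    LinearMap.congr_fun (S.adj_comp_L S' hT) y
  have hcc : c * c = -1 := by
    rw [hc]
    linear_combination (((δ : ℤ) : ℂ) * ((δ : ℤ) : ℂ)) * Complex.I_mul_I - unit_mul_self δ
  have hd : ((δ : ℤ) : ℂ) * ((δ : ℤ) : ℂ) = 1 := unit_mul_self δ
  have hLA : ∀ y, S.L (S.adj S' T y) = (-c) • S.adj S' T (S'.L y) := by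
    intro y
    rw [hAL, smul_smul, neg_mul, hcc, neg_neg, one_smul]
  -- `a₀` is prescribed on the image of `T^⋆` and modulo the kernel of `T`; the two prescriptions are
  -- compatible because `b` commutes with `T T^⋆`
  obtain ⟨a₀, h1, h2⟩ : ∃ a₀ : End ℂ V, (∀ x, T (a₀ x) = b (T x)) ∧
      ∀ y, a₀ (S.adj S' T y) = S.adj S' T (b y) :=
    ⟨S.adj S' T ∘ₗ b ∘ₗ π + σ ∘ₗ (b ∘ₗ T - T ∘ₗ S.adj S' T ∘ₗ b ∘ₗ π),
      fun x => by simp [hσ'], fun y => by simp [hπ', hbX]⟩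
  -- averaging over conjugation by `L` makes the endomorphism commute with `L`
  refine ⟨(1 / 2 : ℂ) • (a₀ + ((δ : ℤ) : ℂ) • (S.L * a₀ * S.L)), ?_, ?_, ?_⟩
  · ext x
    simp only [LinearMap.comp_apply, LinearMap.smul_apply, LinearMap.add_apply,
      Module.End.mul_apply, map_smul, map_add]
    rw [hTL, h1, h1, hTL, map_smul, map_smul, hbL, S'.L_sq, neg_unit_cast]
    simp only [smul_smul]
    rw [show ((δ : ℤ) : ℂ) * (c * (c * -((δ : ℤ) : ℂ))) = 1 by
      linear_combination (-((δ : ℤ) : ℂ) * ((δ : ℤ) : ℂ)) * hcc + hd, one_smul, ← two_smul ℂ,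
      smul_smul]
    norm_num
  · ext y
    simp only [LinearMap.comp_apply, LinearMap.smul_apply, LinearMap.add_apply,
      Module.End.mul_apply]
    rw [hLA, map_smul, h2, h2, map_smul, hLA, hbL, S'.L_sq, neg_unit_cast]
    simp only [map_smul, smul_smul]
    rw [show ((δ : ℤ) : ℂ) * (-c * (-c * -((δ : ℤ) : ℂ))) = 1 by
      linear_combination (-((δ : ℤ) : ℂ) * ((δ : ℤ) : ℂ)) * hcc + hd, one_smul,
      ← two_smul ℂ, smul_smul]
    norm_num
  · rw [smul_mul_assoc, mul_smul_comm, add_mul, mul_add, smul_mul_assoc, mul_smul_comm]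
    congr 1
    rw [mul_assoc _ S.L S.L, L_mul_L, ← mul_assoc, ← mul_assoc, L_mul_L]
    simp [smul_smul, hd, add_comm]

end Basic

end CartanSpace

/-! ### Descent and lifting of stabilizers -/

namespace CartanSpace

/-- A polynomial which evaluates to an involution at `g`, with the values `1` at `1` and `-1` at
`-1`. By the Chinese remainder theorem it can be `-1` near the eigenvalue `-1` of `g` and `1` near
all other eigenvalues. -/
lemma exists_sign_polynomial {V : Type*} [AddCommGroup V] [Module ℂ V] [FiniteDimensional ℂ V]
    (g : End ℂ V) : ∃ f : Polynomial ℂ, Polynomial.aeval g f * Polynomial.aeval g f = 1 ∧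
      f.eval 1 = 1 ∧ f.eval (-1) = -1 := by
  obtain ⟨q, hq, hndvd⟩ := Polynomial.exists_eq_pow_rootMultiplicity_mul_and_not_dvd g.charpoly
    (LinearMap.charpoly_monic g).ne_zero (-1)
  set m := g.charpoly.rootMultiplicity (-1) with hm
  set l : Polynomial ℂ := Polynomial.X - Polynomial.C (-1) with hl
  set r : Polynomial ℂ := Polynomial.X - Polynomial.C 1 with hr
  have hirr : Irreducible l := Polynomial.irreducible_X_sub_C _
  have hlr : IsCoprime l r := by
    rw [hl, hr]
    exact Polynomial.isCoprime_X_sub_C_of_isUnit_sub (by norm_num)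
  have hlq : IsCoprime l q := (hirr.coprime_iff_not_dvd).mpr hndvd
  -- `b r q` is `1` modulo `l ^ (m + 1)` and `0` modulo `r q`. The extra factors `l` and `r` fix the
  -- values at `-1` and `1` even where these are not eigenvalues of `g`
  obtain ⟨a, b, hab⟩ := ((hlr.mul_right hlq).pow_left : IsCoprime (l ^ (m + 1)) (r * q))
  have hcp : Polynomial.aeval g (l ^ m * q) = 0 := by
    rw [← hq]
    exact LinearMap.aeval_self_charpoly g
  refine ⟨1 - 2 * (b * (r * q)), ?_, ?_, ?_⟩
  · rw [← map_mul]
    have : (1 - 2 * (b * (r * q))) * (1 - 2 * (b * (r * q))) =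
        1 - (4 * a * b * l * r) * (l ^ m * q) := by
      have h : a * l ^ (m + 1) = 1 - b * (r * q) := by rw [← hab]; ring
      linear_combination (4 * b * r * q) * h
    rw [this, map_sub, map_mul, hcp, mul_zero, sub_zero, map_one]
  · simp [hr]
  · have h := congrArg (Polynomial.eval (-1)) hab
    simp only [Polynomial.eval_add, Polynomial.eval_mul, Polynomial.eval_pow, hl,
      Polynomial.eval_sub, Polynomial.eval_X, Polynomial.eval_C, sub_self, Polynomial.eval_one] at h
    simp only [Polynomial.eval_sub, Polynomial.eval_one, Polynomial.eval_mul,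
      Polynomial.eval_ofNat]
    rw [zero_pow (Nat.succ_ne_zero m), mul_zero, zero_add] at h
    rw [h]
    norm_num

variable {ε δ : ℤˣ} {V : Type v} [AddCommGroup V] [Module ℂ V] [FiniteDimensional ℂ V]
  {V' : Type v} [AddCommGroup V'] [Module ℂ V'] [FiniteDimensional ℂ V']
  (S : CartanSpace ε δ V) (S' : CartanSpace (-ε) (-δ) V') {T : V →ₗ[ℂ] V'}

lemma comp_aeval_eq {T : V →ₗ[ℂ] V'} {a : End ℂ V} {b : End ℂ V'} (h : T ∘ₗ a = b ∘ₗ T)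
    (f : Polynomial ℂ) : T ∘ₗ Polynomial.aeval a f = Polynomial.aeval b f ∘ₗ T := by
  induction f using Polynomial.induction_on' with
  | add p q hp hq => rw [map_add, map_add, LinearMap.comp_add, LinearMap.add_comp, hp, hq]
  | monomial n c =>
    rw [Polynomial.aeval_monomial, Polynomial.aeval_monomial, Algebra.algebraMap_eq_smul_one,
      Algebra.algebraMap_eq_smul_one, smul_mul_assoc, smul_mul_assoc, one_mul, one_mul,
      LinearMap.comp_smul, LinearMap.smul_comp, comp_pow_eq h]

lemma mem_lieStab_iff {X x : End ℂ V} :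
    x ∈ S.lieStab X ↔ S.dagger x = -x ∧ x * S.L = S.L * x ∧ x * X = X * x := by
  rw [← mem_lieG_iff]
  rfl

lemma exists_descent_lieStab (hT : T ∈ S.Xcirc S') {x : End ℂ V}
    (hx : x ∈ S.lieStab (S.moment S' T)) :
    ∃ x' ∈ S'.lieStab (S.moment' S' T), T ∘ₗ x = x' ∘ₗ T := by
  obtain ⟨h1, h2, h3⟩ := S.mem_lieStab_iff.mp hx
  obtain ⟨x', hx'⟩ := S.exists_descent_end S' hT.1 h3
  refine ⟨x', S'.mem_lieStab_iff.mpr ⟨?_, S.descent_commute_L S' hT h2 hx',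
    S.descent_commute_moment' S' hT.1 h3 hx'⟩, hx'⟩
  refine (S.descent_dagger S' hT.1 h3 hx' ?_).symm
  rw [h1, LinearMap.comp_neg, hx', LinearMap.neg_comp]

/-- The map `𝔨_X → 𝔨'_{X'}` is surjective: any lift as a linear map may be replaced by its skew
part. -/
lemma exists_lift_lieStab (hT : T ∈ S.Xcirc S') {x' : End ℂ V'}
    (hx' : x' ∈ S'.lieStab (S.moment' S' T)) :
    ∃ x ∈ S.lieStab (S.moment S' T), T ∘ₗ x = x' ∘ₗ T := by
  obtain ⟨h1, h2, h3⟩ := S'.mem_lieStab_iff.mp hx'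
  obtain ⟨a, ha, ha', haL⟩ := S.exists_lift_end S' hT h3 h2
  have hd : T ∘ₗ S.dagger a = -(x' ∘ₗ T) := by
    rw [S.comp_dagger_of_comp_adj S' ha', h1, LinearMap.neg_comp]
  have hd' : S.dagger a ∘ₗ S.adj S' T = -(S.adj S' T ∘ₗ x') := by
    rw [S.dagger_comp_adj S' ha, h1, LinearMap.comp_neg]
  have e1 : T ∘ₗ ((1 / 2 : ℂ) • (a - S.dagger a)) = x' ∘ₗ T := by
    rw [LinearMap.comp_smul, LinearMap.comp_sub, ha, hd, sub_neg_eq_add, ← two_smul ℂ, smul_smul]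
    norm_num
  have e2 : ((1 / 2 : ℂ) • (a - S.dagger a)) ∘ₗ S.adj S' T = S.adj S' T ∘ₗ x' := by
    rw [LinearMap.smul_comp, LinearMap.sub_comp, ha', hd', sub_neg_eq_add, ← two_smul ℂ, smul_smul]
    norm_num
  refine ⟨(1 / 2 : ℂ) • (a - S.dagger a), S.mem_lieStab_iff.mpr ⟨?_, ?_, ?_⟩, e1⟩
  · rw [dagger_smul, dagger_sub, dagger_dagger, ← smul_neg, neg_sub]
  · rw [smul_mul_assoc, mul_smul_comm, sub_mul, mul_sub, haL, S.commute_dagger_L haL]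
  · change ((1 / 2 : ℂ) • (a - S.dagger a)) ∘ₗ S.adj S' T ∘ₗ T =
      (S.adj S' T ∘ₗ T) ∘ₗ ((1 / 2 : ℂ) • (a - S.dagger a))
    rw [LinearMap.comp_assoc, e1, ← LinearMap.comp_assoc, e2, LinearMap.comp_assoc]

lemma mul_L_of_mem_K {k : V ≃ₗ[ℂ] V} (hk : k ∈ S.K) :
    (k : End ℂ V) * S.L = S.L * (k : End ℂ V) := LinearMap.ext hk.2

lemma dagger_mul_self_of_mem_K {k : V ≃ₗ[ℂ] V} (hk : k ∈ S.K) :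
    S.dagger (k : End ℂ V) * (k : End ℂ V) = 1 := S.dagger_mul_self_of_mem_isom hk.1

lemma exists_descent_K (hT : T ∈ S.Xcirc S') {k : V ≃ₗ[ℂ] V} (hk : k ∈ S.K)
    (hX : (k : End ℂ V) * S.moment S' T = S.moment S' T * (k : End ℂ V)) :
    ∃ k' ∈ S'.K, T ∘ₗ (k : End ℂ V) = (k' : End ℂ V') ∘ₗ T ∧
      (k' : End ℂ V') * S.moment' S' T = S.moment' S' T * (k' : End ℂ V') := by
  obtain ⟨b, hb⟩ := S.exists_descent_end S' hT.1 hX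
  have hkk := S.dagger_mul_self_of_mem_K hk
  have hkk' := S.mul_dagger_self_of_mem_isom hk.1
  have hX' : S.dagger (k : End ℂ V) * S.moment S' T = S.moment S' T * S.dagger (k : End ℂ V) := by
    have h1 := congrArg S.dagger hX
    rw [dagger_mul, dagger_mul, dagger_moment, neg_mul, mul_neg, neg_inj] at h1
    exact h1.symm
  obtain ⟨c, hc⟩ := S.exists_descent_end S' hT.1 hX'
  have hcb := S.descent_dagger S' hT.1 hX hb hc
  have h1 : S'.dagger b * b = 1 := by
    rw [← hcb]
    refine descent_unique (T := T) (a := 1) hT.1 ?_ ?_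
    · rw [← hkk]
      change T ∘ₗ S.dagger k ∘ₗ (k : End ℂ V) = c ∘ₗ b ∘ₗ T
      rw [← LinearMap.comp_assoc, hc, LinearMap.comp_assoc, hb]
    · rfl
  obtain ⟨k', hk', rfl⟩ := S'.exists_mem_K h1 (S.descent_commute_L S' hT (S.mul_L_of_mem_K hk) hb)
  exact ⟨k', hk', hb, S.descent_commute_moment' S' hT.1 hX hb⟩

lemma comp_adj_of_mem_K {k : V ≃ₗ[ℂ] V} {k' : V' ≃ₗ[ℂ] V'} (hk : k ∈ S.K) (hk' : k' ∈ S'.K)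
    (h : T ∘ₗ (k : End ℂ V) = (k' : End ℂ V') ∘ₗ T) :
    (k : End ℂ V) ∘ₗ S.adj S' T = S.adj S' T ∘ₗ (k' : End ℂ V') := by
  have h1 := S.dagger_comp_adj S' h
  rw [S.mem_isom_iff.mp hk.1, S'.mem_isom_iff.mp hk'.1] at h1
  ext y
  have h2 := LinearMap.congr_fun h1 (k' y)
  simp only [LinearMap.comp_apply, LinearEquiv.coe_coe, LinearEquiv.symm_apply_apply] at h2
  simp only [LinearMap.comp_apply, LinearEquiv.coe_coe]
  rw [← h2, LinearEquiv.apply_symm_apply]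

lemma commute_moment_of_mem_K {k : V ≃ₗ[ℂ] V} {k' : V' ≃ₗ[ℂ] V'} (hk : k ∈ S.K) (hk' : k' ∈ S'.K)
    (h : T ∘ₗ (k : End ℂ V) = (k' : End ℂ V') ∘ₗ T) :
    (k : End ℂ V) * S.moment S' T = S.moment S' T * (k : End ℂ V) := by
  have h2 := S.comp_adj_of_mem_K S' hk hk' h
  change (k : End ℂ V) ∘ₗ S.adj S' T ∘ₗ T = (S.adj S' T ∘ₗ T) ∘ₗ (k : End ℂ V)
  rw [LinearMap.comp_assoc, h, ← LinearMap.comp_assoc, h2, LinearMap.comp_assoc]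

/-- The map `K_X → K'_{X'}` is surjective, a form of Witt's theorem. Decompose `k' = exp(y') s'` with
`y'` in `𝔨'_{X'}` and `s'` an involution. The element `y'` lifts to `𝔨_X`; a self-adjoint lift of `s'`
becomes an involution after applying a polynomial which fixes `1` and `-1`. -/
theorem exists_lift_K (hT : T ∈ S.Xcirc S') {k' : V' ≃ₗ[ℂ] V'} (hk' : k' ∈ S'.K)
    (hX : (k' : End ℂ V') * S.moment' S' T = S.moment' S' T * (k' : End ℂ V')) :
    ∃ k ∈ S.K, T ∘ₗ (k : End ℂ V) = (k' : End ℂ V') ∘ₗ T := by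
  obtain ⟨y', s', hy', hys, hss, hs', hcomm, -⟩ := S'.exists_expEnd_mul_involution hk'.1
  have hL' := S'.mul_L_of_mem_K hk'
  obtain ⟨hyL, hsL⟩ := hcomm S'.L hL'.symm (by
    rw [dagger_L, smul_mul_assoc, mul_smul_comm, hL'])
  obtain ⟨hyX, hsX⟩ := hcomm (S.moment' S' T) hX.symm (by
    rw [dagger_moment', neg_mul, mul_neg, hX])
  obtain ⟨x, hx, hxT⟩ := S.exists_lift_lieStab S' hT
    (S'.mem_lieStab_iff.mpr ⟨S'.mem_lieG_iff.mp hy', hyL.symm, hyX.symm⟩)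
  obtain ⟨hx1, hx2, -⟩ := S.mem_lieStab_iff.mp hx
  obtain ⟨a, ha, ha', haL⟩ := S.exists_lift_end S' hT hsX.symm hsL.symm
  -- a self-adjoint lift of the involution
  set g := (1 / 2 : ℂ) • (a + S.dagger a) with hg
  have hgd : S.dagger g = g := by
    rw [hg, dagger_smul, dagger_add, dagger_dagger, add_comm]
  have hgT : T ∘ₗ g = s' ∘ₗ T := by
    rw [hg, LinearMap.comp_smul, LinearMap.comp_add, ha, S.comp_dagger_of_comp_adj S' ha', hs',
      ← two_smul ℂ, smul_smul]
    norm_num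
  have hgL : g * S.L = S.L * g := by
    rw [hg, smul_mul_assoc, mul_smul_comm, add_mul, mul_add, haL, S.commute_dagger_L haL]
  obtain ⟨f, hf, hf1, hf2⟩ := exists_sign_polynomial g
  set s := Polynomial.aeval g f with hs
  have hsd : S.dagger s = s := by rw [hs, dagger_aeval, hgd]
  have hsL : s * S.L = S.L * s :=
    (Algebra.commute_of_mem_adjoin_singleton_of_commute
      (Polynomial.aeval_mem_adjoin_singleton ℂ g) hgL.symm).symm
  have hfs : Polynomial.aeval s' f = s' := by
    -- on the eigenspaces of the involution `s'` for `1` and `-1`, both sides agree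
    have hp : ∀ v, s' v = v → Polynomial.aeval s' f v = v := by
      intro v hv
      rw [aeval_apply_of_apply_eq_self hv, hf1, one_smul]
    have hn : ∀ v, s' v = -v → Polynomial.aeval s' f v = -v := by
      intro v hv
      by_cases h0 : v = 0
      · simp [h0]
      · have h1 : s'.HasEigenvector (-1) v := ⟨by simpa using hv, h0⟩
        rw [Module.End.aeval_apply_of_hasEigenvector h1, hf2, neg_one_smul]
    have hss' : ∀ v, s' (s' v) = v := fun v => LinearMap.congr_fun hss v
    ext v
    have e1 : v = (1 / 2 : ℂ) • (v + s' v) + (1 / 2 : ℂ) • (v - s' v) := by module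
    have h1 := hp (v + s' v) (by rw [map_add, hss', add_comm])
    have h2 := hn (v - s' v) (by rw [map_sub, hss', neg_sub])
    conv_lhs => rw [e1]
    rw [map_add, map_smul, map_smul, h1, h2]
    module
  have hsT : T ∘ₗ s = s' ∘ₗ T := by rw [hs, comp_aeval_eq hgT, hfs]
  obtain ⟨k, hk, hkk⟩ := S.exists_mem_K (a := expEnd x * s) (by
    rw [dagger_mul, dagger_expEnd, hx1, hsd, mul_assoc, ← mul_assoc (expEnd (-x)), expEnd_neg_mul,
      one_mul, hf]) (by
    rw [mul_assoc, hsL, ← mul_assoc, ← mul_assoc, expEnd_commute hx2.symm])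
  refine ⟨k, hk, ?_⟩
  rw [hkk, ← hys]
  change T ∘ₗ expEnd x ∘ₗ s = (expEnd y' ∘ₗ s') ∘ₗ T
  rw [← LinearMap.comp_assoc, comp_expEnd hxT, LinearMap.comp_assoc, hsT, LinearMap.comp_assoc]

end CartanSpace

/-! ### The trace of the adjoint action on `𝔨_X` -/

open scoped TensorProduct

namespace LinearMap

/-- Additivity of the trace in a short exact sequence. -/
lemma trace_eq_add_of_exact {A M B : Type*} [AddCommGroup A] [Module ℂ A] [FiniteDimensional ℂ A]
    [AddCommGroup M] [Module ℂ M] [FiniteDimensional ℂ M] [AddCommGroup B] [Module ℂ B]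
    [FiniteDimensional ℂ B] {i : A →ₗ[ℂ] M} {q : M →ₗ[ℂ] B} (hi : Function.Injective i)
    (hq : Function.Surjective q) (hiq : ∀ m, q m = 0 ↔ ∃ a, i a = m)
    {fA : End ℂ A} {f : End ℂ M} {fB : End ℂ B} (h1 : f ∘ₗ i = i ∘ₗ fA) (h2 : q ∘ₗ f = fB ∘ₗ q) :
    trace ℂ M f = trace ℂ A fA + trace ℂ B fB := by
  obtain ⟨σ, hσ⟩ := q.exists_rightInverse_of_surjective (range_eq_top.mpr hq)
  obtain ⟨r, hr⟩ := i.exists_leftInverse_of_injective (ker_eq_bot.mpr hi)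
  have hσ' : ∀ b, q (σ b) = b := fun b => LinearMap.congr_fun hσ b
  have hr' : ∀ a, r (i a) = a := fun a => LinearMap.congr_fun hr a
  -- `r'` is the retraction of `i` which vanishes on the image of `σ`
  set r' : M →ₗ[ℂ] A := r - r ∘ₗ σ ∘ₗ q with hr'_def
  have hqi : ∀ a, q (i a) = 0 := fun a => (hiq _).mpr ⟨a, rfl⟩
  have hri : r' ∘ₗ i = id := by
    ext a
    simp [r', hr', hqi]
  have hsum : i ∘ₗ r' + σ ∘ₗ q = id := by
    ext m
    obtain ⟨a, ha⟩ := (hiq (m - σ (q m))).mp (by rw [map_sub, hσ', sub_self])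
    have : r' m = a := by
      rw [← hr' a, ha]
      simp [r']
    simp [this, ha]
  have e1 : f = f ∘ₗ i ∘ₗ r' + f ∘ₗ σ ∘ₗ q := by
    rw [← comp_add, hsum, comp_id]
  rw [e1, map_add]
  congr 1
  · rw [← comp_assoc, trace_comp_comm', h1, ← comp_assoc, hri, id_comp]
  · rw [← comp_assoc, trace_comp_comm', ← comp_assoc, h2, comp_assoc, hσ, comp_id]

lemma trace_map_comp_comm {N : Type*} [AddCommGroup N] [Module ℂ N] [FiniteDimensional ℂ N]
    (A B : End ℂ N) :
    trace ℂ (N ⊗[ℂ] N) (TensorProduct.map A B ∘ₗ (TensorProduct.comm ℂ N N).toLinearMap) =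
      trace ℂ N (A * B) := by
  set b := finBasis ℂ N
  rw [trace_eq_matrix_trace ℂ (b.tensorProduct b), trace_eq_matrix_trace ℂ b, toMatrix_mul,
    Matrix.trace, Matrix.trace, Fintype.sum_prod_type]
  refine Finset.sum_congr rfl fun i _ => ?_
  rw [Matrix.diag_apply, Matrix.mul_apply]
  refine Finset.sum_congr rfl fun j _ => ?_
  rw [Matrix.diag_apply, toMatrix_apply, toMatrix_apply, toMatrix_apply]
  simp [mul_comm]

end LinearMap

namespace CartanSpace

variable {ε δ : ℤˣ} {V : Type v} [AddCommGroup V] [Module ℂ V] [FiniteDimensional ℂ V]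
  {V' : Type v} [AddCommGroup V'] [Module ℂ V'] [FiniteDimensional ℂ V']
  (S : CartanSpace ε δ V) (S' : CartanSpace (-ε) (-δ) V') {T : V →ₗ[ℂ] V'}

/-- The map `a ⊗ b ↦ (v ↦ ⟨b, v⟩ a)` from `N ⊗ N` to endomorphisms of `V`. -/
def tensorEnd (N : Submodule ℂ V) : N ⊗[ℂ] N →ₗ[ℂ] End ℂ V :=
  TensorProduct.lift (LinearMap.mk₂ ℂ (fun a b : N => (S.form b).smulRight (a : V))
    (by intros; ext; simp) (fun c a b => by
      ext v; exact smul_comm (S.form b v) c (a : V))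
    (by intros; ext; simp [add_smul]) (by intros; ext; simp [mul_smul]))

lemma tensorEnd_tmul (N : Submodule ℂ V) (a b : N) (v : V) :
    S.tensorEnd N (a ⊗ₜ b) v = S.form b v • (a : V) := rfl

/-- `N ⊗ N` is identified with the endomorphisms which have image in `N` and vanish on `N^⊥`. -/
lemma exists_inverse_tensorEnd (N : Submodule ℂ V) :
    ∃ ρ : End ℂ V →ₗ[ℂ] N ⊗[ℂ] N, (∀ t, ρ (S.tensorEnd N t) = t) ∧
      ∀ y : End ℂ V, (∀ v, y v ∈ N) → (∀ v, (∀ n ∈ N, S.form n v = 0) → y v = 0) →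
        S.tensorEnd N (ρ y) = y := by
  obtain ⟨P, hP⟩ := N.subtype.exists_leftInverse_of_injective N.ker_subtype
  have hP' : ∀ n : N, P n = n := fun n => LinearMap.congr_fun hP n
  set b := finBasis ℂ N with hb
  -- `d j` represents the `j`-th coordinate on `N`
  have hd : ∀ j, ∃ d : V, ∀ n : N, S.form n d = b.coord j n := by
    intro j
    refine ⟨(S.form.flip.toDual S.nondeg.flip).symm (b.coord j ∘ₗ P), fun n => ?_⟩
    have h := LinearMap.BilinForm.apply_toDual_symm_apply (hB := S.nondeg.flip)
      (b.coord j ∘ₗ P) (n : V)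
    rw [LinearMap.comp_apply, hP'] at h
    exact h
  choose d hd using hd
  let ρ : End ℂ V →ₗ[ℂ] N ⊗[ℂ] N :=
    ∑ j, (TensorProduct.mk ℂ N N).flip (b j) ∘ₗ P ∘ₗ LinearMap.applyₗ (d j)
  have hρ : ∀ y, ρ y = ∑ j, P (y (d j)) ⊗ₜ b j := by
    intro y
    simp [ρ]
  refine ⟨ρ, fun t => ?_, fun y hy1 hy2 => ?_⟩
  · induction t using TensorProduct.induction_on with
    | zero => simp
    | add s t hs ht => rw [map_add, map_add, hs, ht]
    | tmul a c =>
      rw [hρ]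
      simp only [tensorEnd_tmul, hd, map_smul, hP', TensorProduct.smul_tmul]
      rw [← TensorProduct.tmul_sum]
      congr 1
      exact b.sum_repr c
  · ext v
    rw [hρ, map_sum, LinearMap.sum_apply]
    simp only [tensorEnd_tmul]
    have h1 : ∀ j, ((P (y (d j)) : N) : V) = y (d j) := fun j =>
      congrArg Subtype.val (hP' ⟨y (d j), hy1 _⟩)
    simp only [h1, ← map_smul, ← map_sum]
    rw [eq_comm, ← sub_eq_zero, ← map_sub]
    refine hy2 _ fun n hn => ?_
    have h2 : (n : V) = ∑ j, b.coord j ⟨n, hn⟩ • ((b j : N) : V) := by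
      have := congrArg Subtype.val (b.sum_repr ⟨n, hn⟩)
      simp only [AddSubmonoidClass.coe_finsetSum, Submodule.coe_smul] at this
      exact this.symm
    rw [map_sub, map_sum, sub_eq_zero]
    simp only [map_smul, smul_eq_mul]
    conv_lhs => rw [h2]
    rw [map_sum, LinearMap.sum_apply]
    refine Finset.sum_congr rfl fun j _ => ?_
    rw [map_smul, LinearMap.smul_apply, smul_eq_mul, mul_comm]
    congr 1
    exact (hd j ⟨n, hn⟩).symm

/-- The surjection `𝔨_X → 𝔨'_{X'}`, `x ↦ x'` with `T x = x' T`. -/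
def lieDescent (hT : T ∈ S.Xcirc S') :
    S.lieStab (S.moment S' T) →ₗ[ℂ] S'.lieStab (S.moment' S' T) :=
  LinearMap.codRestrict _
    ((LinearMap.lcomp ℂ V'
        (T.exists_rightInverse_of_surjective (LinearMap.range_eq_top.mpr hT.1)).choose) ∘ₗ
      (LinearMap.llcomp ℂ V V V' T) ∘ₗ (S.lieStab (S.moment S' T)).subtype)
    (by
      intro x
      obtain ⟨x', hx', h⟩ := S.exists_descent_lieStab S' hT x.2
      have hσ := (T.exists_rightInverse_of_surjective (LinearMap.range_eq_top.mpr hT.1)).choose_spec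
      have : (T ∘ₗ x.1) ∘ₗ
          (T.exists_rightInverse_of_surjective (LinearMap.range_eq_top.mpr hT.1)).choose = x' := by
        rw [h, LinearMap.comp_assoc, hσ, LinearMap.comp_id]
      change (T ∘ₗ x.1) ∘ₗ _ ∈ S'.lieStab (S.moment' S' T)
      rw [this]
      exact hx')

lemma comp_lieDescent (hT : T ∈ S.Xcirc S') (x : S.lieStab (S.moment S' T)) :
    T ∘ₗ x.1 = (S.lieDescent S' hT x).1 ∘ₗ T := by
  obtain ⟨x', hx', h⟩ := S.exists_descent_lieStab S' hT x.2
  have hσ := (T.exists_rightInverse_of_surjective (LinearMap.range_eq_top.mpr hT.1)).choose_spec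
  have : (S.lieDescent S' hT x).1 = x' := by
    change (T ∘ₗ x.1) ∘ₗ
      (T.exists_rightInverse_of_surjective (LinearMap.range_eq_top.mpr hT.1)).choose = x'
    rw [h, LinearMap.comp_assoc, hσ, LinearMap.comp_id]
  rw [this, h]

lemma lieDescent_eq_iff (hT : T ∈ S.Xcirc S') {x : S.lieStab (S.moment S' T)}
    {x' : S'.lieStab (S.moment' S' T)} :
    S.lieDescent S' hT x = x' ↔ T ∘ₗ x.1 = x'.1 ∘ₗ T := by
  constructor
  · rintro rfl
    exact S.comp_lieDescent S' hT x
  · intro h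
    exact Subtype.ext (descent_unique hT.1 (S.comp_lieDescent S' hT x) h)

lemma lieDescent_surjective (hT : T ∈ S.Xcirc S') : Function.Surjective (S.lieDescent S' hT) := by
  intro x'
  obtain ⟨x, hx, h⟩ := S.exists_lift_lieStab S' hT x'.2
  exact ⟨⟨x, hx⟩, (S.lieDescent_eq_iff S' hT).mpr h⟩

lemma adStab_apply (X : End ℂ V) (x y : S.lieStab X) :
    (S.adStab X x y).1 = x.1 * y.1 - y.1 * x.1 := rfl

lemma lieDescent_adStab (hT : T ∈ S.Xcirc S') (x y : S.lieStab (S.moment S' T)) :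
    S.lieDescent S' hT (S.adStab _ x y) =
      S'.adStab _ (S.lieDescent S' hT x) (S.lieDescent S' hT y) := by
  rw [lieDescent_eq_iff, adStab_apply, adStab_apply, LinearMap.comp_sub, LinearMap.sub_comp]
  have hx := S.comp_lieDescent S' hT x
  have hy := S.comp_lieDescent S' hT y
  congr 1
  · rw [Module.End.mul_eq_comp, Module.End.mul_eq_comp, LinearMap.comp_assoc]
    rw [← LinearMap.comp_assoc, hx, LinearMap.comp_assoc, hy]
  · rw [Module.End.mul_eq_comp, Module.End.mul_eq_comp, LinearMap.comp_assoc]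
    rw [← LinearMap.comp_assoc, hy, LinearMap.comp_assoc, hx]

end CartanSpace

open scoped TensorProduct
namespace CartanSpace

variable {ε δ : ℤˣ} {V : Type v} [AddCommGroup V] [Module ℂ V] [FiniteDimensional ℂ V]
  {V' : Type v} [AddCommGroup V'] [Module ℂ V'] [FiniteDimensional ℂ V']
  (S : CartanSpace ε δ V) (S' : CartanSpace (-ε) (-δ) V') {T : V →ₗ[ℂ] V'}

lemma tensorEnd_map_add {N : Submodule ℂ V} {x : End ℂ V} (hx : S.dagger x = -x) {A : End ℂ N}
    (hA : ∀ n, ((A n : N) : V) = x n) (t : N ⊗[ℂ] N) :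
    S.tensorEnd N ((TensorProduct.map A 1 + TensorProduct.map 1 A : End ℂ (N ⊗[ℂ] N)) t) =
      x * S.tensorEnd N t - S.tensorEnd N t * x := by
  induction t using TensorProduct.induction_on with
  | zero => simp
  | add s t hs ht =>
    rw [map_add, map_add, hs, ht, map_add, mul_add, add_mul]
    abel
  | tmul a b =>
    ext v
    simp only [LinearMap.add_apply, TensorProduct.map_tmul, map_add, Module.End.one_apply,
      LinearMap.sub_apply, Module.End.mul_apply, tensorEnd_tmul, hA, map_smul]
    rw [← S.form_dagger, hx]
    simp [sub_eq_add_neg]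

lemma tensorEnd_map_L {N : Submodule ℂ V} {Λ : End ℂ N} (hΛ : ∀ n, ((Λ n : N) : V) = S.L n)
    (t : N ⊗[ℂ] N) :
    S.tensorEnd N (TensorProduct.map Λ Λ t) =
      ((δ : ℤ) : ℂ) • (S.L * S.tensorEnd N t * S.L) := by
  induction t using TensorProduct.induction_on with
  | zero => simp
  | add s t hs ht => rw [map_add, map_add, hs, ht, map_add, mul_add, add_mul, smul_add]
  | tmul a b =>
    ext v
    simp only [TensorProduct.map_tmul, Module.End.mul_apply, LinearMap.smul_apply, tensorEnd_tmul,
      hΛ, map_smul]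
    rw [← S.form_dagger, dagger_L, LinearMap.smul_apply, map_smul, smul_smul, smul_eq_mul]

lemma tensorEnd_comm {N : Submodule ℂ V} (t : N ⊗[ℂ] N) :
    S.tensorEnd N (TensorProduct.comm ℂ N N t) =
      ((ε : ℤ) : ℂ) • S.dagger (S.tensorEnd N t) := by
  induction t using TensorProduct.induction_on with
  | zero => simp [dagger_zero]
  | add s t hs ht => rw [map_add, map_add, hs, ht, map_add, dagger_add, smul_add]
  | tmul a b =>
    have h : S.tensorEnd N (b ⊗ₜ a) =
        S.dagger (((ε : ℤ) : ℂ) • S.tensorEnd N (a ⊗ₜ b)) := by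
      refine S.eq_dagger fun x y => ?_
      simp only [LinearMap.smul_apply, tensorEnd_tmul, map_smul, smul_eq_mul]
      rw [S.form_symm x b]
      ring
    rw [TensorProduct.comm_tmul, h, dagger_smul]

/-- The trace of `A ⊗ 1 + 1 ⊗ A` on the common fixed space of `- ε swap` and `Λ ⊗ Λ` in `N ⊗ N`,
where `A` and `Λ` commute and `Λ ^ 2` is a scalar. -/
lemma trace_fixed {N : Type*} [AddCommGroup N] [Module ℂ N] [FiniteDimensional ℂ N]
    (e d : ℂ) {A Λ : End ℂ N} (hΛ : Λ * Λ = d • 1) (hA : LinearMap.trace ℂ N A = 0) :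
    LinearMap.trace ℂ (N ⊗[ℂ] N) ((TensorProduct.map A 1 + TensorProduct.map 1 A) ∘ₗ
      ((1 / 4 : ℂ) • ((LinearMap.id + TensorProduct.map Λ Λ) ∘ₗ
        (LinearMap.id - e • (TensorProduct.comm ℂ N N).toLinearMap)))) =
      1 / 2 * (LinearMap.trace ℂ N (A * Λ) * LinearMap.trace ℂ N Λ) := by
  have hc : ∀ B C : End ℂ N, TensorProduct.map B C ∘ₗ TensorProduct.map Λ Λ =
      TensorProduct.map (B * Λ) (C * Λ) := fun B C => (TensorProduct.map_comp B C Λ Λ).symm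
  have e1 : (TensorProduct.map A 1 + TensorProduct.map 1 A) ∘ₗ
      ((1 / 4 : ℂ) • ((LinearMap.id + TensorProduct.map Λ Λ) ∘ₗ
        (LinearMap.id - e • (TensorProduct.comm ℂ N N).toLinearMap))) =
      (1 / 4 : ℂ) • (TensorProduct.map A 1 + TensorProduct.map 1 A +
        TensorProduct.map (A * Λ) Λ + TensorProduct.map Λ (A * Λ) -
        e • ((TensorProduct.map A 1 ∘ₗ (TensorProduct.comm ℂ N N).toLinearMap) +
          (TensorProduct.map 1 A ∘ₗ (TensorProduct.comm ℂ N N).toLinearMap) +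
          (TensorProduct.map (A * Λ) Λ ∘ₗ (TensorProduct.comm ℂ N N).toLinearMap) +
          (TensorProduct.map Λ (A * Λ) ∘ₗ (TensorProduct.comm ℂ N N).toLinearMap))) := by
    rw [LinearMap.comp_smul, ← LinearMap.comp_assoc]
    congr 1
    have e2 : (TensorProduct.map A 1 + TensorProduct.map 1 A) ∘ₗ
        (LinearMap.id + TensorProduct.map Λ Λ) =
        TensorProduct.map A 1 + TensorProduct.map 1 A +
        TensorProduct.map (A * Λ) Λ + TensorProduct.map Λ (A * Λ) := by
      rw [LinearMap.comp_add, LinearMap.comp_id, LinearMap.add_comp, hc, hc, one_mul]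
      abel
    rw [e2, LinearMap.comp_sub, LinearMap.comp_id, LinearMap.comp_smul]
    simp only [LinearMap.add_comp]
  rw [e1]
  have hAL : LinearMap.trace ℂ N (A * Λ * Λ) = 0 := by
    rw [mul_assoc, hΛ, mul_smul_comm, mul_one, map_smul, hA, smul_zero]
  have hAL' : LinearMap.trace ℂ N (Λ * (A * Λ)) = 0 := by
    rw [LinearMap.trace_mul_comm, hAL]
  simp only [map_smul, map_sub, map_add, LinearMap.trace_map_comp_comm,
    LinearMap.trace_tensorProduct', hA, hAL, hAL', mul_one, one_mul]
  simp only [smul_eq_mul]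
  ring

/-- The kernel of `𝔨_X → 𝔨'_{X'}`. -/
def lieKer (T : V →ₗ[ℂ] V') : Submodule ℂ (End ℂ V) :=
  S.lieStab (S.moment S' T) ⊓ LinearMap.ker (LinearMap.llcomp ℂ V V V' T)

lemma lieKer_le (T : V →ₗ[ℂ] V') : S.lieKer S' T ≤ S.lieStab (S.moment S' T) := inf_le_left

lemma mem_lieKer_iff {y : End ℂ V} :
    y ∈ S.lieKer S' T ↔ y ∈ S.lieStab (S.moment S' T) ∧ T ∘ₗ y = 0 := Iff.rfl

/-- The trace of `ad x` on the kernel of `𝔨_X → 𝔨'_{X'}`. This kernel consists of the elements of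
`N ⊗ N` fixed by `- ε swap` and by `L ⊗ L`, where `N` is the kernel of `T`. -/
lemma trace_ad_ker (x : S.lieStab (S.moment S' T))
    {N : Submodule ℂ V} (hN : ∀ n, n ∈ N ↔ T n = 0)
    {A Λ : End ℂ N} (hA : ∀ n, ((A n : N) : V) = x.1 n) (hΛ : ∀ n, ((Λ n : N) : V) = S.L n)
    (hA0 : LinearMap.trace ℂ _ A = 0) (f : End ℂ (S.lieKer S' T))
    (hf : ∀ y, ((f y : S.lieKer S' T) : End ℂ V) = x.1 * y.1 - y.1 * x.1) :
    LinearMap.trace ℂ _ f =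
      1 / 2 * (LinearMap.trace ℂ _ (A * Λ) * LinearMap.trace ℂ _ Λ) := by
  have hee : ((ε : ℤ) : ℂ) * ((ε : ℤ) : ℂ) = 1 := unit_mul_self ε
  have hdd : ((δ : ℤ) : ℂ) * ((δ : ℤ) : ℂ) = 1 := unit_mul_self δ
  obtain ⟨ρ, hρ1, hρ2⟩ := S.exists_inverse_tensorEnd N
  obtain ⟨hx1, hx2, hx3⟩ := S.mem_lieStab_iff.mp x.2
  set E := S.tensorEnd N with hE
  have hinj : Function.Injective E := Function.LeftInverse.injective hρ1
  have hTE : ∀ t, T ∘ₗ E t = 0 := by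
    intro t
    induction t using TensorProduct.induction_on with
    | zero => simp
    | add s t hs ht => rw [map_add, LinearMap.comp_add, hs, ht, add_zero]
    | tmul a b =>
      ext v
      rw [LinearMap.comp_apply, hE, tensorEnd_tmul, map_smul, (hN a).mp a.2, smul_zero]
      rfl
  have hEX : ∀ t, E t ∘ₗ S.adj S' T = 0 := by
    intro t
    induction t using TensorProduct.induction_on with
    | zero => simp
    | add s t hs ht => rw [map_add, LinearMap.add_comp, hs, ht, add_zero]
    | tmul a b =>
      ext v
      rw [LinearMap.comp_apply, hE, tensorEnd_tmul, form_adj, (hN b).mp b.2, map_zero,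
        LinearMap.zero_apply, zero_smul]
      rfl
  have hΛΛ : Λ * Λ = ((δ : ℤ) : ℂ) • 1 := by
    ext n
    simp [hΛ, S.L_sq]
  -- the projection onto the common fixed space of `- ε swap` and `Λ ⊗ Λ`
  set pr : End ℂ (N ⊗[ℂ] N) := (1 / 4 : ℂ) • ((LinearMap.id + TensorProduct.map Λ Λ) ∘ₗ
        (LinearMap.id - ((ε : ℤ) : ℂ) • (TensorProduct.comm ℂ N N).toLinearMap)) with hpr
  have hEpr : ∀ t, E (pr t) = (1 / 4 : ℂ) • ((E t - S.dagger (E t)) +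
      ((δ : ℤ) : ℂ) • (S.L * (E t - S.dagger (E t)) * S.L)) := by
    intro t
    have h1 : E ((LinearMap.id - ((ε : ℤ) : ℂ) • (TensorProduct.comm ℂ N N).toLinearMap :
        End ℂ (N ⊗[ℂ] N)) t) =
        E t - S.dagger (E t) := by
      simp only [LinearMap.sub_apply, LinearMap.id_apply, LinearMap.smul_apply, map_sub, map_smul,
        LinearEquiv.coe_coe]
      rw [hE, tensorEnd_comm, smul_smul, hee, one_smul]
    rw [hpr, LinearMap.smul_apply, map_smul, LinearMap.comp_apply, LinearMap.add_apply, map_add,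
      LinearMap.id_apply, h1, hE, S.tensorEnd_map_L hΛ, ← hE, h1]
  have hmem : ∀ t, E (pr t) ∈ S.lieStab (S.moment S' T) := by
    intro t
    rw [mem_lieStab_iff]
    refine ⟨?_, ?_, ?_⟩
    · rw [hEpr, dagger_smul, dagger_add, dagger_smul, dagger_mul, dagger_mul, dagger_sub,
        dagger_dagger, dagger_L, ← smul_neg]
      congr 1
      rw [neg_add, neg_sub, ← smul_neg]
      congr 2
      rw [smul_mul_assoc, mul_smul_comm, mul_smul_comm, smul_smul, hdd, one_smul, ← mul_assoc,
        ← neg_sub (E t), mul_neg, neg_mul]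
    · rw [hEpr]
      set B := E t - S.dagger (E t)
      rw [smul_mul_assoc, mul_smul_comm, add_mul, mul_add, smul_mul_assoc, mul_smul_comm]
      congr 1
      rw [mul_assoc _ S.L S.L, L_mul_L, ← mul_assoc, ← mul_assoc, L_mul_L]
      simp [smul_smul, hdd, add_comm]
    · have e1 : E (pr t) * S.moment S' T = 0 := by
        change E (pr t) ∘ₗ S.adj S' T ∘ₗ T = 0
        rw [← LinearMap.comp_assoc, hEX, LinearMap.zero_comp]
      have e2 : S.moment S' T * E (pr t) = 0 := by
        change (S.adj S' T ∘ₗ T) ∘ₗ E (pr t) = 0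
        rw [LinearMap.comp_assoc, hTE, LinearMap.comp_zero]
      rw [e1, e2]
  -- the projection of `N ⊗ N` onto the kernel, and the inclusion of the kernel into `N ⊗ N`
  let r : N ⊗[ℂ] N →ₗ[ℂ] S.lieKer S' T :=
    LinearMap.codRestrict _ (E ∘ₗ pr) fun t => ⟨hmem t, hTE _⟩
  let ι : S.lieKer S' T →ₗ[ℂ] N ⊗[ℂ] N := ρ ∘ₗ (S.lieKer S' T).subtype
  -- a skew `y` with image in `N` vanishes on `N^⊥`, hence comes from `N ⊗ N`
  have hEι : ∀ y : S.lieKer S' T, E (ι y) = y.1 := by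
    intro y
    have hyd := (S.mem_lieStab_iff.mp y.2.1).1
    refine hρ2 _ (fun v => (hN _).mpr (LinearMap.congr_fun y.2.2 v)) fun v hv => ?_
    refine S.eq_of_form_right fun z => ?_
    change S.form z (y.1 v) = _
    have h1 : S.form z (S.dagger (S.dagger y.1) v) = 0 := by
      rw [form_dagger, hyd, LinearMap.neg_apply, map_neg, LinearMap.neg_apply,
        hv _ ((hN _).mpr (LinearMap.congr_fun y.2.2 z)), neg_zero]
    rw [dagger_dagger] at h1
    rw [h1, map_zero]
  have hιr : ι ∘ₗ r = pr := by
    ext1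
    refine LinearMap.ext fun a => LinearMap.ext fun b => hinj ?_
    exact hEι _
  have hrι : r ∘ₗ ι = LinearMap.id := by
    ext y
    have hyd := (S.mem_lieStab_iff.mp y.2.1)
    have : E (pr (ι y)) = y.1 := by
      rw [hEpr, hEι, hyd.1, sub_neg_eq_add, ← two_smul ℂ, mul_smul_comm, smul_mul_assoc,
        ← hyd.2.1, mul_assoc, L_mul_L, mul_smul_comm, mul_one, smul_comm, smul_smul _ _ y.1,
        smul_smul, hdd]
      module
    exact LinearMap.congr_fun this _
  have hιf : ι ∘ₗ f = (TensorProduct.map A 1 + TensorProduct.map 1 A) ∘ₗ ι := by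
    ext y
    refine hinj ?_
    change E (ι (f y)) = E ((TensorProduct.map A 1 + TensorProduct.map 1 A : End ℂ (N ⊗[ℂ] N))
      (ι y))
    rw [hEι, hE, S.tensorEnd_map_add hx1 hA, ← hE, hEι,
      hf]
  have hfin : f = r ∘ₗ (ι ∘ₗ f) := by
    rw [← LinearMap.comp_assoc, hrι, LinearMap.id_comp]
  rw [hfin, LinearMap.trace_comp_comm', hιf, LinearMap.comp_assoc, hιr]
  exact trace_fixed _ _ hΛΛ hA0

/-- The trace formula comparing the adjoint actions on `𝔨_X` and `𝔨'_{X'}`. -/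
theorem dgamma_eq (hT : T ∈ S.Xcirc S') (x : S.lieStab (S.moment S' T))
    (x' : S'.lieStab (S.moment' S' T)) (h : T ∘ₗ x.1 = x'.1 ∘ₗ T) :
    S.dgamma _ x = S'.dgamma _ x' +
      1 / 2 * ((LinearMap.trace ℂ V (x.1 * S.L) +
          Complex.I * ((δ : ℤ) : ℂ) * LinearMap.trace ℂ V' (x'.1 * S'.L)) *
        (LinearMap.trace ℂ V S.L + Complex.I * ((δ : ℤ) : ℂ) * LinearMap.trace ℂ V' S'.L)) := by
  obtain ⟨hx1, hx2, hx3⟩ := S.mem_lieStab_iff.mp x.2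
  obtain ⟨hx1', hx2', hx3'⟩ := S'.mem_lieStab_iff.mp x'.2
  have hTL := S.T_comp_L S' hT
  set N := LinearMap.ker T with hN
  have hA : ∀ n ∈ N, x.1 n ∈ N := by
    intro n hn
    have := LinearMap.congr_fun h n
    rw [LinearMap.comp_apply, LinearMap.comp_apply, LinearMap.mem_ker.mp hn, map_zero] at this
    exact this
  have hΛ : ∀ n ∈ N, S.L n ∈ N := by
    intro n hn
    have := LinearMap.congr_fun hTL n
    rw [LinearMap.comp_apply, LinearMap.smul_apply, LinearMap.comp_apply, LinearMap.mem_ker.mp hn,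
      map_zero, smul_zero] at this
    exact this
  set A : End ℂ N := x.1.restrict hA
  set Λ : End ℂ N := S.L.restrict hΛ
  have key : ∀ {f : End ℂ V} {fN : End ℂ N} {fB : End ℂ V'}, (∀ n, ((fN n : N) : V) = f n) →
      T ∘ₗ f = fB ∘ₗ T → LinearMap.trace ℂ V f = LinearMap.trace ℂ N fN +
        LinearMap.trace ℂ V' fB := by
    intro f fN fB h1 h2
    refine LinearMap.trace_eq_add_of_exact N.injective_subtype hT.1 (fun m => ?_) ?_ h2
    · exact ⟨fun hm => ⟨⟨m, hm⟩, rfl⟩, by rintro ⟨n, rfl⟩; exact n.2⟩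
    · ext n
      exact (h1 n).symm
  -- traces of `x`, `L` and `x L` on the kernel of `T`, in terms of traces on `V` and on `V'`;
  -- skew endomorphisms have trace zero
  have t1 := key (f := x.1) (fN := A) (fun n => rfl) h
  rw [S.trace_eq_zero_of_dagger_eq_neg hx1, S'.trace_eq_zero_of_dagger_eq_neg hx1', add_zero] at t1
  have t2 := key (f := S.L) (fN := Λ) (fB := (-(Complex.I * ((δ : ℤ) : ℂ))) • S'.L)
    (fun n => rfl) (by rw [hTL, LinearMap.smul_comp])
  have t3 := key (f := x.1 * S.L) (fN := A * Λ)
    (fB := (-(Complex.I * ((δ : ℤ) : ℂ))) • (x'.1 * S'.L)) (fun n => rfl) (by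
      change T ∘ₗ x.1 ∘ₗ S.L = _
      rw [← LinearMap.comp_assoc, h, LinearMap.comp_assoc, hTL, LinearMap.comp_smul]
      rfl)
  rw [map_smul, smul_eq_mul] at t2 t3
  have hker : ∀ y ∈ S.lieKer S' T,
      (LinearMap.mulLeft ℂ x.1 - LinearMap.mulRight ℂ x.1) y ∈ S.lieKer S' T := by
    intro y hy
    refine ⟨S.commutator_mem_lieStab x.2 hy.1, ?_⟩
    change T ∘ₗ (x.1 ∘ₗ y - y ∘ₗ x.1) = 0
    have hy2 : T ∘ₗ y = 0 := hy.2
    rw [LinearMap.comp_sub, ← LinearMap.comp_assoc, ← LinearMap.comp_assoc, h, hy2,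
      LinearMap.comp_assoc, hy2, LinearMap.comp_zero, LinearMap.zero_comp, sub_zero]
  have t4 := S.trace_ad_ker S' x (N := N) (fun n => Iff.rfl) (A := A) (Λ := Λ)
    (fun n => rfl) (fun n => rfl) t1.symm
    ((LinearMap.mulLeft ℂ x.1 - LinearMap.mulRight ℂ x.1).restrict hker) (fun y => rfl)
  -- `𝔨_X` is an extension of `𝔨'_{X'}` by the kernel of the descent
  have t5 := LinearMap.trace_eq_add_of_exact
    (i := Submodule.inclusion (S.lieKer_le S' T))
    (Submodule.inclusion_injective _) (S.lieDescent_surjective S' hT)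
    (fun m => by
      rw [← LinearMap.mem_ker, LinearMap.mem_ker, lieDescent_eq_iff]
      constructor
      · intro hm
        exact ⟨⟨m.1, m.2, hm.trans (LinearMap.zero_comp _)⟩, rfl⟩
      · rintro ⟨n, rfl⟩
        exact (mem_lieKer_iff S S' |>.mp n.2).2.trans (LinearMap.zero_comp _).symm)
    (f := S.adStab _ x)
    (fA := (LinearMap.mulLeft ℂ x.1 - LinearMap.mulRight ℂ x.1).restrict hker)
    (fB := S'.adStab _ x')
    (by ext n; rfl) (by
      ext1 y
      rw [LinearMap.comp_apply, LinearMap.comp_apply, lieDescent_adStab,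
        (S.lieDescent_eq_iff S' hT).mpr h])
  unfold dgamma
  rw [t5, t4]
  rw [t2, t3]
  ring

end CartanSpace

/-! ### Automorphisms which are products of exponentials -/

namespace CartanSpace

variable {ε δ : ℤˣ} {V : Type v} [AddCommGroup V] [Module ℂ V] [FiniteDimensional ℂ V]
  (S : CartanSpace ε δ V)

/-- The monoid generated by the `exp y`, for `y ∈ 𝔨` vanishing on `W`. -/
def expMonoid (W : Submodule ℂ V) : Submonoid (End ℂ V) :=
  Submonoid.closure {a | ∃ y : End ℂ V, S.dagger y = -y ∧ y * S.L = S.L * y ∧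
    (∀ w ∈ W, y w = 0) ∧ a = expEnd y}

variable {S}

lemma expEnd_mem_expMonoid {W : Submodule ℂ V} {y : End ℂ V} (h1 : S.dagger y = -y)
    (h2 : y * S.L = S.L * y) (h3 : ∀ w ∈ W, y w = 0) : expEnd y ∈ S.expMonoid W :=
  Submonoid.subset_closure ⟨y, h1, h2, h3, rfl⟩

/-- The eigenvalues of `h` are `0, 1, -1`, so that `exp (π i h)` is `1` on the kernel of `h` and `-1` on
its range. -/
lemma expEnd_pi_mul {h : End ℂ V} (hh : h * h * h = h) :
    expEnd ((Real.pi * Complex.I : ℂ) • h) = 1 - (2 : ℂ) • (h * h) := by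
  have hh' : ∀ v, h (h (h v)) = h v := fun v => LinearMap.congr_fun hh v
  ext v
  have hv : v = (v - h (h v)) + ((1 / 2 : ℂ) • (h (h v) + h v) + (1 / 2 : ℂ) • (h (h v) - h v)) := by
    module
  have e0 : expEnd ((Real.pi * Complex.I : ℂ) • h) (v - h (h v)) = v - h (h v) := by
    apply expEnd_apply_of_eq_zero
    rw [LinearMap.smul_apply, map_sub, hh', sub_self, smul_zero]
  have e1 : expEnd ((Real.pi * Complex.I : ℂ) • h) (h (h v) + h v) = -(h (h v) + h v) := by
    rw [expEnd_apply_of_eq_smul (c := Real.pi * Complex.I), Complex.exp_pi_mul_I, neg_smul, one_smul]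
    rw [LinearMap.smul_apply, map_add, hh', add_comm]
  have e2 : expEnd ((Real.pi * Complex.I : ℂ) • h) (h (h v) - h v) = -(h (h v) - h v) := by
    rw [expEnd_apply_of_eq_smul (c := -(Real.pi * Complex.I)), Complex.exp_neg, Complex.exp_pi_mul_I,
      inv_neg, inv_one, neg_smul, one_smul]
    rw [LinearMap.smul_apply, map_sub, hh', neg_smul, ← smul_neg, neg_sub]
  conv_lhs => rw [hv]
  rw [map_add, map_add, map_smul, map_smul, e0, e1, e2]
  simp only [LinearMap.sub_apply, Module.End.one_apply, LinearMap.smul_apply, Module.End.mul_apply]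
  module

/-- If `δ = -1`, an involution in `K` is a single exponential, because multiplication by `L`
preserves its eigenspaces and `exp (π L) = -1`. -/
lemma involution_mem_expMonoid_of_neg {W : Submodule ℂ V} (hδ : δ = -1) {s : End ℂ V}
    (hs : s * s = 1) (hds : S.dagger s = s) (hL : s * S.L = S.L * s) (hW : ∀ w ∈ W, s w = w) :
    s ∈ S.expMonoid W := by
  have hLL := S.L_mul_L
  have hdL := S.dagger_L
  subst hδ
  simp only [Units.val_neg, Units.val_one, Int.cast_neg, Int.cast_one, neg_smul, one_smul] at hLL hdL
  set h : End ℂ V := (-(Complex.I) / 2) • (S.L * (1 - s)) with hh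
  have h2 : h * h = (1 / 2 : ℂ) • (1 - s) := by
    have : S.L * (1 - s) * (S.L * (1 - s)) = (-2 : ℂ) • (1 - s) := by
      have e : (1 - s) * S.L = S.L * (1 - s) := by rw [sub_mul, mul_sub, hL, one_mul, mul_one]
      have e2 : (1 - s) * (1 - s) = (2 : ℂ) • (1 - s) := by
        rw [sub_mul, mul_sub, mul_sub, hs, one_mul, one_mul, mul_one, two_smul]; abel
      rw [mul_assoc, ← mul_assoc (1 - s), e, mul_assoc, ← mul_assoc, hLL, e2, mul_smul_comm,
        neg_one_mul, smul_neg, neg_smul]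
    rw [hh, smul_mul_smul_comm, this, smul_smul]
    congr 1
    linear_combination (-1 / 2 : ℂ) * Complex.I_sq
  have h3 : h * h * h = h := by
    have e2 : (1 - s) * (1 - s) = (2 : ℂ) • (1 - s) := by
      rw [sub_mul, mul_sub, mul_sub, hs, one_mul, one_mul, mul_one, two_smul]; abel
    have e : (1 - s) * S.L = S.L * (1 - s) := by rw [sub_mul, mul_sub, hL, one_mul, mul_one]
    rw [h2, hh, smul_mul_smul_comm, ← mul_assoc, e, mul_assoc, e2, mul_smul_comm, smul_smul]
    congr 1
    ring
  have key := expEnd_pi_mul h3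
  have hs1 : s = 1 - (2 : ℂ) • (h * h) := by rw [h2]; module
  rw [hs1, ← key]
  apply expEnd_mem_expMonoid
  · rw [hh, dagger_smul, dagger_smul, dagger_mul, dagger_sub, dagger_one, hds, hdL, mul_neg, sub_mul,
      one_mul, hL, mul_sub, mul_one, smul_neg, smul_neg]
  · rw [hh, smul_mul_assoc, smul_mul_assoc, mul_smul_comm, mul_smul_comm, mul_assoc, sub_mul, one_mul,
      hL, mul_sub, mul_sub, mul_one, mul_sub]
  · intro w hw
    simp [hh, hW w hw]

/-- For a hyperbolic pair `u, w` this is the skew endomorphism `u ↦ u`, `w ↦ -w`. -/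
def hyp (S : CartanSpace ε δ V) (u w : V) : End ℂ V :=
  (S.form.flip w).smulRight u - (S.form u).smulRight w

lemma hyp_apply (u w v : V) : S.hyp u w v = S.form v w • u - S.form u v • w := rfl

lemma dagger_hyp (u w : V) : S.dagger (S.hyp u w) = -S.hyp u w := by
  symm
  apply S.eq_dagger
  intro x y
  have hee := unit_mul_self ε
  simp only [LinearMap.neg_apply, hyp_apply, map_neg, map_sub, map_smul, LinearMap.sub_apply,
    LinearMap.smul_apply, smul_eq_mul]
  rw [S.form_symm u x, S.form_symm w y]
  linear_combination (S.form y w * S.form x u) * hee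

lemma hyp_mul_L {u w : V} {η : ℂ} (hδ : δ = 1) (hu : S.L u = η • u) (hw : S.L w = η • w) :
    S.hyp u w * S.L = S.L * S.hyp u w := by
  have hL : ∀ x y, S.form (S.L x) y = S.form x (S.L y) := by
    intro x y
    rw [← S.L_form (S.L x) y, S.L_sq]
    simp [hδ]
  ext v
  simp only [Module.End.mul_apply, hyp_apply, map_sub, map_smul, hL v w, ← hL u v, hu, hw,
    LinearMap.smul_apply, smul_eq_mul]
  simp only [smul_smul]
  congr 2 <;> ring

/-- If `δ = 1`, an involution in `K` which is trivial on one eigenspace of `L` is a product of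
exponentials (when its determinant is `1` in the orthogonal case): its `-1`-eigenspace is a sum of
hyperbolic planes, and on each of them `-1` is `exp (π i h)` with `h` skew of eigenvalues `1, -1`. -/
lemma involution_mem_expMonoid {W : Submodule ℂ V} (hδ : δ = 1) {η : ℂ} :
    ∀ (n : ℕ) (s : End ℂ V), finrank ℂ (LinearMap.ker (s + 1)) = n → s * s = 1 →
    S.dagger s = s → s * S.L = S.L * s → (∀ w ∈ W, s w = w) →
    (∀ u, s u = -u → S.L u = η • u) → (ε = 1 → LinearMap.det s = 1) → s ∈ S.expMonoid W := by
  intro n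
  induction n using Nat.strong_induction_on with
  | _ n ih =>
  intro s hn hs hds hL hW hη hdet
  have hss : ∀ v, s (s v) = v := fun v => LinearMap.congr_fun hs v
  have hsf : ∀ x y, S.form (s x) y = S.form x (s y) := by
    intro x y; rw [← S.form_dagger, hds]
  -- the `-1`-eigenspace of `s` either contains an isotropic vector, which is completed to a
  -- hyperbolic pair, or it has dimension at most one
  by_cases hiso : ∃ u, u ≠ 0 ∧ s u = -u ∧ S.form u u = 0
  · obtain ⟨u, hu0, hsu, huu⟩ := hiso
    obtain ⟨z, hz⟩ : ∃ z, S.form u z = 1 := by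
      by_contra! hc
      refine hu0 (S.eq_of_form_left fun z => ?_)
      by_contra h0
      simp only [map_zero, LinearMap.zero_apply] at h0
      refine hc ((S.form u z)⁻¹ • z) ?_
      rw [map_smul, smul_eq_mul, inv_mul_cancel₀ h0]
    obtain ⟨w0, hw0, hsw0⟩ : ∃ w0, S.form u w0 = 1 ∧ s w0 = -w0 := by
      refine ⟨(1 / 2 : ℂ) • (z - s z), ?_, ?_⟩
      · rw [map_smul, map_sub, ← hsf, hsu, map_neg, LinearMap.neg_apply, hz]
        norm_num
      · rw [map_smul, map_sub, hss, ← smul_neg, neg_sub]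
    -- a multiple of `u` corrects `w0` to an isotropic vector
    obtain ⟨w, hw, hsw, hww⟩ : ∃ w, S.form u w = 1 ∧ s w = -w ∧ S.form w w = 0 := by
      refine ⟨w0 - (1 / 2 * S.form w0 w0) • u, ?_, ?_, ?_⟩
      · rw [map_sub, map_smul, huu, hw0]; simp
      · rw [map_sub, map_smul, hsw0, hsu, smul_neg, neg_sub]; abel
      · simp only [map_sub, map_smul, LinearMap.sub_apply, LinearMap.smul_apply, huu, hw0,
          S.form_symm w0 u, smul_eq_mul]
        rcases Int.units_eq_one_or ε with h | h
        · subst h; simp; ring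
        · subst h
          have := S.form_symm w0 w0
          simp only [Units.val_neg, Units.val_one, Int.cast_neg, Int.cast_one] at this
          have : S.form w0 w0 = 0 := by linear_combination this / 2
          simp [this]
    have hwu : S.form w u = ((ε : ℤ) : ℂ) := by rw [S.form_symm, hw, mul_one]
    set h := S.hyp u w with hh
    have hhu : h u = u := by rw [hh, hyp_apply, huu, hw]; simp
    have hhw : h w = -w := by rw [hh, hyp_apply, hww, hw]; simp
    have hhh : ∀ v, h (h v) = S.form v w • u + S.form u v • w := by
      intro v
      conv_lhs => rw [hh, hyp_apply (v := v), map_sub, map_smul, map_smul, ← hh]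
      rw [hhu, hhw, smul_neg, sub_neg_eq_add]
    have h3 : h * h * h = h := by
      ext v
      change h (h (h v)) = h v
      conv_lhs => rw [hhh, hh, hyp_apply]
      rw [hh, hyp_apply]
      simp only [map_sub, map_smul, LinearMap.sub_apply, LinearMap.smul_apply, hw, hww, huu,
        smul_eq_mul]
      module
    have key := expEnd_pi_mul h3
    have hhL : h * S.L = S.L * h := hyp_mul_L hδ (hη u hsu) (hη w hsw)
    have hskew : S.dagger ((Real.pi * Complex.I : ℂ) • h) = -((Real.pi * Complex.I : ℂ) • h) := by
      rw [dagger_smul, dagger_hyp, smul_neg]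
    have hse : s * (h * h) = -(h * h) := by
      ext v
      simp only [Module.End.mul_apply, LinearMap.neg_apply, hhh, map_add, map_smul, hsu, hsw]
      module
    have hes : h * h * s = -(h * h) := by
      ext v
      simp only [Module.End.mul_apply, LinearMap.neg_apply, hhh]
      rw [hsf, ← hsf u, hsu, hsw]
      simp only [map_neg, LinearMap.neg_apply]
      module
    have hee : h * h * (h * h) = h * h := by rw [← mul_assoc, h3]
    have hexp : expEnd ((Real.pi * Complex.I : ℂ) • h) ∈ S.expMonoid W := by
      refine expEnd_mem_expMonoid hskew ?_ ?_
      · rw [smul_mul_assoc, mul_smul_comm, hhL]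
      · intro x hx
        have h1 := hsf x w
        rw [hW x hx, hsw, map_neg] at h1
        have h2 := hsf u x
        rw [hW x hx, hsu, map_neg, LinearMap.neg_apply] at h2
        have h1' : S.form x w = 0 := by linear_combination h1 / 2
        have h2' : S.form u x = 0 := by linear_combination -h2 / 2
        rw [LinearMap.smul_apply, hh, hyp_apply, h1', h2']
        simp
    have hs' : s = (s + (2 : ℂ) • (h * h)) * expEnd ((Real.pi * Complex.I : ℂ) • h) := by
      rw [key, mul_sub, mul_one, add_mul, mul_smul_comm, mul_smul_comm, smul_mul_assoc, hse, hee]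
      module
    rw [hs']
    refine Submonoid.mul_mem _ ?_ hexp
    -- `s + 2 h ^ 2` is `s` with its sign changed on the hyperbolic plane, where `h ^ 2 = 1`
    have hlt : finrank ℂ (LinearMap.ker (s + (2 : ℂ) • (h * h) + 1)) < n := by
      rw [← hn]
      apply Submodule.finrank_lt_finrank_of_lt
      refine lt_of_le_of_ne ?_ ?_
      · intro v hv
        rw [LinearMap.mem_ker] at hv ⊢
        have h1 : (h * h) ((s + (2 : ℂ) • (h * h) + 1) v) = 0 := by rw [hv, map_zero]
        rw [← Module.End.mul_apply, mul_add, mul_add, mul_smul_comm, hes, hee] at h1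
        have h2 : (2 : ℂ) • (h * h) v = 0 := by
          rw [← h1]
          simp only [LinearMap.add_apply, LinearMap.neg_apply, LinearMap.smul_apply, mul_one]
          module
        rw [LinearMap.add_apply, LinearMap.add_apply, LinearMap.smul_apply, h2, add_zero] at hv
        exact hv
      · intro heq
        have h1 : u ∈ LinearMap.ker (s + (2 : ℂ) • (h * h) + 1) := by
          rw [heq, LinearMap.mem_ker]; simp [hsu]
        rw [LinearMap.mem_ker] at h1
        simp [hsu, hhu, hu0] at h1
    refine ih _ hlt (s + (2 : ℂ) • (h * h)) rfl ?_ ?_ ?_ ?_ ?_ ?_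
    · rw [mul_add, add_mul, add_mul, mul_smul_comm, mul_smul_comm, smul_mul_assoc, smul_mul_assoc,
        hse, hes, hee, hs]
      module
    · rw [dagger_add, dagger_smul, dagger_mul, dagger_hyp, hds, neg_mul_neg]
    · rw [add_mul, mul_add, hL, smul_mul_assoc, mul_smul_comm, mul_assoc, hhL, ← mul_assoc, hhL,
        mul_assoc]
    · intro x hx
      have h1 : (h * h) x = 0 := by
        have h2 := LinearMap.congr_fun hes x
        rw [Module.End.mul_apply, hW x hx, LinearMap.neg_apply] at h2
        have h3 : (2 : ℂ) • (h * h) x = 0 := by rw [two_smul]; nth_rewrite 1 [h2]; simp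
        simpa using h3
      rw [LinearMap.add_apply, LinearMap.smul_apply, h1, hW x hx, smul_zero, add_zero]
    · intro v hv
      apply hη
      have h1 : (h * h) ((s + (2 : ℂ) • (h * h)) v) = -(h * h) v := by rw [hv, map_neg]
      rw [← Module.End.mul_apply, mul_add, mul_smul_comm, hes, hee] at h1
      have h2 : (2 : ℂ) • (h * h) v = 0 := by
        have h3 : (-(h * h) + (2 : ℂ) • (h * h)) v + (h * h) v = 0 := by rw [h1]; simp
        rw [← h3]
        simp only [LinearMap.add_apply, LinearMap.neg_apply, LinearMap.smul_apply]
        module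
      rw [LinearMap.add_apply, LinearMap.smul_apply, h2, add_zero] at hv
      exact hv
    · intro hε
      have h1 := hdet hε
      rw [hs', map_mul, det_expEnd, S.trace_eq_zero_of_dagger_eq_neg hskew, Complex.exp_zero,
        mul_one] at h1
      exact h1
  · by_cases hu : ∃ u, u ≠ 0 ∧ s u = -u
    · exfalso
      obtain ⟨u, hu0, hsu⟩ := hu
      have huu : S.form u u ≠ 0 := fun h => hiso ⟨u, hu0, hsu, h⟩
      have hε : ε = 1 := by
        rcases Int.units_eq_one_or ε with h | h
        · exact h
        · subst h
          have := S.form_symm u u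
          simp only [Units.val_neg, Units.val_one, Int.cast_neg, Int.cast_one] at this
          exact absurd (by linear_combination this / 2) huu
      subst hε
      have hsymm : ∀ x y, S.form x y = S.form y x := by
        intro x y; rw [S.form_symm]; simp
      have hspan : ∀ v, s v = -v → v = (S.form u v / S.form u u) • u := by
        intro v hv
        set v1 := v - (S.form u v / S.form u u) • u with hv1
        have h1 : S.form u v1 = 0 := by
          rw [hv1, map_sub, map_smul, smul_eq_mul, div_mul_cancel₀ _ huu, sub_self]
        obtain ⟨t, ht⟩ := IsAlgClosed.exists_pow_nat_eq (-(S.form v1 v1) / S.form u u) (n := 2)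
          (by norm_num)
        have h2 : v1 + t • u = 0 := by
          by_contra hne
          refine hiso ⟨_, hne, ?_, ?_⟩
          · rw [hv1]; simp only [map_add, map_sub, map_smul, hv, hsu]; module
          · simp only [map_add, map_smul, LinearMap.add_apply, LinearMap.smul_apply, h1,
              hsymm v1 u, smul_eq_mul]
            field_simp at ht
            linear_combination ht
        have h3 : t = 0 := by
          have h4 : S.form u (v1 + t • u) = 0 := by rw [h2, map_zero]
          rw [map_add, h1, map_smul, smul_eq_mul, zero_add] at h4
          exact (mul_eq_zero.mp h4).resolve_right huu
        rw [h3, zero_smul, add_zero] at h2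
        exact sub_eq_zero.mp h2
      -- an involution with `-1`-eigenspace spanned by `u` is a reflection, of determinant `-1`
      have hs2 : s = LinearMap.transvection ((-2 / S.form u u) • S.form u) u := by
        ext v
        have h1 := hspan (v - s v) (by rw [map_sub, hss, neg_sub])
        rw [map_sub, ← hsf, hsu, map_neg, LinearMap.neg_apply] at h1
        rw [LinearMap.transvection.apply]
        have h2 : s v = v - (v - s v) := by abel
        rw [h2, h1, LinearMap.smul_apply, smul_eq_mul]
        rw [sub_eq_add_neg, ← neg_smul]
        congr 2
        ring
      have h1 := hdet rfl
      rw [hs2, LinearMap.transvection.det, LinearMap.smul_apply, smul_eq_mul,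
        div_mul_cancel₀ _ huu] at h1
      norm_num at h1
    · have : s = 1 := by
        ext v
        by_contra hne
        refine hu ⟨v - s v, ?_, by rw [map_sub, hss, neg_sub]⟩
        intro h0
        exact hne (sub_eq_zero.mp h0).symm
      rw [this]
      exact Submonoid.one_mem _

variable (S)

/-- The projection of `V` onto the `η`-eigenspace of `L`, when `δ = 1`. -/
def signProj (η : ℤˣ) : End ℂ V := (1 / 2 : ℂ) • (1 + ((η : ℤ) : ℂ) • S.L)

lemma signProj_add_neg (η : ℤˣ) : S.signProj η + S.signProj (-η) = 1 := by
  simp only [signProj, Units.val_neg, Int.cast_neg]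
  module

lemma signProj_mul_self (hδ : δ = 1) (η : ℤˣ) : S.signProj η * S.signProj η = S.signProj η := by
  have h1 := S.L_mul_L
  have h2 := unit_mul_self η
  have h3 : ((δ : ℤ) : ℂ) = 1 := by simp [hδ]
  rw [h3, one_smul] at h1
  simp only [signProj, smul_mul_smul_comm, mul_add, add_mul, mul_one, one_mul, h1, h2]
  module

lemma signProj_mul_neg (hδ : δ = 1) (η : ℤˣ) : S.signProj η * S.signProj (-η) = 0 := by
  have h1 := S.signProj_add_neg η
  rw [← eq_sub_iff_add_eq'] at h1
  rw [h1, mul_sub, mul_one, S.signProj_mul_self hδ, sub_self]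

lemma commute_signProj {a : End ℂ V} (h : a * S.L = S.L * a) (η : ℤˣ) :
    a * S.signProj η = S.signProj η * a := by
  simp only [signProj, mul_smul_comm, smul_mul_assoc, mul_add, add_mul, h, mul_one, one_mul]

lemma dagger_signProj (hδ : δ = 1) (η : ℤˣ) : S.dagger (S.signProj η) = S.signProj η := by
  have h3 : ((δ : ℤ) : ℂ) = 1 := by simp [hδ]
  rw [signProj, dagger_smul, dagger_add, dagger_one, dagger_smul, dagger_L, h3, one_smul]

lemma signPart_mul (hδ : δ = 1) (η : ℤˣ) {a b : End ℂ V} (hb : b * S.L = S.L * b) :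
    (a * S.signProj η + S.signProj (-η)) * (b * S.signProj η + S.signProj (-η)) =
      a * b * S.signProj η + S.signProj (-η) := by
  have h1 := S.signProj_mul_neg hδ (-η)
  rw [neg_neg] at h1
  rw [mul_add, add_mul, add_mul, S.commute_signProj hb, ← mul_assoc (S.signProj (-η)), h1, zero_mul,
    S.signProj_mul_self hδ (-η), mul_assoc a (S.signProj η) (S.signProj (-η)),
    S.signProj_mul_neg hδ, mul_zero, mul_assoc a, ← mul_assoc (S.signProj η) (S.signProj η) b,
    S.signProj_mul_self hδ, ← S.commute_signProj hb]
  simp [mul_assoc]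

/-- The determinant on the `η`-eigenspace of `L`, as a character of `K`, when `δ = 1`. -/
def signDet (hδ : δ = 1) (η : ℤˣ) : S.K →* ℂˣ :=
  MonoidHom.toHomUnits
    { toFun := fun k => LinearMap.det ((k.1 : End ℂ V) * S.signProj η + S.signProj (-η))
      map_one' := by
        have : ((1 : S.K).1 : End ℂ V) = 1 := rfl
        rw [this, one_mul, signProj_add_neg, map_one]
      map_mul' := by
        intro a b
        rw [← map_mul, S.signPart_mul hδ η (S.mul_L_of_mem_K b.2)]
        rfl }

lemma coe_signDet (hδ : δ = 1) (η : ℤˣ) (k : S.K) : (S.signDet hδ η k : ℂ) =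
    LinearMap.det ((k.1 : End ℂ V) * S.signProj η + S.signProj (-η)) := rfl

lemma dagger_signPart_mul (hδ : δ = 1) (η : ℤˣ) {k : V ≃ₗ[ℂ] V} (hk : k ∈ S.K) :
    S.dagger ((k : End ℂ V) * S.signProj η + S.signProj (-η)) *
      ((k : End ℂ V) * S.signProj η + S.signProj (-η)) = 1 := by
  have hL := S.mul_L_of_mem_K hk
  have hL' : S.dagger (k : End ℂ V) * S.L = S.L * S.dagger (k : End ℂ V) := by
    rw [S.commute_dagger_L hL]
  rw [dagger_add, dagger_mul, S.dagger_signProj hδ, S.dagger_signProj hδ,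
    ← S.commute_signProj hL' η, S.signPart_mul hδ η hL, S.dagger_mul_self_of_mem_K hk, one_mul,
    signProj_add_neg]

lemma det_dagger (a : End ℂ V) : LinearMap.det (S.dagger a) = LinearMap.det a := by
  have h : S.dagger a = ((S.form.flip.toDual S.nondeg.flip).symm.toLinearMap ∘ₗ a.dualMap) ∘ₗ
      (S.form.flip.toDual S.nondeg.flip).symm.symm.toLinearMap := by
    ext x
    rfl
  rw [h, LinearMap.comp_assoc, LinearMap.det_conj, LinearMap.det_dualMap]

lemma signDet_mul_self (hδ : δ = 1) (η : ℤˣ) (k : S.K) :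
    S.signDet hδ η k * S.signDet hδ η k = 1 := by
  apply Units.ext
  have h1 := congrArg LinearMap.det (S.dagger_signPart_mul hδ η k.2)
  rw [map_mul, map_one, det_dagger] at h1
  exact h1

variable {S}

/-- An element of `K` which is trivial on an `L`-stable subspace `W` is a product of exponentials of
elements of `𝔨` vanishing on `W`, as soon as its two determinants are `1` in the real orthogonal
case. -/
theorem mem_expMonoid_of_fixes {W : Submodule ℂ V} {k : V ≃ₗ[ℂ] V} (hk : k ∈ S.K)
    (hWL : ∀ w ∈ W, S.L w ∈ W) (hW : ∀ w ∈ W, k w = w)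
    (hdet : ε = 1 → ∀ (hδ : δ = 1) (η : ℤˣ), S.signDet hδ η ⟨k, hk⟩ = 1) :
    (k : End ℂ V) ∈ S.expMonoid W := by
  rcases Int.units_eq_one_or δ with hδ | hδ
  -- `k` is the product of its two restrictions to the eigenspaces of `L`, extended by the identity
  · have main : ∀ η : ℤˣ,
        (k : End ℂ V) * S.signProj η + S.signProj (-η) ∈ S.expMonoid W := by
      intro η
      have hL := S.mul_L_of_mem_K hk
      have hPL : ∀ ζ, S.signProj ζ * S.L = S.L * S.signProj ζ := fun ζ => by
        rw [S.commute_signProj rfl]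
      obtain ⟨g, hg, hgk⟩ := S.exists_mem_K (S.dagger_signPart_mul hδ η hk) (by
        rw [add_mul, mul_add, mul_assoc, hPL, hPL, ← mul_assoc, hL, mul_assoc])
      obtain ⟨y, s, hy, hys, hss, hds, hcomm, hfix⟩ := S.exists_expEnd_mul_involution hg.1
      have hgL := S.mul_L_of_mem_K hg
      obtain ⟨hyL, hsL⟩ := hcomm S.L hgL.symm (by rw [dagger_L, smul_mul_assoc, mul_smul_comm, hgL])
      have hgW : ∀ w ∈ W, g w = w := by
        intro w hw
        have hPw : ∀ ζ, S.signProj ζ w ∈ W := fun ζ => by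
          rw [signProj, LinearMap.smul_apply, LinearMap.add_apply, LinearMap.smul_apply]
          exact W.smul_mem _ (W.add_mem hw (W.smul_mem _ (hWL w hw)))
        have h1 := LinearMap.congr_fun hgk w
        rw [LinearEquiv.coe_coe] at h1
        rw [h1, LinearMap.add_apply, Module.End.mul_apply, LinearEquiv.coe_coe, hW _ (hPw η),
          ← LinearMap.add_apply, signProj_add_neg, Module.End.one_apply]
      have hgP : ∀ v, g (S.signProj (-η) v) = S.signProj (-η) v := by
        intro v
        have h1 := LinearMap.congr_fun hgk (S.signProj (-η) v)
        rw [LinearEquiv.coe_coe] at h1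
        rw [h1, LinearMap.add_apply, Module.End.mul_apply, ← Module.End.mul_apply (S.signProj η),
          S.signProj_mul_neg hδ, ← Module.End.mul_apply (S.signProj (-η)), S.signProj_mul_self hδ]
        simp
      have hdy : S.dagger y = -y := S.mem_lieG_iff.mp hy
      rw [← hgk, ← hys]
      refine Submonoid.mul_mem _ (expEnd_mem_expMonoid hdy hyL.symm
        fun w hw => (hfix w (hgW w hw)).1) ?_
      refine involution_mem_expMonoid hδ (η := ((η : ℤ) : ℂ)) _ s rfl hss hds hsL.symm
        (fun w hw => (hfix w (hgW w hw)).2) ?_ ?_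
      · intro u hu
        have h1 : S.signProj (-η) u = 0 := by
          have h2 := LinearMap.congr_fun (S.commute_signProj hsL.symm (-η)) u
          rw [Module.End.mul_apply, Module.End.mul_apply, (hfix _ (hgP u)).2, hu, map_neg] at h2
          have h3 : (2 : ℂ) • S.signProj (-η) u = 0 := by
            rw [two_smul]; nth_rewrite 1 [h2]; simp
          simpa using h3
        have hηη := unit_mul_self η
        simp only [signProj, LinearMap.smul_apply, LinearMap.add_apply, Module.End.one_apply,
          Units.val_neg, Int.cast_neg] at h1
        have h2 : u + -((η : ℤ) : ℂ) • S.L u = 0 :=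
          (smul_eq_zero.mp h1).resolve_left (by norm_num)
        have h3 := congrArg (fun v => ((η : ℤ) : ℂ) • v) h2
        simp only [smul_add, smul_smul, mul_neg, hηη, smul_zero] at h3
        rw [neg_smul, one_smul] at h3
        exact (sub_eq_zero.mp (by rw [sub_eq_add_neg]; exact h3)).symm
      · intro hε
        have h1 := congrArg Units.val (hdet hε hδ η)
        rw [coe_signDet] at h1
        change LinearMap.det ((k : End ℂ V) * S.signProj η + S.signProj (-η)) = 1 at h1
        rw [← hgk, ← hys, map_mul, det_expEnd, S.trace_eq_zero_of_dagger_eq_neg hdy,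
          Complex.exp_zero, one_mul] at h1
        exact h1
    have h1 := Submonoid.mul_mem _ (main 1) (main (-1))
    rw [neg_neg] at h1
    have h2 : ((k : End ℂ V) * S.signProj 1 + S.signProj (-1)) *
        ((k : End ℂ V) * S.signProj (-1) + S.signProj 1) = k := by
      have hL := S.mul_L_of_mem_K hk
      have e1 := S.signProj_mul_neg hδ (-1)
      rw [neg_neg] at e1
      rw [mul_add, add_mul, add_mul, S.commute_signProj hL (-1), mul_assoc,
        ← mul_assoc (S.signProj 1) (S.signProj (-1)), S.signProj_mul_neg hδ, zero_mul, mul_zero,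
        ← mul_assoc, S.signProj_mul_self hδ, mul_assoc, S.signProj_mul_self hδ, e1, zero_add,
        add_zero, ← S.commute_signProj hL (-1), ← mul_add, add_comm, signProj_add_neg, mul_one]
    rwa [h2] at h1
  · obtain ⟨y, s, hy, hys, hss, hds, hcomm, hfix⟩ := S.exists_expEnd_mul_involution hk.1
    have hgL := S.mul_L_of_mem_K hk
    obtain ⟨hyL, hsL⟩ := hcomm S.L hgL.symm (by rw [dagger_L, smul_mul_assoc, mul_smul_comm, hgL])
    rw [← hys]
    exact Submonoid.mul_mem _ (expEnd_mem_expMonoid (S.mem_lieG_iff.mp hy) hyL.symm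
      fun w hw => (hfix w (hW w hw)).1)
      (involution_mem_expMonoid_of_neg hδ hss hds hsL.symm fun w hw => (hfix w (hW w hw)).2)

end CartanSpace

/-! ### Characters of the component group -/

namespace CartanSpace

variable {ε δ : ℤˣ} {V : Type v} [AddCommGroup V] [Module ℂ V] [FiniteDimensional ℂ V]
  {S : CartanSpace ε δ V}

open scoped Matrix.Norms.Operator in
lemma continuous_exp_smul_mat (y : End ℂ V) :
    Continuous fun t : ℝ => mat (expEnd ((t : ℂ) • y)) := by
  let _ : NormedAlgebra ℚ (Matrix (Fin (finrank ℂ V)) (Fin (finrank ℂ V)) ℂ) :=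
    NormedAlgebra.restrictScalars ℚ ℂ _
  have h : (fun t : ℝ => mat (expEnd ((t : ℂ) • y))) =
      fun t : ℝ => NormedSpace.exp ((t : ℂ) • mat y) := by
    funext t
    rw [mat_expEnd, mat, map_smul]
    rfl
  rw [h]
  refine NormedSpace.exp_continuous.comp ?_
  fun_prop

lemma exists_mem_K_expEnd {y : End ℂ V} (h1 : S.dagger y = -y) (h2 : y * S.L = S.L * y) :
    ∃ k : S.K, (k.1 : End ℂ V) = expEnd y := by
  obtain ⟨k, hk, h⟩ := S.exists_mem_K (a := expEnd y) (by rw [dagger_expEnd, h1, expEnd_neg_mul])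
    (expEnd_commute h2.symm).symm
  exact ⟨⟨k, hk⟩, h⟩

/-- Exponentials are joined to `1` by a one-parameter group, so that characters of the component group
are trivial on them. -/
lemma componentDual_expEnd (χ : S.componentDual) {y : End ℂ V} (h1 : S.dagger y = -y)
    (h2 : y * S.L = S.L * y) {k : S.K} (hk : (k.1 : End ℂ V) = expEnd y) : χ.1 k = 1 := by
  have hex : ∀ t : ℝ, ∃ k : S.K, (k.1 : End ℂ V) = expEnd ((t : ℂ) • y) := fun t =>
    exists_mem_K_expEnd (by rw [dagger_smul, h1, smul_neg])
      (by rw [smul_mul_assoc, mul_smul_comm, h2])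
  choose f hf using hex
  have hinj : ∀ {a b : S.K}, (a.1 : End ℂ V) = b.1 → a = b := fun h =>
    Subtype.ext (LinearEquiv.toLinearMap_injective h)
  have hf0 : f 0 = 1 := hinj (by rw [hf, Complex.ofReal_zero, zero_smul, expEnd_zero]; rfl)
  have hf1 : f 1 = k := hinj (by rw [hf, Complex.ofReal_one, one_smul, hk])
  apply χ.2
  let _ : TopologicalSpace S.K := S.topK
  have hc : Continuous f := by
    rw [continuous_induced_rng]
    refine (continuous_exp_smul_mat y).congr fun t => ?_
    rw [Function.comp_apply, hf]
  have hpre : IsPreconnected (Set.range f) := isPreconnected_range hc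
  exact hpre.subset_connectedComponent ⟨0, hf0⟩ ⟨1, hf1⟩

/-- A property of elements of `K` which is multiplicative and holds for exponentials of elements
of `𝔨` vanishing on `W` holds for all products of such exponentials. -/
lemma induction_expMonoid {W : Submodule ℂ V} (P : S.K → Prop) (h1 : P 1)
    (hmul : ∀ a b, P a → P b → P (a * b))
    (hexp : ∀ y : End ℂ V, S.dagger y = -y → y * S.L = S.L * y → (∀ w ∈ W, y w = 0) →
      ∀ k : S.K, (k.1 : End ℂ V) = expEnd y → P k)
    (k : S.K) (hk : (k.1 : End ℂ V) ∈ S.expMonoid W) : P k := by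
  have hinj : ∀ {a b : S.K}, (a.1 : End ℂ V) = b.1 → a = b := fun h =>
    Subtype.ext (LinearEquiv.toLinearMap_injective h)
  have key : ∀ a ∈ S.expMonoid W, ∃ k : S.K, (k.1 : End ℂ V) = a ∧ P k := by
    intro a ha
    induction ha using Submonoid.closure_induction with
    | mem a ha =>
      obtain ⟨y, hy1, hy2, hy3, rfl⟩ := ha
      obtain ⟨k, hk⟩ := exists_mem_K_expEnd hy1 hy2
      exact ⟨k, hk, hexp y hy1 hy2 hy3 k hk⟩
    | one => exact ⟨1, rfl, h1⟩
    | mul a b _ _ ha hb =>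
      obtain ⟨k, hk, hPk⟩ := ha
      obtain ⟨l, hl, hPl⟩ := hb
      exact ⟨k * l, by rw [← hk, ← hl]; rfl, hmul k l hPk hPl⟩
  obtain ⟨k', hk', hP⟩ := key _ hk
  rwa [← hinj hk']

/-- A character of the component group is determined by the two determinants in the real orthogonal
case, and it is trivial in the other cases. -/
lemma componentDual_eq_one (χ : S.componentDual) (k : S.K)
    (hdet : ε = 1 → ∀ (hδ : δ = 1) (η : ℤˣ), S.signDet hδ η k = 1) : χ.1 k = 1 := by
  refine induction_expMonoid (W := ⊥) (fun k => χ.1 k = 1) (map_one _)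
    (fun a b ha hb => by rw [map_mul, ha, hb, one_mul])
    (fun y h1 h2 _ k hk => componentDual_expEnd χ h1 h2 hk) k ?_
  refine mem_expMonoid_of_fixes k.2 ?_ ?_ hdet
  · intro w hw
    rw [Submodule.mem_bot] at hw ⊢
    rw [hw, map_zero]
  · intro w hw
    rw [Submodule.mem_bot] at hw
    rw [hw, map_zero]

/-- The determinant on an eigenspace of `L` is continuous with values `1` and `-1`. -/
lemma signDet_mem_componentDual (hδ : δ = 1) (η : ℤˣ) : S.signDet hδ η ∈ S.componentDual := by
  intro k hk
  let _ : TopologicalSpace S.K := S.topK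
  have hc : Continuous fun k : S.K => (S.signDet hδ η k : ℂ) := by
    have h1 : Continuous fun k : S.K => mat (k.1 : End ℂ V) := continuous_induced_dom
    have h2 : (fun k : S.K => (S.signDet hδ η k : ℂ)) = fun k : S.K =>
        (mat (k.1 : End ℂ V) * mat (S.signProj η) + mat (S.signProj (-η))).det := by
      funext k
      rw [coe_signDet, ← LinearMap.det_toMatrix (finBasis ℂ V), map_add, LinearMap.toMatrix_mul]
      rfl
    rw [h2]
    exact ((h1.matrix_mul continuous_const).add continuous_const).matrix_det
  have hfin : ({1, -1} : Set ℂ).Finite := by simp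
  have := isPreconnected_connectedComponent.constant_of_mapsTo (S := connectedComponent (1 : S.K))
    (T := {1, -1}) hfin.isDiscrete hc.continuousOn
    (fun k _ => by
      have h := congrArg Units.val (S.signDet_mul_self hδ η k)
      exact mul_self_eq_one_iff.mp h) hk mem_connectedComponent
  apply Units.ext
  rw [this, map_one]

/-! ### Regular functions -/

section Regular

variable {H : Subgroup S.Kt}

lemma regular_linear (φ : Dual ℂ (End ℂ V)) :
    (fun k : H => φ (S.toGL k.1 : End ℂ V)) ∈ S.regularFunctions H :=
  Algebra.subset_adjoin (Or.inl (Or.inl ⟨φ, rfl⟩))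

lemma regular_linear_inv (φ : Dual ℂ (End ℂ V)) :
    (fun k : H => φ (S.toGL k.1⁻¹ : End ℂ V)) ∈ S.regularFunctions H :=
  Algebra.subset_adjoin (Or.inl (Or.inr ⟨φ, rfl⟩))

lemma regular_toC : (fun k : H => (S.toC k.1 : ℂ)) ∈ S.regularFunctions H :=
  Algebra.subset_adjoin (Or.inr (Or.inl rfl))

lemma regular_toC_inv : (fun k : H => (S.toC k.1⁻¹ : ℂ)) ∈ S.regularFunctions H :=
  Algebra.subset_adjoin (Or.inr (Or.inr rfl))

lemma regular_const (c : ℂ) : (fun _ : H => c) ∈ S.regularFunctions H :=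
  (S.regularFunctions H).algebraMap_mem c

lemma regular_det {W : Type*} [AddCommGroup W] [Module ℂ W] [FiniteDimensional ℂ W]
    {f : H → End ℂ W} (hf : ∀ φ : Dual ℂ (End ℂ W), (fun k => φ (f k)) ∈ S.regularFunctions H) :
    (fun k => LinearMap.det (f k)) ∈ S.regularFunctions H := by
  have h1 : (fun k => LinearMap.det (f k)) = ∑ σ : Equiv.Perm (Fin (finrank ℂ W)),
      ((Equiv.Perm.sign σ : ℤ) : ℂ) • ∏ i, fun k => mat (f k) (σ i) i := by
    funext k
    rw [← LinearMap.det_toMatrix (finBasis ℂ W), Matrix.det_apply', Finset.sum_apply]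
    refine Finset.sum_congr rfl fun σ _ => ?_
    rw [Pi.smul_apply, Finset.prod_apply]
    rfl
  rw [h1]
  refine Subalgebra.sum_mem _ fun σ _ => Subalgebra.smul_mem _ (Subalgebra.prod_mem _ fun i _ => ?_) _
  exact hf (Matrix.entryLinearMap ℂ ℂ (σ i) i ∘ₗ
    (LinearMap.toMatrix (finBasis ℂ W) (finBasis ℂ W)).toLinearMap)

lemma regular_det_linear {W : Type*} [AddCommGroup W] [Module ℂ W] [FiniteDimensional ℂ W]
    (Λ : End ℂ V →ₗ[ℂ] End ℂ W) (b : End ℂ W) :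
    (fun k : H => LinearMap.det (Λ (S.toGL k.1 : End ℂ V) + b)) ∈ S.regularFunctions H := by
  refine regular_det fun φ => ?_
  simp only [map_add]
  exact Subalgebra.add_mem _ (regular_linear (φ ∘ₗ Λ)) (regular_const _)

lemma regular_det_linear_inv {W : Type*} [AddCommGroup W] [Module ℂ W] [FiniteDimensional ℂ W]
    (Λ : End ℂ V →ₗ[ℂ] End ℂ W) (b : End ℂ W) :
    (fun k : H => LinearMap.det (Λ (S.toGL k.1⁻¹ : End ℂ V) + b)) ∈ S.regularFunctions H := by
  refine regular_det fun φ => ?_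
  simp only [map_add]
  exact Subalgebra.add_mem _ (regular_linear_inv (φ ∘ₗ Λ)) (regular_const _)

/-- A character of `H` is regular in all its powers if it and its inverse are regular. -/
lemma regular_zpow {ψ : S.Kt →* ℂˣ} (h1 : (fun k : H => (ψ k.1 : ℂ)) ∈ S.regularFunctions H)
    (h2 : (fun k : H => (ψ k.1⁻¹ : ℂ)) ∈ S.regularFunctions H) (m : ℤ) :
    (fun k : H => ((ψ k.1 ^ m : ℂˣ) : ℂ)) ∈ S.regularFunctions H := by
  obtain ⟨n, rfl | rfl⟩ := m.eq_nat_or_neg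
  · have : (fun k : H => ((ψ k.1 ^ (n : ℤ) : ℂˣ) : ℂ)) = (fun k : H => (ψ k.1 : ℂ)) ^ n := by
      funext k; simp
    rw [this]
    exact Subalgebra.pow_mem _ h1 n
  · have : (fun k : H => ((ψ k.1 ^ (-(n : ℤ)) : ℂˣ) : ℂ)) = (fun k : H => (ψ k.1⁻¹ : ℂ)) ^ n := by
      funext k; simp
    rw [this]
    exact Subalgebra.pow_mem _ h2 n

/-- The projection onto `𝒳_V`, when `δ = -1`. -/
def projI (S : CartanSpace ε δ V) : End ℂ V := (1 / 2 : ℂ) • (1 - Complex.I • S.L)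

lemma projI_mem (hδ : δ = -1) (v : V) : S.projI v ∈ S.eigI := by
  rw [Module.End.mem_eigenspace_iff]
  simp only [projI, LinearMap.smul_apply, LinearMap.sub_apply, Module.End.one_apply, map_smul,
    map_sub, S.L_sq]
  have : ((δ : ℤ) : ℂ) = -1 := by simp [hδ]
  rw [this]
  have hI := Complex.I_sq
  match_scalars
  · linear_combination (1 / 2 : ℂ) * hI
  · ring

lemma projI_of_mem {v : V} (hv : v ∈ S.eigI) : S.projI v = v := by
  rw [Module.End.mem_eigenspace_iff] at hv
  simp only [projI, LinearMap.smul_apply, LinearMap.sub_apply, Module.End.one_apply, hv]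
  have hI := Complex.I_sq
  match_scalars
  linear_combination (-1 / 2 : ℂ) * hI

/-- Restriction to `𝒳_V`, extended to a linear map on all endomorphisms of `V`. -/
def compressI (S : CartanSpace ε δ V) (hδ : δ = -1) : End ℂ V →ₗ[ℂ] End ℂ S.eigI where
  toFun a := (S.projI.codRestrict S.eigI (projI_mem hδ)) ∘ₗ a ∘ₗ S.eigI.subtype
  map_add' a b := by ext; simp
  map_smul' c a := by ext; simp

lemma compressI_of_mem (hδ : δ = -1) (k : S.K) :
    S.compressI hδ (k.1 : End ℂ V) = S.resI k := by
  ext v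
  exact projI_of_mem (S.mem_eigI_of_commute (f := (k.1 : V →ₗ[ℂ] V)) k.2.2 v v.2)

lemma regular_detI (hδ : δ = -1) (m : ℤ) :
    (fun k : H => ((S.detI (S.toK k.1) ^ m : ℂˣ) : ℂ)) ∈ S.regularFunctions H := by
  have key : ∀ k : S.Kt, ((S.detI (S.toK k) : ℂˣ) : ℂ) =
      LinearMap.det (S.compressI hδ (S.toGL k : End ℂ V) + 0) := by
    intro k
    rw [add_zero]
    exact congrArg LinearMap.det (compressI_of_mem hδ (S.toK k)).symm
  refine regular_zpow (ψ := S.detI.comp S.toK) ?_ ?_ m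
  · simp only [MonoidHom.comp_apply, key]
    exact regular_det_linear _ _
  · simp only [MonoidHom.comp_apply, key]
    exact regular_det_linear_inv _ _

lemma regular_varsigma (m : ℤ) :
    (fun k : H => (S.varsigma m k.1 : ℂ)) ∈ S.regularFunctions H := by
  unfold varsigma
  split_ifs with h1 h2
  · exact regular_zpow (ψ := S.toC) regular_toC regular_toC_inv m
  · exact regular_detI h2.2 _
  · exact regular_const 1

lemma regular_signDet (hδ : δ = 1) (η : ℤˣ) :
    (fun k : H => (S.signDet hδ η (S.toK k.1) : ℂ)) ∈ S.regularFunctions H :=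
  regular_det_linear (LinearMap.mulRight ℂ (S.signProj η)) _

/-- A character of the component group is a function of two determinants with values `1` and `-1`,
hence a polynomial in them. -/
lemma regular_componentDual (χ : S.componentDual) :
    (fun k : H => (χ.1 (S.toK k.1) : ℂ)) ∈ S.regularFunctions H := by
  by_cases hε : ε = 1 ∧ δ = 1
  · obtain ⟨hε, hδ⟩ := hε
    set a : H → ℂ := fun k => (S.signDet hδ 1 (S.toK k.1) : ℂ) with ha
    set b : H → ℂ := fun k => (S.signDet hδ (-1) (S.toK k.1) : ℂ) with hb
    have hval : ∀ (η : ℤˣ) (k : S.K), (S.signDet hδ η k : ℂ) = 1 ∨ (S.signDet hδ η k : ℂ) = -1 :=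
      fun η k => mul_self_eq_one_iff.mp (congrArg Units.val (S.signDet_mul_self hδ η k))
    have hfac : ∀ k l : H, a k = a l → b k = b l → χ.1 (S.toK k.1) = χ.1 (S.toK l.1) := by
      intro k l h1 h2
      have h3 := componentDual_eq_one χ (S.toK k.1 * (S.toK l.1)⁻¹) (by
        intro _ hδ η
        rw [map_mul, map_inv, mul_inv_eq_one]
        rcases Int.units_eq_one_or η with rfl | rfl
        · exact Units.ext h1
        · exact Units.ext h2)
      rwa [map_mul, map_inv, mul_inv_eq_one] at h3
    classical
    -- the value of `χ` where the determinants are `α` and `β`; if they do not occur, the value `0` is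
    -- arbitrary
    let c : ℂ → ℂ → ℂ := fun α β =>
      if h : ∃ l : H, a l = α ∧ b l = β then (χ.1 (S.toK h.choose.1) : ℂ) else 0
    have hc : ∀ k : H, c (a k) (b k) = (χ.1 (S.toK k.1) : ℂ) := by
      intro k
      have h : ∃ l : H, a l = a k ∧ b l = b k := ⟨k, rfl, rfl⟩
      simp only [c]
      rw [dif_pos h]
      exact congrArg Units.val (hfac _ _ h.choose_spec.1 h.choose_spec.2)
    have ha' : a ∈ S.regularFunctions H := regular_signDet hδ 1
    have hb' : b ∈ S.regularFunctions H := regular_signDet hδ (-1)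
    have h1 : (fun k : H => (χ.1 (S.toK k.1) : ℂ)) =
        (c 1 1 / 4) • ((1 + a) * (1 + b)) + (c 1 (-1) / 4) • ((1 + a) * (1 - b)) +
        (c (-1) 1 / 4) • ((1 - a) * (1 + b)) + (c (-1) (-1) / 4) • ((1 - a) * (1 - b)) := by
      funext k
      rw [← hc]
      simp only [Pi.add_apply, Pi.smul_apply, Pi.mul_apply, Pi.sub_apply, Pi.one_apply, smul_eq_mul]
      rcases hval 1 (S.toK k.1) with h1 | h1 <;> rcases hval (-1) (S.toK k.1) with h2 | h2 <;>
      · change a k = _ at h1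
        change b k = _ at h2
        rw [h1, h2]
        ring
    rw [h1]
    have hone := Subalgebra.one_mem (S.regularFunctions H)
    refine add_mem (add_mem (add_mem ?_ ?_) ?_) ?_ <;> refine Subalgebra.smul_mem _ (mul_mem ?_ ?_) _
    exacts [add_mem hone ha', add_mem hone hb', add_mem hone ha', sub_mem hone hb',
      sub_mem hone ha', add_mem hone hb', sub_mem hone ha', sub_mem hone hb']
  · have : (fun k : H => (χ.1 (S.toK k.1) : ℂ)) = fun _ => 1 := by
      funext k
      rw [componentDual_eq_one χ _ fun h1 h2 => absurd ⟨h1, h2⟩ hε, Units.val_one]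
    rw [this]
    exact regular_const 1

end Regular

end CartanSpace

/-! ### Signatures and the half canonical character -/

namespace CartanSpace

variable {ε δ : ℤˣ} {V : Type v} [AddCommGroup V] [Module ℂ V] [FiniteDimensional ℂ V]
  {V' : Type v} [AddCommGroup V'] [Module ℂ V'] [FiniteDimensional ℂ V']
  (S : CartanSpace ε δ V) (S' : CartanSpace (-ε) (-δ) V') {T : V →ₗ[ℂ] V'}

/-- A skew symmetric Gram matrix of odd size is singular. -/
lemma even_finrank (S : CartanSpace ε δ V) (hε : ε = -1) : Even (finrank ℂ V) := by
  set b := finBasis ℂ V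
  set A := LinearMap.BilinForm.toMatrix b S.form with hA
  have hdet : A.det ≠ 0 :=
    (LinearMap.BilinForm.nondegenerate_iff_det_ne_zero b).mp S.nondeg
  have hT : A.transpose = -A := by
    ext i j
    rw [Matrix.transpose_apply, Matrix.neg_apply, hA, LinearMap.BilinForm.toMatrix_apply,
      LinearMap.BilinForm.toMatrix_apply, S.form_symm]
    simp [hε]
  by_contra hodd
  rw [Nat.not_even_iff_odd] at hodd
  have h1 := A.det_transpose
  rw [hT, Matrix.det_neg, Fintype.card_fin, hodd.neg_one_pow] at h1
  exact hdet (by linear_combination -h1 / 2)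

/-- The dimension of an eigenspace of `L` is the trace of the projection onto it. -/
lemma finrank_eigenspace {c : ℂ} (hc : c * c = ((δ : ℤ) : ℂ)) :
    (finrank ℂ (Module.End.eigenspace S.L c) : ℂ) =
      1 / 2 * (finrank ℂ V + ((δ : ℤ) : ℂ) * c * LinearMap.trace ℂ V S.L) := by
  have hdd := unit_mul_self δ
  have hproj : LinearMap.IsProj (Module.End.eigenspace S.L c)
      ((1 / 2 : ℂ) • (1 + (((δ : ℤ) : ℂ) * c) • S.L)) := by
    constructor
    · intro v
      rw [Module.End.mem_eigenspace_iff]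
      simp only [LinearMap.smul_apply, LinearMap.add_apply, Module.End.one_apply, map_smul,
        map_add, S.L_sq]
      match_scalars
      · linear_combination (-(1 / 2 : ℂ) * ((δ : ℤ) : ℂ)) * hc - (1 / 2 : ℂ) * hdd
      · linear_combination (1 / 2 * c : ℂ) * hdd
    · intro v hv
      rw [Module.End.mem_eigenspace_iff] at hv
      simp only [LinearMap.smul_apply, LinearMap.add_apply, Module.End.one_apply, hv]
      match_scalars
      linear_combination (1 / 2 * ((δ : ℤ) : ℂ)) * hc + (1 / 2 : ℂ) * hdd
  rw [← hproj.trace, map_smul, map_add, map_smul, LinearMap.trace_one, smul_eq_mul, smul_eq_mul]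

lemma trace_L_eq_zero (hδ : δ = -1) : LinearMap.trace ℂ V S.L = 0 := by
  apply S.trace_eq_zero_of_dagger_eq_neg
  rw [dagger_L]
  simp [hδ]

lemma sign_sub_of_pos (hδ : δ = 1) :
    LinearMap.trace ℂ V S.L = (S.signPos : ℂ) - S.signNeg := by
  have h1 : ((δ : ℤ) : ℂ) = 1 := by simp [hδ]
  have h2 := S.finrank_eigenspace (c := 1) (by rw [h1, one_mul])
  have h3 := S.finrank_eigenspace (c := -1) (by rw [h1]; ring)
  rw [signPos, signNeg, if_pos hδ, if_pos hδ, h2, h3, h1]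
  ring

lemma sign_add : (S.signPos : ℂ) + S.signNeg = finrank ℂ V := by
  rcases Int.units_eq_one_or δ with hδ | hδ
  · have h1 : ((δ : ℤ) : ℂ) = 1 := by simp [hδ]
    have h2 := S.finrank_eigenspace (c := 1) (by rw [h1, one_mul])
    have h3 := S.finrank_eigenspace (c := -1) (by rw [h1]; ring)
    rw [signPos, signNeg, if_pos hδ, if_pos hδ, h2, h3]
    ring
  · have h1 : ((δ : ℤ) : ℂ) = -1 := by simp [hδ]
    have h2 := S.finrank_eigenspace (c := Complex.I) (by rw [h1, Complex.I_mul_I])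
    have h3 := S.finrank_eigenspace (c := -Complex.I) (by rw [h1, neg_mul_neg, Complex.I_mul_I])
    have h4 : ¬ δ = 1 := by rw [hδ]; decide
    rw [signPos, signNeg, if_neg h4, if_neg h4, h2, h3]
    ring

lemma sign_add' : (S.signPos : ℤ) + S.signNeg = finrank ℂ V := by
  exact_mod_cast S.sign_add

lemma trace_mul_L_eq_zero (hδ : δ = 1) {x : End ℂ V} (hx : S.dagger x = -x)
    (hxL : x * S.L = S.L * x) : LinearMap.trace ℂ V (x * S.L) = 0 := by
  apply S.trace_eq_zero_of_dagger_eq_neg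
  have h1 : ((δ : ℤ) : ℂ) = 1 := by simp [hδ]
  rw [dagger_mul, dagger_L, hx, h1, one_smul, mul_neg, hxL]

/-- `(1 - i L) / 2` is the projection onto `𝒳_V`, and `x` has trace zero on `V`. -/
lemma trace_mul_L (hδ : δ = -1) {X : End ℂ V} (x : S.lieStab X) :
    LinearMap.trace ℂ V (x.1 * S.L) = 2 * Complex.I * LinearMap.trace ℂ _ (S.lieResI x) := by
  obtain ⟨hx1, hx2, hx3⟩ := S.mem_lieStab_iff.mp x.2
  have hmem : ∀ v, (x.1 * S.projI) v ∈ S.eigI := fun v =>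
    S.mem_eigI_of_commute (fun y => LinearMap.congr_fun hx2 y) _ (projI_mem hδ v)
  have h1 := LinearMap.trace_restrict_eq_of_forall_mem S.eigI _ hmem
  have h2 : (x.1 * S.projI).restrict (fun v _ => hmem v) = S.lieResI x := by
    ext v
    change x.1 (S.projI v) = x.1 v
    rw [projI_of_mem v.2]
  rw [h2] at h1
  rw [h1, projI, mul_smul_comm, mul_sub, mul_one, mul_smul_comm, map_smul, map_sub, map_smul,
    S.trace_eq_zero_of_dagger_eq_neg hx1, smul_eq_mul, smul_eq_mul]
  linear_combination (LinearMap.trace ℂ V (x.1 * S.L)) * Complex.I_sq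

/-- For `δ = -1`, all terms of the trace formula vanish but for `tr (x L) tr L'`. -/
lemma dgamma_eq_of_neg (hδ : δ = -1) (hT : T ∈ S.Xcirc S') (x : S.lieStab (S.moment S' T))
    (x' : S'.lieStab (S.moment' S' T)) (h : T ∘ₗ x.1 = x'.1 ∘ₗ T) :
    S.dgamma _ x = S'.dgamma _ x' +
      ((S'.signPos : ℂ) - S'.signNeg) * LinearMap.trace ℂ _ (S.lieResI x) := by
  obtain ⟨hx1', hx2', hx3'⟩ := S'.mem_lieStab_iff.mp x'.2
  have hδ' : -δ = 1 := by rw [hδ, neg_neg]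
  have h1 : ((δ : ℤ) : ℂ) = -1 := by simp [hδ]
  rw [S.dgamma_eq S' hT x x' h, S.trace_L_eq_zero hδ, S'.trace_mul_L_eq_zero hδ' hx1' hx2',
    S.trace_mul_L hδ, S'.sign_sub_of_pos hδ', h1]
  linear_combination (-((S'.signPos : ℂ) - S'.signNeg) *
    LinearMap.trace ℂ _ (S.lieResI x)) * Complex.I_sq

/-- For `δ = 1`, all terms of the trace formula vanish but for `tr (x' L') tr L`. -/
lemma dgamma_eq_of_pos (hδ : δ = 1) (hT : T ∈ S.Xcirc S') (x : S.lieStab (S.moment S' T))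
    (x' : S'.lieStab (S.moment' S' T)) (h : T ∘ₗ x.1 = x'.1 ∘ₗ T) :
    S.dgamma _ x = S'.dgamma _ x' +
      ((S.signNeg : ℂ) - S.signPos) * LinearMap.trace ℂ _ (S'.lieResI x') := by
  obtain ⟨hx1, hx2, hx3⟩ := S.mem_lieStab_iff.mp x.2
  have hδ' : -δ = -1 := by rw [hδ]
  have h1 : ((δ : ℤ) : ℂ) = 1 := by simp [hδ]
  rw [S.dgamma_eq S' hT x x' h, S'.trace_L_eq_zero hδ', S.trace_mul_L_eq_zero hδ hx1 hx2,
    S'.trace_mul_L hδ', S.sign_sub_of_pos hδ, h1]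
  linear_combination (((S.signPos : ℂ) - S.signNeg) *
    LinearMap.trace ℂ _ (S'.lieResI x')) * Complex.I_sq

variable {S S'}

lemma detI_eq_exp {X : End ℂ V} {k : S.Kt} {x : S.lieStab X}
    (h : (S.toGL k : End ℂ V) = expEnd x.1) :
    (S.detI (S.toK k) : ℂ) = Complex.exp (LinearMap.trace ℂ _ (S.lieResI x)) := by
  have h1 : S.eigI.subtype ∘ₗ S.lieResI x = x.1 ∘ₗ S.eigI.subtype := rfl
  have h2 := comp_expEnd h1
  have h3 : S.resI (S.toK k) = expEnd (S.lieResI x) := by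
    ext v
    have h4 := LinearMap.congr_fun h2 v
    rw [← h] at h4
    exact h4.symm
  change LinearMap.det (S.resI (S.toK k)) = _
  rw [h3, det_expEnd]

lemma varsigma_of_pos (hδ : δ = 1) (m : ℤ) (k : S.Kt) : S.varsigma m k = 1 := by
  have h1 : ¬ S.IsRealSymplectic := fun h => by
    have := h.2; rw [hδ] at this; exact absurd this (by decide)
  have h2 : ¬ (ε = 1 ∧ δ = -1) := fun h => by
    have := h.2; rw [hδ] at this; exact absurd this (by decide)
  rw [varsigma, if_neg h1, if_neg h2, MonoidHom.one_apply]

/-- The half of the exponent in the quaternionic orthogonal case is an integer division, whence the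
parity assumption. -/
lemma varsigma_of_isExp (hδ : δ = -1) {m : ℤ} (hm : ε = 1 → Even m) {X : End ℂ V} {k : S.Kt}
    {x : S.lieStab X} (h : S.IsExp k x) :
    (S.varsigma m k : ℂ) = Complex.exp (m * LinearMap.trace ℂ _ (S.lieResI x) / 2) := by
  rcases Int.units_eq_one_or ε with hε | hε
  · have h1 : ¬ S.IsRealSymplectic := fun h => by
      have := h.1; rw [hε] at this; exact absurd this (by decide)
    rw [varsigma, if_neg h1, if_pos ⟨hε, hδ⟩]
    obtain ⟨j, rfl⟩ := hm hε
    change ((S.detI (S.toK k) ^ ((j + j) / 2) : ℂˣ) : ℂ) = _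
    rw [Units.val_zpow_eq_zpow_val, detI_eq_exp h.1, ← Complex.exp_int_mul]
    congr 1
    rw [← two_mul, Int.mul_ediv_cancel_left _ two_ne_zero]
    push_cast
    ring
  · have h1 : S.IsRealSymplectic := ⟨hε, hδ⟩
    rw [varsigma, if_pos h1]
    change ((S.toC k ^ m : ℂˣ) : ℂ) = _
    rw [Units.val_zpow_eq_zpow_val, h.2 h1, ← Complex.exp_int_mul]
    congr 1
    ring

lemma even_sign_sub (hε : ε = -1) : Even ((S.signPos : ℤ) - S.signNeg) := by
  have h1 : Even (finrank ℂ V : ℤ) := by exact_mod_cast S.even_finrank hε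
  rw [← S.sign_add'] at h1
  rw [Int.even_sub]
  rwa [Int.even_add] at h1

lemma even_sign_sub' (hε : ε = -1) : Even ((S.signNeg : ℤ) - S.signPos) := by
  rw [← neg_sub]
  exact (even_sign_sub hε).neg

/-- The half canonical characters of `X` and of its descent `X'` differ by `ς`. -/
theorem exp_half_dgamma_eq (hT : T ∈ S.Xcirc S') {x : S.lieStab (S.moment S' T)}
    {x' : S'.lieStab (S.moment' S' T)} (h : T ∘ₗ x.1 = x'.1 ∘ₗ T) {k : S.Kt} {k' : S'.Kt}
    (hk : S.IsExp k x) (hk' : S'.IsExp k' x') :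
    Complex.exp (S.dgamma _ x / 2) =
      (S.varsigmaK S' k : ℂ) * (S.varsigmaK' S' k' : ℂ) * Complex.exp (S'.dgamma _ x' / 2) := by
  rcases Int.units_eq_one_or δ with hδ | hδ
  · rw [varsigmaK, varsigma_of_pos hδ, Units.val_one, one_mul, varsigmaK',
      varsigma_of_isExp (by rw [hδ]) (fun hε => even_sign_sub' (by rw [← hε, neg_neg])) hk',
      ← Complex.exp_add, S.dgamma_eq_of_pos S' hδ hT x x' h]
    congr 1
    push_cast
    ring
  · rw [varsigmaK', varsigma_of_pos (by rw [hδ, neg_neg]), Units.val_one, mul_one, varsigmaK,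
      varsigma_of_isExp hδ (fun hε => even_sign_sub (by rw [hε])) hk,
      ← Complex.exp_add, S.dgamma_eq_of_neg S' hδ hT x x' h]
    congr 1
    push_cast
    ring

/-! ### Pairs of elements of `K̃_X` and `K̃'_{X'}` -/

lemma exists_toK (g : S.K) : ∃ k : S.Kt, S.toK k = g := by
  by_cases h : S.IsRealSymplectic
  · obtain ⟨c, hc⟩ := IsAlgClosed.exists_pow_nat_eq (S.detI g : ℂ) (n := 2) (by norm_num)
    have hc0 : c ≠ 0 := by
      rintro rfl
      exact (S.detI g).ne_zero (by rw [← hc]; norm_num)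
    refine ⟨⟨(g, Units.mk0 c hc0), ?_⟩, rfl⟩
    change if S.IsRealSymplectic then S.detI g = (Units.mk0 c hc0) ^ 2 else _
    rw [if_pos h]
    exact Units.ext hc.symm
  · refine ⟨⟨(g, 1), ?_⟩, rfl⟩
    change if S.IsRealSymplectic then _ else (1 : ℂˣ) = 1
    rw [if_neg h]

/-- The kernel of `K̃ → K` is trivial or `{(1, 1), (1, -1)}`. -/
lemma eq_or_isCoverSign {z : S.Kt} (h : S.toK z = 1) : z = 1 ∨ S.IsCoverSign z := by
  have hz := z.2
  change if S.IsRealSymplectic then S.detI (S.toK z) = (S.toC z) ^ 2 else S.toC z = 1 at hz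
  have hone : S.toC z = 1 → z = 1 := fun hc => Subtype.ext (Prod.ext h hc)
  split_ifs at hz with hS
  · rw [h, map_one] at hz
    have h1 : (S.toC z : ℂ) * S.toC z = 1 := by
      rw [← Units.val_mul, ← pow_two, ← hz, Units.val_one]
    rcases mul_self_eq_one_iff.mp h1 with h2 | h2
    · exact Or.inl (hone (Units.ext h2))
    · exact Or.inr ⟨hS, h, Units.ext (by rw [h2]; rfl)⟩
  · exact Or.inl (hone hz)

lemma exists_isExp {X : End ℂ V} (x : S.lieStab X) : ∃ k : S.Kt, S.IsExp k x := by
  obtain ⟨hx1, hx2, hx3⟩ := S.mem_lieStab_iff.mp x.2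
  obtain ⟨g, hg⟩ := exists_mem_K_expEnd hx1 hx2
  by_cases h : S.IsRealSymplectic
  · set c : ℂˣ := Units.mk0 _ (Complex.exp_ne_zero (LinearMap.trace ℂ _ (S.lieResI x) / 2)) with hc
    obtain ⟨k, rfl⟩ := exists_toK g
    have hk : S.detI (S.toK k) = c ^ 2 := by
      apply Units.ext
      rw [detI_eq_exp hg, Units.val_pow_eq_pow_val, hc, Units.val_mk0, ← Complex.exp_nat_mul]
      congr 1
      push_cast
      ring
    refine ⟨⟨(S.toK k, c), ?_⟩, hg, fun _ => rfl⟩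
    change if S.IsRealSymplectic then S.detI (S.toK k) = c ^ 2 else _
    rwa [if_pos h]
  · obtain ⟨k, rfl⟩ := exists_toK g
    exact ⟨k, hg, fun h' => absurd h' h⟩

lemma Ad_eq_iff {k : S.Kt} {X Y : End ℂ V} :
    S.Ad k X = Y ↔ (S.toGL k : End ℂ V) * X = Y * (S.toGL k : End ℂ V) := by
  rw [Ad, LinearEquiv.conj_apply]
  constructor
  · rintro rfl
    ext v
    simp
  · intro h
    ext v
    have := LinearMap.congr_fun h ((S.toGL k).symm v)
    simpa using this

lemma isExp_mem_stab {X : End ℂ V} {x : S.lieStab X} {k : S.Kt} (h : S.IsExp k x) :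
    S.Ad k X = X := by
  obtain ⟨hx1, hx2, hx3⟩ := S.mem_lieStab_iff.mp x.2
  rw [Ad_eq_iff, h.1]
  exact (expEnd_commute hx3.symm).symm

lemma exists_pair_right (hT : T ∈ S.Xcirc S') {k : S.Kt} (hk : S.Ad k (S.moment S' T) = S.moment S' T) :
    ∃ k' : S'.Kt, S'.Ad k' (S.moment' S' T) = S.moment' S' T ∧
      T ∘ₗ (S.toGL k : End ℂ V) = (S'.toGL k' : End ℂ V') ∘ₗ T := by
  obtain ⟨g', hg', h1, h2⟩ := S.exists_descent_K S' hT (S.toK k).2 (Ad_eq_iff.mp hk)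
  obtain ⟨k', hk'⟩ := exists_toK ⟨g', hg'⟩
  have h3 : S'.toGL k' = g' := congrArg Subtype.val hk'
  exact ⟨k', by rw [Ad_eq_iff, h3]; exact h2, by rw [h3]; exact h1⟩

lemma exists_pair_left (hT : T ∈ S.Xcirc S') {k' : S'.Kt}
    (hk' : S'.Ad k' (S.moment' S' T) = S.moment' S' T) :
    ∃ k : S.Kt, S.Ad k (S.moment S' T) = S.moment S' T ∧
      T ∘ₗ (S.toGL k : End ℂ V) = (S'.toGL k' : End ℂ V') ∘ₗ T := by
  obtain ⟨g, hg, h1⟩ := S.exists_lift_K S' hT (S'.toK k').2 (Ad_eq_iff.mp hk')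
  obtain ⟨k, hk⟩ := exists_toK ⟨g, hg⟩
  have h3 : S.toGL k = g := congrArg Subtype.val hk
  refine ⟨k, ?_, by rw [h3]; exact h1⟩
  rw [Ad_eq_iff, h3]
  exact S.commute_moment_of_mem_K S' hg (S'.toK k').2 h1

/-- The image of `k = exp x` in `K'` is `exp x'`. -/
lemma exists_isExp_pair {x : S.lieStab (S.moment S' T)} {x' : S'.lieStab (S.moment' S' T)}
    (h : T ∘ₗ x.1 = x'.1 ∘ₗ T) {k : S.Kt} (hk : S.IsExp k x) :
    ∃ k' : S'.Kt, S'.IsExp k' x' ∧ T ∘ₗ (S.toGL k : End ℂ V) = (S'.toGL k' : End ℂ V') ∘ₗ T := by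
  obtain ⟨k', hk'⟩ := exists_isExp x'
  exact ⟨k', hk', by rw [hk.1, hk'.1, comp_expEnd h]⟩

lemma exists_isExp_pair_left {x : S.lieStab (S.moment S' T)} {x' : S'.lieStab (S.moment' S' T)}
    (h : T ∘ₗ x.1 = x'.1 ∘ₗ T) {k' : S'.Kt} (hk' : S'.IsExp k' x') :
    ∃ k : S.Kt, S.IsExp k x ∧ T ∘ₗ (S.toGL k : End ℂ V) = (S'.toGL k' : End ℂ V') ∘ₗ T := by
  obtain ⟨k, hk⟩ := exists_isExp x
  exact ⟨k, hk, by rw [hk.1, hk'.1, comp_expEnd h]⟩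

end CartanSpace

namespace CartanSpace

variable {ε δ : ℤˣ} {V : Type v} [AddCommGroup V] [Module ℂ V] [FiniteDimensional ℂ V]
  {V' : Type v} [AddCommGroup V'] [Module ℂ V'] [FiniteDimensional ℂ V']
  {S : CartanSpace ε δ V} {S' : CartanSpace (-ε) (-δ) V'} {T : V →ₗ[ℂ] V'}

/-- The elements `k ∈ K̃_X` and `k' ∈ K̃'_{X'}` have `T k = k' T`, that is, `α k = k'` in `K'`. -/
def IsPair (S : CartanSpace ε δ V) (S' : CartanSpace (-ε) (-δ) V') (T : V →ₗ[ℂ] V')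
    (k : S.stab (S.moment S' T)) (k' : S'.stab (S.moment' S' T)) : Prop :=
  T ∘ₗ (S.toGL k.1 : End ℂ V) = (S'.toGL k'.1 : End ℂ V') ∘ₗ T

lemma IsPair.one : IsPair S S' T 1 1 := rfl

lemma IsPair.mul {k l : S.stab (S.moment S' T)} {k' l' : S'.stab (S.moment' S' T)}
    (hk : IsPair S S' T k k') (hl : IsPair S S' T l l') : IsPair S S' T (k * l) (k' * l') := by
  change (T ∘ₗ (S.toGL k.1 : End ℂ V)) ∘ₗ (S.toGL l.1 : End ℂ V) =
    (S'.toGL k'.1 : End ℂ V') ∘ₗ (S'.toGL l'.1 : End ℂ V') ∘ₗ T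
  rw [hk, LinearMap.comp_assoc, hl]

lemma IsPair.inv {k : S.stab (S.moment S' T)} {k' : S'.stab (S.moment' S' T)}
    (hk : IsPair S S' T k k') : IsPair S S' T k⁻¹ k'⁻¹ := by
  have h := hk
  ext v
  have h1 := LinearMap.congr_fun h ((S.toGL k.1).symm v)
  change T ((S.toGL k.1).symm v) = (S'.toGL k'.1).symm (T v)
  rw [LinearEquiv.eq_symm_apply]
  simpa using h1.symm

lemma exists_isPair_right (hT : T ∈ S.Xcirc S') (k : S.stab (S.moment S' T)) :
    ∃ k', IsPair S S' T k k' := by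
  obtain ⟨k', h1, h2⟩ := exists_pair_right hT k.2
  exact ⟨⟨k', h1⟩, h2⟩

lemma exists_isPair_left (hT : T ∈ S.Xcirc S') (k' : S'.stab (S.moment' S' T)) :
    ∃ k, IsPair S S' T k k' := by
  obtain ⟨k, h1, h2⟩ := exists_pair_left hT k'.2
  exact ⟨⟨k, h1⟩, h2⟩

/-! ### Regular functions pulled back from `K̃'_{X'}` to `K̃_X` -/

lemma exists_isCoverSign (h : S.IsRealSymplectic) : ∃ z, S.IsCoverSign z := by
  refine ⟨⟨(1, -1), ?_⟩, h, rfl, rfl⟩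
  change if S.IsRealSymplectic then S.detI 1 = (-1) ^ 2 else _
  rw [if_pos h]
  simp

lemma toGL_of_isCoverSign {z : S.Kt} (hz : S.IsCoverSign z) : S.toGL z = 1 :=
  congrArg Subtype.val hz.2.1

lemma isCoverSign_mem_stab {z : S.Kt} (hz : S.IsCoverSign z) (X : End ℂ V) : z ∈ S.stab X := by
  change S.Ad z X = X
  rw [Ad_eq_iff, toGL_of_isCoverSign hz]
  rfl

lemma toC_of_not_isRealSymplectic (h : ¬ S.IsRealSymplectic) (k : S.Kt) : S.toC k = 1 := by
  have hk := k.2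
  change if S.IsRealSymplectic then _ else S.toC k = 1 at hk
  rwa [if_neg h] at hk

lemma toC_sq (h : S.IsRealSymplectic) (k : S.Kt) : S.toC k ^ 2 = S.detI (S.toK k) := by
  have hk := k.2
  change if S.IsRealSymplectic then S.detI (S.toK k) = S.toC k ^ 2 else _ at hk
  rw [if_pos h] at hk
  exact hk.symm

/-- The square of the coordinate `c` of `k'` is a determinant, hence a regular function of `k`, although
`c` itself is not a function of `k`. -/
lemma exists_regular_toC_sq (hT : T ∈ S.Xcirc S') :
    ∃ D ∈ S.regularFunctions (S.stab (S.moment S' T)), ∀ k k', IsPair S S' T k k' →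
      (S'.toC k'.1 : ℂ) * S'.toC k'.1 = D k := by
  by_cases h : S'.IsRealSymplectic
  · obtain ⟨σ, hσ⟩ := T.exists_rightInverse_of_surjective (LinearMap.range_eq_top.mpr hT.1)
    let Λ : End ℂ V →ₗ[ℂ] End ℂ V' :=
      { toFun := fun a => T ∘ₗ a ∘ₗ σ
        map_add' := fun a b => by ext; simp
        map_smul' := fun c a => by ext; simp }
    refine ⟨_, regular_det_linear (S'.compressI h.2 ∘ₗ Λ) 0, fun k k' hk => ?_⟩
    have h1 : Λ (S.toGL k.1 : End ℂ V) = (S'.toGL k'.1 : End ℂ V') := by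
      change T ∘ₗ _ ∘ₗ σ = _
      rw [← LinearMap.comp_assoc, hk, LinearMap.comp_assoc, hσ, LinearMap.comp_id]
    rw [add_zero, LinearMap.comp_apply, h1, ← Units.val_mul, ← pow_two, toC_sq h]
    exact congrArg LinearMap.det (compressI_of_mem h.2 (S'.toK k'.1)).symm
  · refine ⟨_, regular_const 1, fun k k' _ => ?_⟩
    rw [toC_of_not_isRealSymplectic h]
    simp

lemma regular_inv {H : Subgroup S.Kt} {f : H → ℂ} (hf : f ∈ S.regularFunctions H) :
    (fun k => f k⁻¹) ∈ S.regularFunctions H := by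
  induction hf using Algebra.adjoin_induction with
  | mem f hf =>
    rcases hf with (⟨φ, rfl⟩ | ⟨φ, rfl⟩) | rfl | rfl
    · exact regular_linear_inv φ
    · simpa using regular_linear φ
    · exact regular_toC_inv
    · simpa using regular_toC
  | algebraMap r => exact regular_const r
  | add f g _ _ hf hg => exact add_mem hf hg
  | mul f g _ _ hf hg => exact mul_mem hf hg

/-- A function on `K̃_X` induced by a regular function on `K̃'_{X'}` is regular. If `G'` is real
symplectic, then `K̃_X` only maps to `K'`; but a regular function of `(k', c)` is of the form
`A k + c B k` with `A` and `B` regular, because `c ^ 2` is a determinant. -/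
theorem regular_of_isPair (hT : T ∈ S.Xcirc S') {F : S.stab (S.moment S' T) → ℂ}
    {F' : S'.stab (S.moment' S' T) → ℂ} (hF' : F' ∈ S'.regularFunctions _)
    (h : ∀ k k', IsPair S S' T k k' → F k = F' k') : F ∈ S.regularFunctions _ := by
  obtain ⟨σ, hσ⟩ := T.exists_rightInverse_of_surjective (LinearMap.range_eq_top.mpr hT.1)
  let Λ : End ℂ V →ₗ[ℂ] End ℂ V' :=
    { toFun := fun a => T ∘ₗ a ∘ₗ σ
      map_add' := fun a b => by ext; simp
      map_smul' := fun c a => by ext; simp }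
  have hΛ : ∀ k k', IsPair S S' T k k' →
      Λ (S.toGL k.1 : End ℂ V) = (S'.toGL k'.1 : End ℂ V') := by
    intro k k' hk
    change T ∘ₗ _ ∘ₗ σ = _
    rw [← LinearMap.comp_assoc, hk, LinearMap.comp_assoc, hσ, LinearMap.comp_id]
  obtain ⟨D, hD, hDk⟩ := exists_regular_toC_sq hT
  have zero := Subalgebra.zero_mem (S.regularFunctions (S.stab (S.moment S' T)))
  have key : ∃ A ∈ S.regularFunctions (S.stab (S.moment S' T)),
      ∃ B ∈ S.regularFunctions (S.stab (S.moment S' T)),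
      ∀ k k', IsPair S S' T k k' → F' k' = A k + S'.toC k'.1 * B k := by
    clear h
    induction hF' using Algebra.adjoin_induction with
    | mem f hf =>
      rcases hf with (⟨φ, rfl⟩ | ⟨φ, rfl⟩) | rfl | rfl
      · refine ⟨_, regular_linear (φ ∘ₗ Λ), 0, zero, fun k k' hk => ?_⟩
        simp [hΛ k k' hk]
      · refine ⟨_, regular_linear_inv (φ ∘ₗ Λ), 0, zero, fun k k' hk => ?_⟩
        have h1 := hΛ _ _ hk.inv
        change φ _ = φ (Λ (S.toGL k.1⁻¹ : End ℂ V)) + _ * 0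
        rw [mul_zero, add_zero]
        exact congrArg φ h1.symm
      · exact ⟨0, zero, _, regular_const 1, fun k k' hk => by simp⟩
      · refine ⟨0, zero, _, regular_inv hD, fun k k' hk => ?_⟩
        have h1 := hDk _ _ hk.inv
        rw [← h1]
        simp
    | algebraMap r => exact ⟨_, regular_const r, 0, zero, fun k k' hk => by simp⟩
    | add f g _ _ hf hg =>
      obtain ⟨A, hA, B, hB, h1⟩ := hf
      obtain ⟨A₂, hA₂, B₂, hB₂, h2⟩ := hg
      refine ⟨_, add_mem hA hA₂, _, add_mem hB hB₂, fun k k' hk => ?_⟩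
      simp only [Pi.add_apply, h1 k k' hk, h2 k k' hk]
      ring
    | mul f g _ _ hf hg =>
      obtain ⟨A, hA, B, hB, h1⟩ := hf
      obtain ⟨A₂, hA₂, B₂, hB₂, h2⟩ := hg
      refine ⟨_, add_mem (mul_mem hA hA₂) (mul_mem hD (mul_mem hB hB₂)), _,
        add_mem (mul_mem hA hB₂) (mul_mem hA₂ hB), fun k k' hk => ?_⟩
      simp only [Pi.add_apply, Pi.mul_apply, h1 k k' hk, h2 k k' hk, ← hDk k k' hk]
      ring
  obtain ⟨A, hA, B, hB, h1⟩ := key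
  by_cases hS' : S'.IsRealSymplectic
  -- both `c` and `-c` occur over each `k`, so that the term with `c` vanishes
  · obtain ⟨z, hz⟩ := exists_isCoverSign hS'
    have : F = A := by
      funext k
      obtain ⟨k', hk⟩ := exists_isPair_right hT k
      have hk2 : IsPair S S' T k (k' * ⟨z, isCoverSign_mem_stab hz _⟩) := by
        have h2 : IsPair S S' T 1 ⟨z, isCoverSign_mem_stab hz _⟩ := by
          change T ∘ₗ LinearMap.id = (S'.toGL z : End ℂ V') ∘ₗ T
          rw [toGL_of_isCoverSign hz]
          rfl
        simpa using hk.mul h2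
      have e1 := h1 _ _ hk
      have e2 := h1 _ _ hk2
      rw [← h _ _ hk] at e1
      rw [← h _ _ hk2] at e2
      rw [Subgroup.coe_mul, map_mul, hz.2.2] at e2
      push_cast at e2
      linear_combination (e1 + e2) / 2
    rwa [this]
  · have : F = A + B := by
      funext k
      obtain ⟨k', hk⟩ := exists_isPair_right hT k
      rw [h _ _ hk, h1 _ _ hk, toC_of_not_isRealSymplectic hS']
      simp
    rw [this]
    exact add_mem hA hB

end CartanSpace

/-! ### Isotropy representations -/

namespace CartanSpace

variable {ε δ : ℤˣ} {V : Type v} [AddCommGroup V] [Module ℂ V] [FiniteDimensional ℂ V]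
  {V' : Type v} [AddCommGroup V'] [Module ℂ V'] [FiniteDimensional ℂ V']
  {S : CartanSpace ε δ V} {S' : CartanSpace (-ε) (-δ) V'} {T : V →ₗ[ℂ] V'}

/-- An irreducible `p`-genuine representation of `K̃_X` on which `exp x` acts by
`exp (dγ_X (x) / 2)`. -/
structure IsAdmissible {X : End ℂ V} {E : Type*} [AddCommGroup E] [Module ℂ E]
    (ρ : S.stab X →* End ℂ E) (p : ZMod 2) : Prop where
  nontrivial : Nontrivial E
  irreducible : ∀ F : Submodule ℂ E, (∀ k, ∀ e ∈ F, ρ k e ∈ F) → F = ⊥ ∨ F = ⊤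
  halfCanonical : ∀ (x : S.lieStab X) (k : S.stab X), S.IsExp k.1 x →
    ∀ e, ρ k e = Complex.exp (S.dgamma X x / 2) • e
  genuine : ∀ k : S.stab X, S.IsCoverSign k.1 → ∀ e, ρ k e = ((-1 : ℂ) ^ p.val) • e

/-- The matrix coefficients of `ρ` are regular functions. -/
def IsRegularRep {X : End ℂ V} {E : Type*} [AddCommGroup E] [Module ℂ E]
    (ρ : S.stab X →* End ℂ E) : Prop :=
  ∀ (e : E) (φ : Dual ℂ E), (fun k => φ (ρ k e)) ∈ S.regularFunctions (S.stab X)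

/-- Through `Φ`, the representation `ρ` of `K̃_X` is `χ ⊗ ς ⊗ (ς' ⊗ ρ') ∘ α`. -/
def IsLiftOf (S : CartanSpace ε δ V) (S' : CartanSpace (-ε) (-δ) V') (T : V →ₗ[ℂ] V')
    (χ : S.componentDual) {E E' : Type*} [AddCommGroup E] [Module ℂ E] [AddCommGroup E']
    [Module ℂ E'] (Φ : E ≃ₗ[ℂ] E') (ρ : S.stab (S.moment S' T) →* End ℂ E)
    (ρ' : S'.stab (S.moment' S' T) →* End ℂ E') : Prop :=
  ∀ k k', IsPair S S' T k k' → ∀ e, Φ (ρ k e) =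
    (χ.1 (S.toK k.1) * S.varsigmaK S' k.1 * S.varsigmaK' S' k'.1 : ℂˣ) • ρ' k' (Φ e)

lemma varsigma_of_isCoverSign {z : S.Kt} (hz : S.IsCoverSign z) (m : ℤ) :
    S.varsigma m z = (-1) ^ m := by
  rw [varsigma, if_pos hz.1]
  change (S.toC z) ^ m = _
  rw [hz.2.2]

lemma neg_one_zpow_eq {m : ℤ} {p : ZMod 2} (h : (m : ZMod 2) = p) :
    ((-1 : ℂˣ) ^ m : ℂˣ) = (-1) ^ p.val := by
  subst h
  rw [← zpow_natCast]
  rcases Int.even_or_odd m with hm | hm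
  · have : (m : ZMod 2) = 0 := by
      rw [ZMod.intCast_zmod_eq_zero_iff_dvd]; exact even_iff_two_dvd.mp hm
    rw [this, hm.neg_one_zpow]
    simp
  · have : (m : ZMod 2) = 1 := by
      obtain ⟨j, rfl⟩ := hm
      push_cast
      have : (2 : ZMod 2) = 0 := rfl
      rw [this]
      ring
    rw [this, hm.neg_one_zpow, ZMod.val_one]
    simp

lemma cast_sign_sub (S : CartanSpace ε δ V) :
    (((S.signPos : ℤ) - S.signNeg : ℤ) : ZMod 2) = (finrank ℂ V : ZMod 2) := by
  have h := congrArg (Int.cast : ℤ → ZMod 2) S.sign_add'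
  push_cast at h ⊢
  rw [← h, sub_eq_add_neg, ZMod.neg_eq_self_mod_two]

lemma cast_sign_sub' (S : CartanSpace ε δ V) :
    (((S.signNeg : ℤ) - S.signPos : ℤ) : ZMod 2) = (finrank ℂ V : ZMod 2) := by
  rw [← cast_sign_sub, ← neg_sub]
  push_cast
  rw [ZMod.neg_eq_self_mod_two]

section Lift

variable {p : ZMod 2} {χ : S.componentDual} {E E' : Type*} [AddCommGroup E] [Module ℂ E]
  [AddCommGroup E'] [Module ℂ E'] {Φ : E ≃ₗ[ℂ] E'} {ρ : S.stab (S.moment S' T) →* End ℂ E}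
  {ρ' : S'.stab (S.moment' S' T) →* End ℂ E'}

lemma unit_smul_mem_iff {M : Type*} [AddCommGroup M] [Module ℂ M] (F : Submodule ℂ M) (c : ℂˣ)
    {e : M} : c • e ∈ F ↔ e ∈ F := Submodule.smul_mem_iff_of_isUnit F c.isUnit

/-- A lift of an algebraic representation is algebraic: `χ ⊗ ς` is regular on `K̃_X`, and
`regular_of_isPair` applies to the matrix coefficients of `(ς' ⊗ ρ') ∘ α`. -/
lemma IsLiftOf.isRegularRep (h : IsLiftOf S S' T χ Φ ρ ρ') (hT : T ∈ S.Xcirc S')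
    (hρ' : IsRegularRep ρ') : IsRegularRep ρ := by
  intro e φ
  set F' : S'.stab (S.moment' S' T) → ℂ := fun k' =>
    (S.varsigmaK' S' k'.1 : ℂ) * φ (Φ.symm (ρ' k' (Φ e))) with hF'
  set F : S.stab (S.moment S' T) → ℂ := fun k =>
    (S.varsigmaK S' k.1⁻¹ : ℂ) * ((χ.1 (S.toK k.1))⁻¹ : ℂˣ) * φ (ρ k e) with hF
  have h1 : F' ∈ S'.regularFunctions _ := mul_mem (regular_varsigma _)
    (hρ' (Φ e) (φ ∘ₗ Φ.symm.toLinearMap))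
  have h2 : F ∈ S.regularFunctions _ := by
    refine regular_of_isPair hT h1 fun k k' hk => ?_
    have h3 : ρ k e = Φ.symm ((χ.1 (S.toK k.1) * S.varsigmaK S' k.1 * S.varsigmaK' S' k'.1 : ℂˣ) •
      ρ' k' (Φ e)) := by rw [← h k k' hk, LinearEquiv.symm_apply_apply]
    simp only [hF, hF', h3, Units.smul_def, map_smul, smul_eq_mul, Units.val_mul]
    rw [map_inv]
    have e1 := (χ.1 (S.toK k.1)).inv_mul
    have e2 := (S.varsigmaK S' k.1).inv_mul
    linear_combination (((χ.1 (S.toK k.1))⁻¹ : ℂˣ) * (χ.1 (S.toK k.1) : ℂ) *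
      (S.varsigmaK' S' k'.1 : ℂ) * φ (Φ.symm (ρ' k' (Φ e)))) * e2 +
      ((S.varsigmaK' S' k'.1 : ℂ) * φ (Φ.symm (ρ' k' (Φ e)))) * e1
  have h3 : (fun k => φ (ρ k e)) = (fun k : S.stab (S.moment S' T) => (χ.1 (S.toK k.1) : ℂ)) *
      ((fun k : S.stab (S.moment S' T) => (S.varsigmaK S' k.1 : ℂ)) * F) := by
    funext k
    simp only [Pi.mul_apply, hF]
    rw [map_inv]
    have e1 := (χ.1 (S.toK k.1)).mul_inv
    have e2 := (S.varsigmaK S' k.1).mul_inv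
    linear_combination -((χ.1 (S.toK k.1) : ℂ) * ((χ.1 (S.toK k.1))⁻¹ : ℂˣ) * φ (ρ k e)) * e2 -
      φ (ρ k e) * e1
  rw [h3]
  exact mul_mem (regular_componentDual χ) (mul_mem (regular_varsigma _) h2)

lemma componentDual_of_isExp (χ : S.componentDual) {X : End ℂ V} {x : S.lieStab X} {k : S.Kt}
    (h : S.IsExp k x) : χ.1 (S.toK k) = 1 := by
  obtain ⟨hx1, hx2, hx3⟩ := S.mem_lieStab_iff.mp x.2
  exact componentDual_expEnd χ hx1 hx2 h.1

lemma isPair_of_isCoverSign_left {z : S.stab (S.moment S' T)} (hz : S.IsCoverSign z.1) :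
    IsPair S S' T z 1 := by
  change T ∘ₗ (S.toGL z.1 : End ℂ V) = _
  rw [toGL_of_isCoverSign hz]
  rfl

lemma isPair_of_isCoverSign_right {z : S'.stab (S.moment' S' T)} (hz : S'.IsCoverSign z.1) :
    IsPair S S' T 1 z := by
  change _ = (S'.toGL z.1 : End ℂ V') ∘ₗ T
  rw [toGL_of_isCoverSign hz]
  rfl

lemma isRealSymplectic_ne {z : S.Kt} (hz : S.IsCoverSign z) : ε ≠ 1 := by
  rw [hz.1.1]; decide

/-- A lift of an admissible representation is admissible: irreducibility follows from the surjectivity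
of `α`, the half canonical condition from `exp_half_dgamma_eq`, and genuineness from the parity of
the exponent of `ς`. -/
lemma IsLiftOf.isAdmissible (h : IsLiftOf S S' T χ Φ ρ ρ') (hT : T ∈ S.Xcirc S')
    (hp : ((if ε = 1 then finrank ℂ V else finrank ℂ V' : ℕ) : ZMod 2) = p)
    (hρ' : IsAdmissible ρ' p) : IsAdmissible ρ p where
  nontrivial := by
    have := hρ'.nontrivial
    exact Φ.toEquiv.nontrivial
  irreducible := by
    intro F hF
    have := hρ'.irreducible (F.map Φ.toLinearMap) ?_
    · rcases this with h1 | h1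
      · exact Or.inl ((Submodule.map_eq_bot_iff (e := Φ)).mp h1)
      · right
        rw [eq_top_iff]
        intro e _
        obtain ⟨f, hf, hfe⟩ : Φ e ∈ F.map Φ.toLinearMap := h1 ▸ Submodule.mem_top
        rwa [← Φ.injective hfe]
    · rintro k' _ ⟨f, hf, rfl⟩
      obtain ⟨k, hk⟩ := exists_isPair_left hT k'
      have h1 := h k k' hk f
      have h2 : Φ (ρ k f) ∈ F.map Φ.toLinearMap := ⟨_, hF k f hf, rfl⟩
      rw [h1, unit_smul_mem_iff] at h2
      exact h2
  halfCanonical := by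
    intro x k hk e
    have hx := S.comp_lieDescent S' hT x
    obtain ⟨k', hk', hp⟩ := exists_isExp_pair hx hk
    apply Φ.injective
    rw [h k ⟨k', isExp_mem_stab hk'⟩ hp, hρ'.halfCanonical _ _ hk', map_smul,
      exp_half_dgamma_eq hT hx hk hk', componentDual_of_isExp χ hk, one_mul, Units.smul_def,
      smul_smul, Units.val_mul]
  genuine := by
    intro z hz e
    apply Φ.injective
    have hz1 : S.toK z.1 = 1 := hz.2.1
    rw [h z 1 (isPair_of_isCoverSign_left hz), hz1]
    rw [if_neg (isRealSymplectic_ne hz)] at hp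
    rw [map_one, map_one, varsigmaK, varsigma_of_isCoverSign hz,
      neg_one_zpow_eq (p := p) (by rw [cast_sign_sub, hp]), Subgroup.coe_one, map_one, one_mul,
      mul_one, Module.End.one_apply, map_smul, Units.smul_def]
    simp

end Lift

end CartanSpace

/-! ### Descent of admissible representations -/

/-- A character `c` which is trivial on the kernel of a quadratic character `d` is `1` or `d`. -/
lemma MonoidHom.eq_one_or_eq_of_mul_self {G : Type*} [Group G] (c d : G →* ℂˣ)
    (hd : ∀ g, d g * d g = 1) (h : ∀ g, d g = 1 → c g = 1) : c = 1 ∨ c = d := by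
  by_cases hc : ∀ g, c g = 1
  · exact Or.inl (MonoidHom.ext hc)
  · right
    push Not at hc
    obtain ⟨g₀, hg₀⟩ := hc
    have hval : ∀ {u : ℂˣ}, u * u = 1 → u ≠ 1 → u = -1 := by
      intro u h1 h2
      have h3 : (u : ℂ) * u = 1 := by rw [← Units.val_mul, h1, Units.val_one]
      rcases mul_self_eq_one_iff.mp h3 with h4 | h4
      · exact absurd (Units.ext h4) h2
      · exact Units.ext (by rw [h4]; rfl)
    have hd₀ : d g₀ = -1 := hval (hd g₀) fun h1 => hg₀ (h g₀ h1)
    have hc₀ : c g₀ = -1 := by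
      refine hval ?_ hg₀
      rw [← map_mul]
      exact h _ (by rw [map_mul, hd])
    ext g
    congr 1
    by_cases hg : d g = 1
    · rw [hg, h g hg]
    · have h1 := hval (hd g) hg
      have h2 := h (g * g₀) (by rw [map_mul, h1, hd₀]; simp)
      rw [map_mul, hc₀] at h2
      rw [h1]
      calc c g = c g * (-1) * (-1) := by simp
        _ = -1 := by rw [h2, one_mul]

/-- Two quadratic characters `d₁, d₂` of a group separate enough characters of a subgroup: a
character `c` of `N` trivial where both are trivial is the restriction of `d₁ ^ i * d₂ ^ j`. -/
lemma MonoidHom.eq_of_trivial_on_ker {G : Type*} [Group G] (N : Subgroup G) (c : N →* ℂˣ)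
    (d₁ d₂ : G →* ℂˣ) (h₁ : ∀ g, d₁ g * d₁ g = 1) (h₂ : ∀ g, d₂ g * d₂ g = 1)
    (h : ∀ g : N, d₁ g = 1 → d₂ g = 1 → c g = 1) :
    ∃ i j : ℕ, ∀ g : N, c g = d₁ g ^ i * d₂ g ^ j := by
  have step1 : ∃ i : ℕ, ∀ g : N, d₂ g = 1 → c g = d₁ g ^ i := by
    set M : Subgroup N := (d₂.comp N.subtype).ker
    rcases MonoidHom.eq_one_or_eq_of_mul_self (c.comp M.subtype)
      ((d₁.comp N.subtype).comp M.subtype) (fun g => h₁ _) (fun g hg => h g.1 hg g.2) with h3 | h3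
    · exact ⟨0, fun g hg => by rw [pow_zero]; exact DFunLike.congr_fun h3 ⟨g, hg⟩⟩
    · exact ⟨1, fun g hg => by rw [pow_one]; exact DFunLike.congr_fun h3 ⟨g, hg⟩⟩
  obtain ⟨i, hi⟩ := step1
  have hii : ∀ g, d₁ g ^ i * d₁ g ^ i = 1 := fun g => by rw [← mul_pow, h₁, one_pow]
  rcases MonoidHom.eq_one_or_eq_of_mul_self (c * (d₁.comp N.subtype) ^ i) (d₂.comp N.subtype)
    (fun g => h₂ _) (fun g hg => by
      change c g * d₁ g ^ i = 1
      rw [hi g hg, hii]) with h3 | h3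
  · refine ⟨i, 0, fun g => ?_⟩
    have h4 : c g * d₁ g ^ i = 1 := DFunLike.congr_fun h3 g
    rw [pow_zero, mul_one, ← mul_one (c g), ← hii g, ← mul_assoc, h4, one_mul]
  · refine ⟨i, 1, fun g => ?_⟩
    have h4 : c g * d₁ g ^ i = d₂ g := DFunLike.congr_fun h3 g
    rw [pow_one, ← mul_one (c g), ← hii g, ← mul_assoc, h4, mul_comm]

namespace CartanSpace

variable {ε δ : ℤˣ} {V : Type v} [AddCommGroup V] [Module ℂ V] [FiniteDimensional ℂ V]
  {V' : Type v} [AddCommGroup V'] [Module ℂ V'] [FiniteDimensional ℂ V']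
  {S : CartanSpace ε δ V} {S' : CartanSpace (-ε) (-δ) V'} {T : V →ₗ[ℂ] V'}
  {p : ZMod 2} {E : Type*} [AddCommGroup E] [Module ℂ E]
  {ρ : S.stab (S.moment S' T) →* End ℂ E}

/-- Schur's lemma: an element of the group commuting with everything acts by a scalar. -/
lemma IsAdmissible.exists_eq_smul [FiniteDimensional ℂ E] {X : End ℂ V} {ρ : S.stab X →* End ℂ E}
    (hρ : IsAdmissible ρ p) {k : S.stab X} (hk : ∀ l, ρ k * ρ l = ρ l * ρ k) :
    ∃ c : ℂ, ∀ e, ρ k e = c • e := by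
  have := hρ.nontrivial
  obtain ⟨c, hc⟩ := Module.End.exists_eigenvalue (ρ k)
  refine ⟨c, fun e => ?_⟩
  have hinv : ∀ l, ∀ e ∈ Module.End.eigenspace (ρ k) c, ρ l e ∈ Module.End.eigenspace (ρ k) c := by
    intro l e he
    rw [Module.End.mem_eigenspace_iff] at he ⊢
    rw [← Module.End.mul_apply, hk, Module.End.mul_apply, he, map_smul]
  rcases hρ.irreducible _ hinv with h | h
  · exact absurd h hc
  · have he : e ∈ Module.End.eigenspace (ρ k) c := h ▸ Submodule.mem_top
    exact Module.End.mem_eigenspace_iff.mp he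

lemma isExp_one {X : End ℂ V} : S.IsExp 1 (0 : S.lieStab X) := by
  refine ⟨?_, fun _ => ?_⟩
  · change _ = expEnd 0
    rw [expEnd_zero, map_one]
    rfl
  · have : S.lieResI (0 : S.lieStab X) = 0 := rfl
    rw [this, map_zero, zero_div, Complex.exp_zero, map_one, Units.val_one]

lemma comp_eq_zero_of_vanish {y : End ℂ V} (hy : S.dagger y = -y)
    (h : ∀ w ∈ LinearMap.range (S.adj S' T), y w = 0) : T ∘ₗ y = 0 := by
  ext u
  refine S'.eq_of_form_left fun z => ?_
  have h1 := S.form_dagger y u (S.adj S' T z)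
  rw [hy, LinearMap.neg_apply, h _ ⟨z, rfl⟩, form_adj] at h1
  simpa using h1.symm

/-- The kernel of `K̃_X → K'_{X'}` acts through `ς`, up to its two determinants in the real
orthogonal case, because it is generated by exponentials and by the kernel of `K̃ → K`. -/
lemma IsAdmissible.apply_of_comp_eq (hρ : IsAdmissible ρ p) (hT : T ∈ S.Xcirc S')
    (hp : ((if ε = 1 then finrank ℂ V else finrank ℂ V' : ℕ) : ZMod 2) = p)
    {k : S.stab (S.moment S' T)} (hk : IsPair S S' T k 1)
    (hdet : ε = 1 → ∀ (hδ : δ = 1) (η : ℤˣ), S.signDet hδ η (S.toK k.1) = 1) (e : E) :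
    ρ k e = S.varsigmaK S' k.1 • e := by
  set W := LinearMap.range (S.adj S' T) with hW
  have hWL : ∀ w ∈ W, S.L w ∈ W := by
    rintro _ ⟨z, rfl⟩
    have hc : -(Complex.I * ((δ : ℤ) : ℂ)) ≠ 0 := by
      have := unit_mul_self δ
      intro h0
      have h1 : ((δ : ℤ) : ℂ) = 0 := by
        rwa [neg_eq_zero, mul_eq_zero, or_iff_right Complex.I_ne_zero] at h0
      rw [h1, zero_mul] at this
      exact zero_ne_one this
    have h1 := LinearMap.congr_fun (S.adj_comp_L S' hT) z
    rw [LinearMap.smul_apply, LinearMap.comp_apply, LinearMap.comp_apply] at h1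
    have h2 : (-(Complex.I * ((δ : ℤ) : ℂ))) • S.L (S.adj S' T z) ∈ W := h1 ▸ ⟨_, rfl⟩
    exact (Submodule.smul_mem_iff W hc).mp h2
  have hfix : ∀ w ∈ W, (S.toK k.1).1 w = w := by
    rintro _ ⟨z, rfl⟩
    have h1 := S.comp_adj_of_mem_K S' (S.toK k.1).2 S'.K.one_mem hk
    exact LinearMap.congr_fun h1 z
  have hmem := mem_expMonoid_of_fixes (S.toK k.1).2 hWL hfix hdet
  obtain ⟨k₀, h₀, h₁⟩ := induction_expMonoid (S := S) (W := W)
    (fun g => ∃ k₀ : S.stab (S.moment S' T), S.toK k₀.1 = g ∧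
      ∀ e, ρ k₀ e = S.varsigmaK S' k₀.1 • e) ⟨1, rfl, fun e => by simp⟩
    (by
      rintro _ _ ⟨a, rfl, ha⟩ ⟨b, rfl, hb⟩
      refine ⟨a * b, rfl, fun e => ?_⟩
      rw [map_mul, Module.End.mul_apply, hb, Units.smul_def, map_smul, ha, Subgroup.coe_mul, map_mul,
        Units.smul_def, smul_smul, mul_comm, ← Units.val_mul, ← Units.smul_def])
    (by
      intro y hy hyL hyW g hg
      have hTy : T ∘ₗ y = 0 := comp_eq_zero_of_vanish hy hyW
      have hyX : y * S.moment S' T = S.moment S' T * y := by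
        have h1 : y * S.moment S' T = 0 := by
          ext v
          exact hyW _ ⟨T v, rfl⟩
        have h2 : S.moment S' T * y = 0 := by
          change (S.adj S' T ∘ₗ T) ∘ₗ y = 0
          rw [LinearMap.comp_assoc, hTy, LinearMap.comp_zero]
        rw [h1, h2]
      obtain ⟨k₀, hk₀⟩ := exists_isExp (⟨y, S.mem_lieStab_iff.mpr ⟨hy, hyL, hyX⟩⟩ :
        S.lieStab (S.moment S' T))
      refine ⟨⟨k₀, isExp_mem_stab hk₀⟩, ?_, fun e => ?_⟩
      · exact Subtype.ext (LinearEquiv.toLinearMap_injective (by rw [hg]; exact hk₀.1))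
      · have h1 := exp_half_dgamma_eq hT (x' := 0) (by rw [hTy]; simp) hk₀ isExp_one
        have h2 : S'.dgamma (S.moment' S' T) 0 = 0 := by
          have : S'.adStab (S.moment' S' T) 0 = 0 := by
            ext y; simp [adStab_apply]
          rw [dgamma, this, map_zero]
        rw [h2, zero_div, Complex.exp_zero, map_one, Units.val_one, mul_one, mul_one] at h1
        rw [hρ.halfCanonical _ _ hk₀, h1, Units.smul_def])
    (S.toK k.1) hmem
  have hz : S.toK (k₀⁻¹ * k).1 = 1 := by
    rw [Subgroup.coe_mul, Subgroup.coe_inv, map_mul, map_inv, h₀, inv_mul_cancel]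
  have hkz : k = k₀ * (k₀⁻¹ * k) := by group
  have hzρ : ∀ e, ρ (k₀⁻¹ * k) e = S.varsigmaK S' (k₀⁻¹ * k).1 • e := by
    intro e
    rcases eq_or_isCoverSign hz with h1 | h1
    · have h2 : k₀⁻¹ * k = 1 := Subtype.ext h1
      rw [h2]
      simp
    · rw [if_neg (isRealSymplectic_ne h1)] at hp
      rw [hρ.genuine _ h1, varsigmaK, varsigma_of_isCoverSign h1,
        neg_one_zpow_eq (p := p) (by rw [cast_sign_sub, hp]), Units.smul_def]
      simp
  conv_lhs => rw [hkz, map_mul, Module.End.mul_apply, hzρ, Units.smul_def, map_smul, h₁,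
    Units.smul_def, smul_smul, mul_comm, ← Units.val_mul, ← Units.smul_def, ← map_mul,
    ← Subgroup.coe_mul, ← hkz]

/-- The kernel of `K̃_X → K'_{X'}` acts through the product of `ς` and a character of the component
group. -/
lemma IsAdmissible.exists_componentDual [FiniteDimensional ℂ E] (hρ : IsAdmissible ρ p)
    (hT : T ∈ S.Xcirc S')
    (hp : ((if ε = 1 then finrank ℂ V else finrank ℂ V' : ℕ) : ZMod 2) = p) :
    ∃ χ : S.componentDual, ∀ k : S.stab (S.moment S' T), IsPair S S' T k 1 → ∀ e,
      ρ k e = (χ.1 (S.toK k.1) * S.varsigmaK S' k.1) • e := by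
  by_cases h11 : ε = 1 ∧ δ = 1
  · obtain ⟨hε, hδ⟩ := h11
    have hvar : ∀ k, S.varsigmaK S' k = 1 := fun k => varsigma_of_pos hδ _ k
    have := hρ.nontrivial
    let d : ℤˣ → S.stab (S.moment S' T) →* ℂˣ := fun η =>
      (S.signDet hδ η).comp (S.toK.comp (S.stab (S.moment S' T)).subtype)
    have hone : ∀ k, IsPair S S' T k 1 → d 1 k = 1 → d (-1) k = 1 → ρ k = 1 := by
      intro k hk h1 h2
      ext e
      rw [hρ.apply_of_comp_eq hT hp hk, hvar, one_smul]
      · rfl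
      · intro _ _ η
        rcases Int.units_eq_one_or η with rfl | rfl
        · exact h1
        · exact h2
    let N : Subgroup (S.stab (S.moment S' T)) :=
      { carrier := {k | IsPair S S' T k 1}
        one_mem' := IsPair.one
        mul_mem' := fun ha hb => by simpa using IsPair.mul ha hb
        inv_mem' := fun ha => by simpa using IsPair.inv ha }
    -- commutators with elements of the kernel lie in the kernel and have determinants `1`, so they act
    -- trivially; by Schur's lemma the kernel acts by a character
    have hcomm : ∀ k : N, ∀ l, ρ k.1 * ρ l = ρ l * ρ k.1 := by
      intro k l
      obtain ⟨l', hl⟩ := exists_isPair_right hT l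
      have h1 : IsPair S S' T (k.1 * l * k.1⁻¹ * l⁻¹) 1 := by
        have := ((k.2.mul hl).mul k.2.inv).mul hl.inv
        simpa using this
      have hd : ∀ η, d η (k.1 * l * k.1⁻¹ * l⁻¹) = 1 := by
        intro η
        simp only [map_mul, map_inv]
        rw [mul_right_comm (d η k.1), mul_inv_cancel, one_mul, mul_inv_cancel]
      have h2 := hone _ h1 (hd 1) (hd (-1))
      rw [← map_mul, ← map_mul]
      have h3 : k.1 * l = (k.1 * l * k.1⁻¹ * l⁻¹) * (l * k.1) := by group
      rw [h3, map_mul, h2, one_mul]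
    have hsc : ∀ k : N, ∃ c : ℂ, ∀ e, ρ k.1 e = c • e := fun k => hρ.exists_eq_smul (hcomm k)
    choose c hc using hsc
    obtain ⟨e₀, he₀⟩ := exists_ne (0 : E)
    have hinj : ∀ {a b : ℂ}, a • e₀ = b • e₀ → a = b := fun h => smul_left_injective ℂ he₀ h
    let c' : N →* ℂˣ := MonoidHom.toHomUnits
      { toFun := c
        map_one' := hinj (by rw [← hc]; simp)
        map_mul' := fun a b => hinj (by
          rw [← hc, Subgroup.coe_mul, map_mul, Module.End.mul_apply, hc b, map_smul, hc a,
            smul_smul, mul_comm]) }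
    obtain ⟨i, j, hij⟩ := MonoidHom.eq_of_trivial_on_ker N c' (d 1) (d (-1))
      (fun g => S.signDet_mul_self hδ 1 _) (fun g => S.signDet_mul_self hδ (-1) _) (by
        intro g h1 h2
        refine Units.ext (hinj ?_)
        change c g • e₀ = (1 : ℂ) • e₀
        rw [← hc, hone _ g.2 h1 h2, one_smul]
        rfl)
    refine ⟨⟨S.signDet hδ 1 ^ i * S.signDet hδ (-1) ^ j, mul_mem
      (pow_mem (signDet_mem_componentDual hδ 1) i)
      (pow_mem (signDet_mem_componentDual hδ (-1)) j)⟩, fun k hk e => ?_⟩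
    rw [hvar, mul_one, hc ⟨k, hk⟩, Units.smul_def]
    congr 1
    exact congrArg Units.val (hij ⟨k, hk⟩)
  · refine ⟨1, fun k hk e => ?_⟩
    rw [hρ.apply_of_comp_eq hT hp hk fun h1 h2 => absurd ⟨h1, h2⟩ h11]
    simp

/-- Every admissible representation of `K̃_X` is, up to a character of the component group, the lift
of an admissible representation of `K̃'_{X'}`. -/
theorem IsAdmissible.exists_descent [FiniteDimensional ℂ E] (hρ : IsAdmissible ρ p)
    (hT : T ∈ S.Xcirc S')
    (hp : ((if ε = 1 then finrank ℂ V else finrank ℂ V' : ℕ) : ZMod 2) = p) :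
    ∃ (χ : S.componentDual) (ρ' : S'.stab (S.moment' S' T) →* End ℂ E),
      IsLiftOf S S' T χ (LinearEquiv.refl ℂ E) ρ ρ' ∧ IsAdmissible ρ' p := by
  obtain ⟨χ, hχ⟩ := hρ.exists_componentDual hT hp
  -- the scalar by which the two actions of a pair `(k, k')` differ
  let m : S.stab (S.moment S' T) → S'.stab (S.moment' S' T) → ℂˣ := fun k k' =>
    χ.1 (S.toK k.1) * S.varsigmaK S' k.1 * S.varsigmaK' S' k'.1
  have hm : ∀ k l k' l', m (k * l) (k' * l') = m k k' * m l l' := by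
    intro k l k' l'
    simp only [m, Subgroup.coe_mul, map_mul]
    ac_rfl
  have hm1 : m 1 1 = 1 := by simp [m]
  choose f hf using fun k' => exists_isPair_left hT k'
  -- `ρ' k'` does not depend on the choice of `k` over `k'`
  have huniq : ∀ k l k', IsPair S S' T k k' → IsPair S S' T l k' → ∀ e,
      (m k k')⁻¹ • ρ k e = (m l k')⁻¹ • ρ l e := by
    intro k l k' hk hl e
    have h1 : IsPair S S' T (l⁻¹ * k) 1 := by simpa using hl.inv.mul hk
    have h2 : k = l * (l⁻¹ * k) := by group
    have h3 : m k k' = m l k' * m (l⁻¹ * k) 1 := by rw [← hm, mul_one, ← h2]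
    have h4 : ρ (l⁻¹ * k) e = m (l⁻¹ * k) 1 • e := by
      rw [hχ _ h1]
      simp [m]
    have h5 : ρ k e = m (l⁻¹ * k) 1 • ρ l e := by
      conv_lhs => rw [h2, map_mul, Module.End.mul_apply, h4, Units.smul_def, map_smul]
      rfl
    rw [h3, h5, smul_smul, mul_inv, inv_mul_cancel_right]
  let ρ' : S'.stab (S.moment' S' T) →* End ℂ E :=
    { toFun := fun k' => (((m (f k') k')⁻¹ : ℂˣ) : ℂ) • ρ (f k')
      map_one' := by
        ext e
        have := huniq _ _ _ (hf 1) IsPair.one e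
        rw [hm1] at this
        simpa [Units.smul_def] using this
      map_mul' := by
        intro a b
        ext e
        have := huniq _ _ _ (hf (a * b)) ((hf a).mul (hf b)) e
        rw [hm, mul_inv (m (f a) a) (m (f b) b), map_mul, mul_smul] at this
        simp only [LinearMap.smul_apply, Module.End.mul_apply, map_smul]
        rw [smul_comm]
        exact this }
  have hlift : IsLiftOf S S' T χ (LinearEquiv.refl ℂ E) ρ ρ' := by
    intro k k' hk e
    change ρ k e = m k k' • ((m (f k') k')⁻¹ • ρ (f k') e)
    rw [← huniq _ _ _ hk (hf k'), smul_smul, mul_inv_cancel, one_smul]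
  have hlift' : ∀ k k', IsPair S S' T k k' → ∀ e, ρ k e = m k k' • ρ' k' e := hlift
  refine ⟨χ, ρ', hlift, hρ.nontrivial, ?_, ?_, ?_⟩
  · intro F hF
    refine hρ.irreducible F fun k e he => ?_
    obtain ⟨k', hk⟩ := exists_isPair_right hT k
    rw [hlift' k k' hk]
    exact F.smul_mem _ (hF k' e he)
  · intro x' k' hk' e
    obtain ⟨x, rfl⟩ := S.lieDescent_surjective S' hT x'
    have hx := S.comp_lieDescent S' hT x
    obtain ⟨k, hk, hpair⟩ := exists_isExp_pair_left hx hk'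
    have h1 := hlift' ⟨k, isExp_mem_stab hk⟩ k' hpair e
    rw [hρ.halfCanonical _ _ hk, exp_half_dgamma_eq hT hx hk hk'] at h1
    have h2 : m ⟨k, isExp_mem_stab hk⟩ k' = S.varsigmaK S' k * S.varsigmaK' S' k'.1 := by
      simp only [m]
      rw [componentDual_of_isExp χ hk, one_mul]
    rw [h2, mul_smul, ← Units.val_mul, ← Units.smul_def] at h1
    exact ((smul_left_cancel_iff _).mp h1).symm
  · intro z hz e
    have h1 := hlift' 1 z (isPair_of_isCoverSign_right hz) e
    have hε : ε = 1 := by have := hz.1.1; rwa [neg_inj] at this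
    rw [if_pos hε] at hp
    have h2 : m 1 z = (-1) ^ p.val := by
      simp only [m, Subgroup.coe_one, map_one, one_mul]
      rw [varsigmaK', varsigma_of_isCoverSign hz, neg_one_zpow_eq (p := p) (by rw [cast_sign_sub', hp])]
    have h3 : ((-1 : ℂˣ) ^ p.val) * (-1) ^ p.val = 1 := by rw [← mul_pow]; simp
    rw [map_one, h2, Module.End.one_apply] at h1
    have h4 : (-1 : ℂˣ) ^ p.val • e = ρ' z e := by
      nth_rewrite 1 [h1]
      rw [smul_smul, h3, one_smul]
    rw [← h4, Units.smul_def]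
    simp

end CartanSpace

/-! ### Every nilpotent element of `𝔭` has a descent -/

lemma LinearMap.finrank_comap_of_surjective {K V W : Type*} [Field K] [AddCommGroup V] [Module K V]
    [FiniteDimensional K V] [AddCommGroup W] [Module K W] {T : V →ₗ[K] W}
    (hT : Function.Surjective T) (q : Submodule K W) :
    finrank K (q.comap T) = finrank K q + finrank K (LinearMap.ker T) := by
  have h1 := LinearMap.finrank_range_add_finrank_ker (T.domRestrict (q.comap T))
  have h2 : LinearMap.range (T.domRestrict (q.comap T)) = q := by
    rw [LinearMap.range_domRestrict, Submodule.map_comap_eq_of_surjective hT]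
  have h3 : LinearMap.ker (T.domRestrict (q.comap T)) =
      (LinearMap.ker T).comap (q.comap T).subtype := rfl
  have h4 : LinearMap.ker T ≤ q.comap T := fun v hv => by
    rw [Submodule.mem_comap, LinearMap.mem_ker.mp hv]; exact q.zero_mem
  rw [h2, h3, (Submodule.comapSubtypeEquivOfLe h4).finrank_eq] at h1
  exact h1.symm

namespace CartanSpace

variable {ε δ : ℤˣ} {V : Type v} [AddCommGroup V] [Module ℂ V] [FiniteDimensional ℂ V]
  {V' : Type v} [AddCommGroup V'] [Module ℂ V'] [FiniteDimensional ℂ V']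
  {S : CartanSpace ε δ V} {S' : CartanSpace (-ε) (-δ) V'} {T : V →ₗ[ℂ] V'}

/-- The form `⟨X u, X v⟩' = ⟨u, X v⟩` on the range of `X`. -/
def rangeForm (S : CartanSpace ε δ V) (X : End ℂ V) : LinearMap.BilinForm ℂ (LinearMap.range X) :=
  S.form.compl₁₂
    (X.rangeRestrict.exists_rightInverse_of_surjective (LinearMap.range_rangeRestrict X)).choose
    (LinearMap.range X).subtype

lemma rangeForm_apply {X : End ℂ V} (hX : X ∈ S.lieG) (u : V) (b : LinearMap.range X) :
    S.rangeForm X (X.rangeRestrict u) b = S.form u b := by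
  obtain ⟨_, v, rfl⟩ := b
  have hσ := (X.rangeRestrict.exists_rightInverse_of_surjective
    (LinearMap.range_rangeRestrict X)).choose_spec
  set σ := (X.rangeRestrict.exists_rightInverse_of_surjective
    (LinearMap.range_rangeRestrict X)).choose
  have h1 : X (σ (X.rangeRestrict u)) = X u :=
    congrArg Subtype.val (LinearMap.congr_fun hσ (X.rangeRestrict u))
  change S.form (σ (X.rangeRestrict u)) (X v) = S.form u (X v)
  have h2 := hX (σ (X.rangeRestrict u)) v
  have h3 := hX u v
  rw [h1] at h2
  linear_combination h2 - h3

/-- The space carrying the descent of `X ∈ 𝔭`: the range of `X` with the form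
`⟨X u, X v⟩' = ⟨u, X v⟩` and with `L' = - δ i L`. The factor `- δ i` puts the corestriction of `X`
into `𝒳°`. -/
def rangeSpace (S : CartanSpace ε δ V) {X : End ℂ V} (hX : X ∈ S.lieP) :
    CartanSpace (-ε) (-δ) (LinearMap.range X) where
  form := S.rangeForm X
  nondeg := by
    constructor
    · rintro ⟨_, u, rfl⟩ h
      apply Subtype.ext
      refine S.eq_of_form_left fun z => ?_
      have h1 := h (X.rangeRestrict z)
      have h2 := rangeForm_apply hX.1 u (X.rangeRestrict z)
      have h3 := hX.1 u z
      change S.rangeForm X (X.rangeRestrict u) _ = 0 at h1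
      rw [h1] at h2
      rw [← show (0 : ℂ) = S.form u (X z) from h2, add_zero] at h3
      simpa using h3
    · rintro b h
      apply Subtype.ext
      refine S.eq_of_form_right fun z => ?_
      rw [← rangeForm_apply hX.1, h]
      simp
  form_symm := by
    rintro ⟨_, u, rfl⟩ ⟨_, w, rfl⟩
    have h1 := rangeForm_apply hX.1 u (X.rangeRestrict w)
    have h2 := rangeForm_apply hX.1 w (X.rangeRestrict u)
    change S.rangeForm X (X.rangeRestrict u) (X.rangeRestrict w) =
      _ * S.rangeForm X (X.rangeRestrict w) (X.rangeRestrict u)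
    rw [h1, h2]
    have h3 := hX.1 u w
    change S.form u (X w) = _ * S.form w (X u)
    rw [S.form_symm (X u) w] at h3
    push_cast
    linear_combination h3
  L := (-(((δ : ℤ) : ℂ) * Complex.I)) • S.L.restrict (p := LinearMap.range X)
    (by rintro _ ⟨u, rfl⟩; exact ⟨-S.L u, by rw [map_neg, hX.2]⟩)
  L_sq := by
    intro a
    apply Subtype.ext
    change (-(((δ : ℤ) : ℂ) * Complex.I)) • S.L ((-(((δ : ℤ) : ℂ) * Complex.I)) • S.L a) =
      (((-δ : ℤˣ) : ℤ) : ℂ) • (a : V)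
    rw [map_smul, S.L_sq, smul_smul, smul_smul]
    congr 1
    push_cast
    have h1 := unit_mul_self δ
    linear_combination ((δ : ℤ) : ℂ) * (((δ : ℤ) : ℂ) * ((δ : ℤ) : ℂ)) * Complex.I_sq -
      ((δ : ℤ) : ℂ) * h1
  L_form := by
    rintro ⟨_, u, rfl⟩ b
    have h0 : ∀ b : LinearMap.range X, S.L b ∈ LinearMap.range X := by
      rintro ⟨_, u, rfl⟩
      exact ⟨-S.L u, by rw [map_neg, hX.2]⟩
    have h1 := rangeForm_apply hX.1 ((((δ : ℤ) : ℂ) * Complex.I) • S.L u)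
      ((-(((δ : ℤ) : ℂ) * Complex.I)) • ⟨S.L b, h0 b⟩)
    have h2 : X.rangeRestrict ((((δ : ℤ) : ℂ) * Complex.I) • S.L u) =
        (-(((δ : ℤ) : ℂ) * Complex.I)) • ⟨S.L (X u), h0 ⟨X u, u, rfl⟩⟩ := by
      apply Subtype.ext
      change X ((((δ : ℤ) : ℂ) * Complex.I) • S.L u) =
        (-(((δ : ℤ) : ℂ) * Complex.I)) • S.L (X u)
      rw [map_smul, hX.2, smul_neg, neg_smul, neg_neg]
    rw [h2] at h1
    refine h1.trans ?_
    rw [show (⟨X u, ⟨u, rfl⟩⟩ : LinearMap.range X) = X.rangeRestrict u from rfl,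
      rangeForm_apply hX.1]
    change S.form _ ((-(((δ : ℤ) : ℂ) * Complex.I)) • S.L b) = _
    rw [map_smul, map_smul, LinearMap.smul_apply, S.L_form, smul_eq_mul, smul_eq_mul]
    have h3 := unit_mul_self δ
    linear_combination (-S.form u b * (((δ : ℤ) : ℂ) * ((δ : ℤ) : ℂ))) * Complex.I_sq +
      S.form u b * h3

/-- Every `X ∈ 𝔭` is `T^⋆ T` for the corestriction `T` of `X` to its range. -/
theorem exists_moment_eq (S : CartanSpace ε δ V) {X : End ℂ V} (hX : X ∈ S.lieP) :
    ∃ (V' : Type v) (_ : AddCommGroup V') (_ : Module ℂ V') (_ : FiniteDimensional ℂ V')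
      (S' : CartanSpace (-ε) (-δ) V') (T : V →ₗ[ℂ] V'), T ∈ S.Xcirc S' ∧ S.moment S' T = X := by
  refine ⟨LinearMap.range X, inferInstance, inferInstance, inferInstance, S.rangeSpace hX,
    X.rangeRestrict, ⟨LinearMap.surjective_rangeRestrict X, fun x => ?_⟩, ?_⟩
  · apply Subtype.ext
    change ((δ : ℤ) : ℂ) • ((-(((δ : ℤ) : ℂ) * Complex.I)) • S.L (X x)) = Complex.I • X (S.L x)
    have h := hX.2 x
    rw [h, smul_smul, smul_neg, ← neg_smul]
    congr 1
    linear_combination Complex.I * unit_mul_self δ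
  · ext x
    have h : ∀ b, ((b : LinearMap.range X) : V) = S.adj (S.rangeSpace hX) X.rangeRestrict b :=
      fun b => S.eq_adj _ _ _ _ fun x => (rangeForm_apply hX.1 x b).symm
    exact (h _).symm

lemma comp_moment_pow (n : ℕ) (v : V) :
    T ((S.moment S' T ^ n) v) = (S.moment' S' T ^ n) (T v) := by
  induction n generalizing v with
  | zero => rfl
  | succ n ih =>
    rw [pow_succ, pow_succ, Module.End.mul_apply, Module.End.mul_apply, ih]
    rfl

lemma isNilpotent_moment' (h : IsNilpotent (S.moment S' T)) : IsNilpotent (S.moment' S' T) := by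
  obtain ⟨n, hn⟩ := h
  refine ⟨n + 1, ?_⟩
  ext v
  rw [pow_succ, Module.End.mul_apply]
  change (S.moment' S' T ^ n) (T (S.adj S' T v)) = 0
  rw [← comp_moment_pow, hn]
  simp

/-- The Young diagram of `X'` is obtained from that of `X` by removing the first column. -/
lemma column_moment' (hT : Function.Surjective T) (l : ℕ) :
    column (S.moment' S' T) l = column (S.moment S' T) (l + 1) := by
  have key : ∀ n, finrank ℂ (LinearMap.ker (S.moment S' T ^ (n + 1))) =
      finrank ℂ (LinearMap.ker (S.moment' S' T ^ n)) + finrank ℂ (LinearMap.ker T) := by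
    intro n
    have hker : LinearMap.ker (S.moment S' T ^ (n + 1)) =
        (LinearMap.ker (S.moment' S' T ^ n)).comap T := by
      ext v
      rw [Submodule.mem_comap, LinearMap.mem_ker, LinearMap.mem_ker, pow_succ', Module.End.mul_apply,
        ← comp_moment_pow]
      change S.adj S' T (T _) = 0 ↔ _
      rw [map_eq_zero_iff _ (S.adj_injective S' hT)]
    rw [hker, LinearMap.finrank_comap_of_surjective hT]
  rw [column, column, key, key, Nat.add_sub_add_right]

lemma column_zero (X : End ℂ V) : column X 0 = finrank ℂ (LinearMap.ker X) := by
  rw [column, zero_add, pow_one, pow_zero]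
  have : LinearMap.ker (1 : End ℂ V) = ⊥ := LinearMap.ker_id
  rw [this, finrank_bot, Nat.sub_zero]

lemma finrank_ker_pos {X : End ℂ V} (hX : IsNilpotent X) (hV : 0 < finrank ℂ V) :
    0 < finrank ℂ (LinearMap.ker X) := by
  have := finrank_pos_iff.mp hV
  rw [finrank_pos_iff, Submodule.nontrivial_iff_ne_bot]
  intro h
  obtain ⟨n, hn⟩ := hX
  have h1 : Function.Injective (X ^ n) := by
    rw [Module.End.coe_pow]
    exact (LinearMap.ker_eq_bot.mp h).iterate n
  obtain ⟨v, hv⟩ := exists_ne (0 : V)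
  exact hv (h1 (by rw [hn]; simp))

lemma finrank_eq_add (hT : Function.Surjective T) :
    finrank ℂ V = finrank ℂ V' + finrank ℂ (LinearMap.ker T) := by
  rw [← T.finrank_range_add_finrank_ker, LinearMap.range_eq_top.mpr hT, finrank_top]

/-- All columns of the Young diagram of `X` have parity `p`. -/
def HasColumnParity (X : End ℂ V) (p : ZMod 2) : Prop :=
  ∀ l, 0 < column X l → (column X l : ZMod 2) = p

lemma HasColumnParity.moment' {p : ZMod 2} (hT : Function.Surjective T)
    (h : HasColumnParity (S.moment S' T) p) : HasColumnParity (S.moment' S' T) p := by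
  intro l
  rw [column_moment' hT]
  exact h _

/-- The first column of the diagram of `X` has length `dim V - dim V'`, and one of the two dimensions
is even. -/
lemma HasColumnParity.finrank {p : ZMod 2} (hT : Function.Surjective T)
    (h : HasColumnParity (S.moment S' T) p) (hX : IsNilpotent (S.moment S' T))
    (hV : 0 < finrank ℂ V) :
    ((if ε = 1 then Module.finrank ℂ V else Module.finrank ℂ V' : ℕ) : ZMod 2) = p := by
  have h1 := h 0
  rw [column_zero] at h1
  have h2 := h1 (finrank_ker_pos hX hV)
  rw [S.ker_moment S' hT] at h2
  have h3 := congrArg (Nat.cast : ℕ → ZMod 2) (finrank_eq_add hT)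
  push_cast at h3
  have heven : ∀ n : ℕ, Even n → (n : ZMod 2) = 0 := fun n hn =>
    (ZMod.natCast_eq_zero_iff_even).mpr hn
  rcases Int.units_eq_one_or ε with hε | hε
  · rw [if_pos hε, h3, heven _ (S'.even_finrank (by rw [hε])), zero_add, h2]
  · have h4 : ¬ ε = 1 := by rw [hε]; decide
    rw [if_neg h4]
    rw [heven _ (S.even_finrank hε), h2] at h3
    have h5 : (Module.finrank ℂ V' : ZMod 2) = -p := by linear_combination -h3
    rw [h5, ZMod.neg_eq_self_mod_two]

/-! ### Admissible representations are algebraic -/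

/-- An admissible representation of `K̃_X` is automatically algebraic: iterated descent reduces this
to the case `V = 0`. -/
theorem IsAdmissible.isRegularRep {p : ZMod 2} {E : Type*} [AddCommGroup E] [Module ℂ E]
    [FiniteDimensional ℂ E] :
    ∀ (n : ℕ) {ε δ : ℤˣ} {V : Type v} [AddCommGroup V] [Module ℂ V] [FiniteDimensional ℂ V]
      {S : CartanSpace ε δ V} {X : End ℂ V}, finrank ℂ V = n → X ∈ S.lieP → IsNilpotent X →
      HasColumnParity X p → ∀ {ρ : S.stab X →* End ℂ E}, IsAdmissible ρ p → IsRegularRep ρ := by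
  intro n
  induction n using Nat.strong_induction_on with
  | _ n ih =>
  intro ε δ V _ _ _ S X hn hXp hX hcol ρ hρ
  rcases Nat.eq_zero_or_pos n with h0 | hpos
  · subst h0
    have hsub : Subsingleton V := finrank_zero_iff.mp hn
    intro e φ
    -- `K̃` has at most two elements, on which `c` is `1` and `-1` and the action is known
    have h1 : (fun k : S.stab X => φ (ρ k e)) =
        (((1 + (-1 : ℂ) ^ p.val) / 2 * φ e) • 1) +
          (((1 - (-1 : ℂ) ^ p.val) / 2 * φ e) • fun k : S.stab X => (S.toC k.1 : ℂ)) := by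
      funext k
      have hk1 : S.toK k.1 = 1 :=
        Subtype.ext (LinearEquiv.ext fun v => Subsingleton.elim _ _)
      simp only [Pi.add_apply, Pi.smul_apply, Pi.one_apply, smul_eq_mul]
      rcases eq_or_isCoverSign hk1 with h | h
      · have hk : k = 1 := Subtype.ext h
        rw [hk]
        simp
        ring
      · rw [hρ.genuine k h, h.2.2, map_smul, smul_eq_mul]
        push_cast
        ring
    rw [h1]
    exact add_mem (Subalgebra.smul_mem _ (one_mem _) _) (Subalgebra.smul_mem _ regular_toC _)
  · obtain ⟨V', _, _, _, S', T, hT, rfl⟩ := S.exists_moment_eq hXp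
    obtain ⟨χ, ρ', hlift, hρ'⟩ := hρ.exists_descent hT (hcol.finrank hT.1 hX (by rw [hn]; exact hpos))
    refine hlift.isRegularRep hT (ih (finrank ℂ V') ?_ rfl (S.moment'_mem_lieP S' hT)
      (isNilpotent_moment' hX) (hcol.moment' hT.1) hρ')
    have h1 := finrank_ker_pos hX (by rw [hn]; exact hpos)
    rw [S.ker_moment S' hT.1] at h1
    rw [← hn, finrank_eq_add hT.1]
    omega

end CartanSpace

/-! ### Equivariant bundles and isotropy representations -/

namespace CartanSpace

variable {ε δ : ℤˣ} {V : Type v} [AddCommGroup V] [Module ℂ V] [FiniteDimensional ℂ V]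
  {S : CartanSpace ε δ V}

section Conjugation

variable {X Y : End ℂ V} {g : S.Kt}

lemma Ad_inv (h : S.Ad g X = Y) : S.Ad g⁻¹ Y = X := by
  rw [← h, ← Ad_mul, inv_mul_cancel, Ad_one]

/-- Conjugation `K̃_Y → K̃_X`, `k ↦ g⁻¹ k g`, if `g` carries `X` to `Y`. -/
def conjStab (h : S.Ad g X = Y) (k : S.stab Y) : S.stab X :=
  ⟨g⁻¹ * k.1 * g, by
    change S.Ad _ X = X
    rw [Ad_mul, h, Ad_mul, k.2, Ad_inv h]⟩

lemma toGL_mul_inv (g : S.Kt) : (S.toGL g : End ℂ V) * (S.toGL g⁻¹ : End ℂ V) = 1 := by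
  ext v
  rw [map_inv]
  exact (S.toGL g).apply_symm_apply v

lemma toGL_inv_mul (g : S.Kt) : (S.toGL g⁻¹ : End ℂ V) * (S.toGL g : End ℂ V) = 1 := by
  ext v
  rw [map_inv]
  exact (S.toGL g).symm_apply_apply v

lemma coe_toGL_mul (a b : S.Kt) :
    (S.toGL (a * b) : End ℂ V) = (S.toGL a : End ℂ V) * (S.toGL b : End ℂ V) := by
  rw [map_mul]
  rfl

lemma regular_conjStab (h : S.Ad g X = Y) {f : S.stab X → ℂ}
    (hf : f ∈ S.regularFunctions (S.stab X)) :
    (fun k => f (conjStab h k)) ∈ S.regularFunctions (S.stab Y) := by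
  let Λ : End ℂ V →ₗ[ℂ] End ℂ V := LinearMap.mulLeft ℂ (S.toGL g⁻¹ : End ℂ V) ∘ₗ
    LinearMap.mulRight ℂ (S.toGL g : End ℂ V)
  have hΛ : ∀ k : S.stab Y, (S.toGL (conjStab h k).1 : End ℂ V) = Λ (S.toGL k.1 : End ℂ V) := by
    intro k
    change (S.toGL (g⁻¹ * k.1 * g) : End ℂ V) = _
    rw [coe_toGL_mul, coe_toGL_mul, mul_assoc]
    rfl
  have hΛ' : ∀ k : S.stab Y, (S.toGL (conjStab h k).1⁻¹ : End ℂ V) =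
      Λ (S.toGL k.1⁻¹ : End ℂ V) := by
    intro k
    change (S.toGL (g⁻¹ * k.1 * g)⁻¹ : End ℂ V) = _
    rw [show (g⁻¹ * k.1 * g)⁻¹ = g⁻¹ * k.1⁻¹ * g by group, coe_toGL_mul, coe_toGL_mul, mul_assoc]
    rfl
  induction hf using Algebra.adjoin_induction with
  | mem f hf =>
    rcases hf with (⟨φ, rfl⟩ | ⟨φ, rfl⟩) | rfl | rfl
    · simp only [hΛ]
      exact regular_linear (φ ∘ₗ Λ)
    · simp only [hΛ']
      exact regular_linear_inv (φ ∘ₗ Λ)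
    · have : (fun k : S.stab Y => (S.toC (conjStab h k).1 : ℂ)) = fun k => (S.toC k.1 : ℂ) := by
        funext k
        change (S.toC (g⁻¹ * k.1 * g) : ℂ) = _
        rw [map_mul, map_mul, map_inv, mul_right_comm, inv_mul_cancel, one_mul]
      rw [this]
      exact regular_toC
    · have : (fun k : S.stab Y => (S.toC (conjStab h k).1⁻¹ : ℂ)) =
          fun k => (S.toC k.1⁻¹ : ℂ) := by
        funext k
        change (S.toC (g⁻¹ * k.1 * g)⁻¹ : ℂ) = _
        rw [map_inv, map_mul, map_mul, map_inv, mul_right_comm, inv_mul_cancel, one_mul, map_inv]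
      rw [this]
      exact regular_toC_inv
  | algebraMap r => exact regular_const r
  | add f g _ _ hf hg => exact add_mem hf hg
  | mul f g _ _ hf hg => exact mul_mem hf hg

/-- Conjugation by an element of `K̃` commutes with everything defining `𝔨_X`. -/
lemma conj_mem_lieStab (h : S.Ad g X = Y) {x : End ℂ V} (hx : x ∈ S.lieStab X) :
    (S.toGL g : End ℂ V) * x * (S.toGL g⁻¹ : End ℂ V) ∈ S.lieStab Y := by
  obtain ⟨h1, h2, h3⟩ := S.mem_lieStab_iff.mp hx
  have hL := S.mul_L_of_mem_K (S.toK g).2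
  have hL' := S.mul_L_of_mem_K (S.toK g⁻¹).2
  change (S.toGL g : End ℂ V) * S.L = S.L * (S.toGL g : End ℂ V) at hL
  change (S.toGL g⁻¹ : End ℂ V) * S.L = S.L * (S.toGL g⁻¹ : End ℂ V) at hL'
  have hd := S.mem_isom_iff.mp (S.toK g).2.1
  have hX := Ad_eq_iff.mp h
  have hX' := Ad_eq_iff.mp (Ad_inv h)
  have hd1 : S.dagger (S.toGL g : End ℂ V) = (S.toGL g⁻¹ : End ℂ V) := by
    have e := S.dagger_mul_self_of_mem_K (S.toK g).2
    change S.dagger (S.toGL g : End ℂ V) * (S.toGL g : End ℂ V) = 1 at e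
    calc S.dagger (S.toGL g : End ℂ V) = S.dagger (S.toGL g : End ℂ V) *
          ((S.toGL g : End ℂ V) * (S.toGL g⁻¹ : End ℂ V)) := by rw [toGL_mul_inv, mul_one]
      _ = _ := by rw [← mul_assoc, e, one_mul]
  have hd2 : S.dagger (S.toGL g⁻¹ : End ℂ V) = (S.toGL g : End ℂ V) := by
    rw [← hd1, dagger_dagger]
  refine S.mem_lieStab_iff.mpr ⟨?_, ?_, ?_⟩
  · rw [dagger_mul, dagger_mul, hd1, hd2, h1]
    simp [mul_assoc]
  · rw [mul_assoc, hL', ← mul_assoc, mul_assoc _ x, h2, ← mul_assoc, hL]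
    simp only [mul_assoc]
  · rw [mul_assoc, hX', ← mul_assoc, mul_assoc _ x, h3, ← mul_assoc, hX]
    simp only [mul_assoc]

/-- Conjugation `𝔨_Y ≃ 𝔨_X`, `x ↦ g⁻¹ x g`, if `g` carries `X` to `Y`. -/
def conjLie (h : S.Ad g X = Y) : S.lieStab Y ≃ₗ[ℂ] S.lieStab X where
  toFun x := ⟨(S.toGL g⁻¹ : End ℂ V) * x.1 * (S.toGL g : End ℂ V), by
    have := conj_mem_lieStab (Ad_inv h) x.2
    rwa [inv_inv] at this⟩
  invFun x := ⟨(S.toGL g : End ℂ V) * x.1 * (S.toGL g⁻¹ : End ℂ V), conj_mem_lieStab h x.2⟩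
  map_add' a b := Subtype.ext (by simp [mul_add, add_mul])
  map_smul' c a := Subtype.ext (by simp)
  left_inv x := Subtype.ext (by
    change (S.toGL g : End ℂ V) * ((S.toGL g⁻¹ : End ℂ V) * x.1 * (S.toGL g : End ℂ V)) *
      (S.toGL g⁻¹ : End ℂ V) = x.1
    rw [mul_assoc, mul_assoc, toGL_mul_inv, mul_one, ← mul_assoc, toGL_mul_inv, one_mul])
  right_inv x := Subtype.ext (by
    change (S.toGL g⁻¹ : End ℂ V) * ((S.toGL g : End ℂ V) * x.1 * (S.toGL g⁻¹ : End ℂ V)) *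
      (S.toGL g : End ℂ V) = x.1
    rw [mul_assoc, mul_assoc, toGL_inv_mul, mul_one, ← mul_assoc, toGL_inv_mul, one_mul])

lemma coe_conjLie (h : S.Ad g X = Y) (x : S.lieStab Y) : ((conjLie h x : S.lieStab X) : End ℂ V) =
    (S.toGL g⁻¹ : End ℂ V) * x.1 * (S.toGL g : End ℂ V) := rfl

lemma dgamma_conjLie (h : S.Ad g X = Y) (x : S.lieStab Y) :
    S.dgamma X (conjLie h x) = S.dgamma Y x := by
  have h1 : S.adStab X (conjLie h x) = (conjLie h).conj (S.adStab Y x) := by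
    ext1 y
    obtain ⟨y, rfl⟩ := (conjLie h).surjective y
    rw [LinearEquiv.conj_apply_apply, LinearEquiv.symm_apply_apply]
    apply Subtype.ext
    rw [adStab_apply, coe_conjLie, coe_conjLie, coe_conjLie, adStab_apply]
    have key : ∀ a b : End ℂ V, (S.toGL g⁻¹ : End ℂ V) * a * (S.toGL g : End ℂ V) *
        ((S.toGL g⁻¹ : End ℂ V) * b * (S.toGL g : End ℂ V)) =
        (S.toGL g⁻¹ : End ℂ V) * (a * b) * (S.toGL g : End ℂ V) := by
      intro a b
      rw [← mul_assoc, ← mul_assoc, mul_assoc _ (S.toGL g : End ℂ V) (S.toGL g⁻¹ : End ℂ V),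
        toGL_mul_inv, mul_one, mul_assoc _ a b]
    rw [key, key, mul_sub, sub_mul]
  rw [dgamma, dgamma, h1, LinearMap.trace_conj']

lemma isExp_conjStab (h : S.Ad g X = Y) {x : S.lieStab Y} {k : S.stab Y} (hk : S.IsExp k.1 x) :
    S.IsExp (conjStab h k).1 (conjLie h x) := by
  constructor
  · change (S.toGL (g⁻¹ * k.1 * g) : End ℂ V) = _
    have h1 : (S.toGL g⁻¹ : End ℂ V) ∘ₗ x.1 = (conjLie h x).1 ∘ₗ (S.toGL g⁻¹ : End ℂ V) := by
      change (S.toGL g⁻¹ : End ℂ V) * x.1 =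
        (S.toGL g⁻¹ : End ℂ V) * x.1 * (S.toGL g : End ℂ V) * (S.toGL g⁻¹ : End ℂ V)
      rw [mul_assoc _ (S.toGL g : End ℂ V), toGL_mul_inv, mul_one]
    have h2 := comp_expEnd h1
    rw [coe_toGL_mul, coe_toGL_mul, hk.1]
    change ((S.toGL g⁻¹ : End ℂ V) ∘ₗ expEnd x.1) * (S.toGL g : End ℂ V) = _
    rw [h2]
    change expEnd _ * (S.toGL g⁻¹ : End ℂ V) * (S.toGL g : End ℂ V) = _
    rw [mul_assoc, toGL_inv_mul, mul_one]
  · intro hS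
    have h1 : S.toC (conjStab h k).1 = S.toC k.1 := by
      change S.toC (g⁻¹ * k.1 * g) = _
      rw [map_mul, map_mul, map_inv, mul_right_comm, inv_mul_cancel, one_mul]
    rw [h1, hk.2 hS]
    congr 2
    have h2 := S.trace_mul_L hS.2 x
    have h3 := S.trace_mul_L hS.2 (conjLie h x)
    have h4 : LinearMap.trace ℂ V ((conjLie h x).1 * S.L) = LinearMap.trace ℂ V (x.1 * S.L) := by
      have hL := S.mul_L_of_mem_K (S.toK g).2
      change (S.toGL g : End ℂ V) * S.L = S.L * (S.toGL g : End ℂ V) at hL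
      rw [coe_conjLie, mul_assoc, hL, mul_assoc, LinearMap.trace_mul_comm, mul_assoc, mul_assoc,
        toGL_mul_inv, mul_one]
    rw [h2, h3] at h4
    exact (mul_left_cancel₀ (mul_ne_zero two_ne_zero Complex.I_ne_zero) h4).symm

lemma isCoverSign_conjStab (h : S.Ad g X = Y) {k : S.stab Y} (hk : S.IsCoverSign k.1) :
    S.IsCoverSign (conjStab h k).1 := by
  refine ⟨hk.1, ?_, ?_⟩
  · change S.toK (g⁻¹ * k.1 * g) = 1
    rw [map_mul, map_mul, hk.2.1, mul_one, map_inv, inv_mul_cancel]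
  · change S.toC (g⁻¹ * k.1 * g) = -1
    rw [map_mul, map_mul, map_inv, mul_right_comm, inv_mul_cancel, one_mul, hk.2.2]

end Conjugation

namespace EquivFamily

variable {O : Set (End ℂ V)} (E : EquivFamily.{u} S O)

/-- The isotropy representation of `K̃_X` on the fiber at `X`. -/
def isoRep (X : O) : S.stab X.1 →* End ℂ (E.fiber X) where
  toFun k := E.act k.1 k.2
  map_one' := LinearMap.ext fun e => E.act_one _ e
  map_mul' a b := LinearMap.ext fun e => E.act_mul a.1 b.1 _ _ _ e

lemma isoRep_apply (X : O) (k : S.stab X.1) (e : E.fiber X) : E.isoRep X k e = E.act k.1 k.2 e := rfl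

lemma act_act {a b c : S.Kt} {X Y Z : O} (hb : S.Ad b X.1 = Y.1) (ha : S.Ad a Y.1 = Z.1)
    (hc : S.Ad c X.1 = Z.1) (h : a * b = c) (e : E.fiber X) :
    E.act a ha (E.act b hb e) = E.act c hc e := by
  subst h
  rw [E.act_mul a b hb ha hc]

lemma act_eq_self {a : S.Kt} {X : O} (h : S.Ad a X.1 = X.1) (ha : a = 1) (e : E.fiber X) :
    E.act a h e = e := by
  subst ha
  exact E.act_one h e

/-- The action of `g` as an isomorphism between fibers. -/
def actEquiv (g : S.Kt) {X Y : O} (h : S.Ad g X.1 = Y.1) : E.fiber X ≃ₗ[ℂ] E.fiber Y :=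
  LinearEquiv.ofLinearMap (E.act g h) (E.act g⁻¹ (Ad_inv h))
    (LinearMap.ext fun e => by
      have h1 : S.Ad 1 Y.1 = Y.1 := Ad_one S _
      rw [LinearMap.comp_apply, E.act_act _ _ h1 (mul_inv_cancel g), E.act_one]
      rfl)
    (LinearMap.ext fun e => by
      have h1 : S.Ad 1 X.1 = X.1 := Ad_one S _
      rw [LinearMap.comp_apply, E.act_act _ _ h1 (inv_mul_cancel g), E.act_one]
      rfl)

lemma actEquiv_apply (g : S.Kt) {X Y : O} (h : S.Ad g X.1 = Y.1) (e : E.fiber X) :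
    E.actEquiv g h e = E.act g h e := rfl

lemma act_actEquiv {g : S.Kt} {X Y : O} (h : S.Ad g X.1 = Y.1) (k : S.stab Y.1) (e : E.fiber X) :
    E.act k.1 k.2 (E.actEquiv g h e) = E.actEquiv g h (E.isoRep X (conjStab h k) e) := by
  have h1 : S.Ad (k.1 * g) X.1 = Y.1 := by rw [Ad_mul, h, k.2]
  have h2 : S.Ad (conjStab h k).1 X.1 = X.1 := (conjStab h k).2
  rw [actEquiv_apply, actEquiv_apply, E.act_act h k.2 h1 rfl]
  change _ = E.act g h (E.act (conjStab h k).1 h2 e)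
  rw [E.act_act h2 h h1 (by change g * (g⁻¹ * k.1 * g) = _; group)]

/-- `K̃` acts transitively on `O`. -/
def _root_.CartanSpace.IsTransitive (S : CartanSpace ε δ V) (O : Set (End ℂ V)) : Prop :=
  ∀ X Y : O, ∃ g, S.Ad g X.1 = Y.1

variable {E} {p : ZMod 2}

lemma IsAOD.isAdmissible_isoRep (hO : S.IsTransitive O) (hE : E.IsAOD p) (X : O) :
    FiniteDimensional ℂ (E.fiber X) ∧ IsAdmissible (E.isoRep X) p where
  left := (hE.algebraic X).1
  right :=
    { nontrivial := by
        obtain ⟨Y, hY⟩ := hE.irreducible.1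
        obtain ⟨g, hg⟩ := hO X Y
        exact (E.actEquiv g hg).toEquiv.nontrivial
      irreducible := by
        intro F hF
        -- the equivariant subbundle with fiber `F` at `X`
        let F' : ∀ Y : O, Submodule ℂ (E.fiber Y) := fun Y =>
          ⨅ (g : S.Kt) (h : S.Ad g Y.1 = X.1), F.comap (E.act g h)
        have hmem : ∀ (Y : O) (e : E.fiber Y), e ∈ F' Y ↔
            ∀ (g : S.Kt) (h : S.Ad g Y.1 = X.1), E.act g h e ∈ F := by
          intro Y e
          simp only [F', Submodule.mem_iInf, Submodule.mem_comap]
        have hFX : F' X = F := by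
          ext e
          rw [hmem]
          constructor
          · intro h
            rw [← E.act_one (Ad_one S X.1) e]
            exact h 1 (Ad_one S X.1)
          · intro he g hg
            exact hF ⟨g, hg⟩ e he
        have := hE.irreducible.2 F' (by
          intro k Y Z h e he
          rw [hmem] at he ⊢
          intro g hg
          rw [E.act_act h hg (by rw [Ad_mul, h, hg]) rfl]
          exact he _ _)
        rcases this with h | h
        · exact Or.inl (hFX ▸ h X)
        · exact Or.inr (hFX ▸ h X)
      halfCanonical := fun x k hk e => hE.halfCanonical X x k.1 k.2 hk e
      genuine := fun k hk e => hE.genuine k.1 X k.2 hk e }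

/-- A bundle on an orbit is an admissible orbit datum as soon as one isotropy representation is
admissible and algebraic. -/
theorem isAOD_of_isoRep (hO : S.IsTransitive O) (X : O) [FiniteDimensional ℂ (E.fiber X)]
    (hE : IsAdmissible (E.isoRep X) p) (hreg : IsRegularRep (E.isoRep X)) : E.IsAOD p where
  algebraic := by
    intro Y
    obtain ⟨g, hg⟩ := hO X Y
    refine ⟨(E.actEquiv g hg).finiteDimensional, fun e φ => ?_⟩
    obtain ⟨e, rfl⟩ := (E.actEquiv g hg).surjective e
    simp only [act_actEquiv]
    exact regular_conjStab hg (hreg e (φ ∘ₗ (E.actEquiv g hg).toLinearMap))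
  irreducible := by
    refine ⟨⟨X, hE.nontrivial⟩, fun F hF => ?_⟩
    have hall : ∀ (Y : O) (g : S.Kt) (hg : S.Ad g X.1 = Y.1) (e : E.fiber X),
        E.actEquiv g hg e ∈ F Y ↔ e ∈ F X := by
      intro Y g hg e
      refine ⟨fun h => ?_, fun h => hF g X Y hg e h⟩
      have h1 := hF g⁻¹ Y X (Ad_inv hg) _ h
      rw [actEquiv_apply, E.act_act hg _ (Ad_one S _) (inv_mul_cancel g), E.act_one] at h1
      exact h1
    rcases hE.irreducible (F X) fun k e he => hF k.1 X X k.2 e he with h | h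
    · left
      intro Y
      obtain ⟨g, hg⟩ := hO X Y
      rw [eq_bot_iff]
      intro e he
      obtain ⟨e, rfl⟩ := (E.actEquiv g hg).surjective e
      rw [hall, h, Submodule.mem_bot] at he
      rw [he, map_zero]
      exact Submodule.zero_mem _
    · right
      intro Y
      obtain ⟨g, hg⟩ := hO X Y
      rw [eq_top_iff]
      intro e _
      obtain ⟨e, rfl⟩ := (E.actEquiv g hg).surjective e
      rw [hall, h]
      exact Submodule.mem_top
  halfCanonical := by
    intro Y x k hk hkx e
    obtain ⟨g, hg⟩ := hO X Y
    obtain ⟨e, rfl⟩ := (E.actEquiv g hg).surjective e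
    rw [E.act_actEquiv hg ⟨k, hk⟩, hE.halfCanonical _ _ (isExp_conjStab hg (k := ⟨k, hk⟩) hkx),
      map_smul, dgamma_conjLie]
  genuine := by
    intro k Y hk hz e
    obtain ⟨g, hg⟩ := hO X Y
    obtain ⟨e, rfl⟩ := (E.actEquiv g hg).surjective e
    rw [E.act_actEquiv hg ⟨k, hk⟩, hE.genuine _ (isCoverSign_conjStab hg (k := ⟨k, hk⟩) hz), map_smul]

/-- Bundles on an orbit are isomorphic if their isotropy representations at one point are. -/
theorem equivalent_of_isoRep {E F : EquivFamily.{u} S O} (hO : S.IsTransitive O) (X : O)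
    (Φ : E.fiber X ≃ₗ[ℂ] F.fiber X) (hΦ : ∀ k e, Φ (E.isoRep X k e) = F.isoRep X k (Φ e)) :
    E.Equivalent F := by
  choose g hg using fun Y => hO X Y
  refine ⟨fun Y => ((E.actEquiv (g Y) (hg Y)).symm.trans Φ).trans (F.actEquiv (g Y) (hg Y)),
    fun k Y Z h e => ?_⟩
  obtain ⟨e, rfl⟩ := (E.actEquiv (g Y) (hg Y)).surjective e
  have hl : S.Ad ((g Z)⁻¹ * k * g Y) X.1 = X.1 := by
    rw [Ad_mul, hg, Ad_mul, h, Ad_inv (hg Z)]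
  have hkg : S.Ad (k * g Y) X.1 = Z.1 := by rw [Ad_mul, hg, h]
  have key : ∀ (G : EquivFamily.{u} S O) (e : G.fiber X), G.act k h (G.actEquiv (g Y) (hg Y) e) =
      G.actEquiv (g Z) (hg Z) (G.isoRep X ⟨_, hl⟩ e) := by
    intro G e
    rw [actEquiv_apply, actEquiv_apply, isoRep_apply, G.act_act (hg Y) h hkg rfl,
      G.act_act hl (hg Z) hkg (by group)]
  simp only [LinearEquiv.trans_apply]
  rw [key E, LinearEquiv.symm_apply_apply, LinearEquiv.symm_apply_apply, hΦ, key F]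

lemma Equivalent.isoRep {E F : EquivFamily.{u} S O} (h : E.Equivalent F) (X : O) :
    ∃ Φ : E.fiber X ≃ₗ[ℂ] F.fiber X, ∀ k e, Φ (E.isoRep X k e) = F.isoRep X k (Φ e) := by
  obtain ⟨Φ, hΦ⟩ := h
  exact ⟨Φ X, fun k e => hΦ k.1 X X k.2 e⟩

/-- The homogeneous bundle on an orbit with a given isotropy representation at `X`; the fibers are
identified by means of a section `g` of the orbit map at `X`. -/
def induced {X : O} (g : O → S.Kt) (hg : ∀ Y : O, S.Ad (g Y) X.1 = Y.1) {M : Type u}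
    [AddCommGroup M] [Module ℂ M] (ρ : S.stab X.1 →* End ℂ M) : EquivFamily.{u} S O where
  fiber _ := M
  act k Y Z h := ρ ⟨(g Z)⁻¹ * k * g Y, by
    change S.Ad _ X.1 = X.1
    rw [Ad_mul, hg, Ad_mul, h, Ad_inv (hg Z)]⟩
  act_one {Y} h e := by
    have : (⟨(g Y)⁻¹ * 1 * g Y, by
        change S.Ad _ X.1 = X.1
        rw [mul_one, inv_mul_cancel, Ad_one]⟩ : S.stab X.1) = 1 := Subtype.ext (by simp)
    rw [this, map_one]
    rfl
  act_mul a b Y Z W hb ha hab e := by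
    rw [← Module.End.mul_apply, ← map_mul]
    congr 2
    exact Subtype.ext (by simp [mul_assoc])

/-- The section of the orbit map is chosen with value `1` at `X`, so that the isotropy representation of
the induced bundle at `X` is `ρ` itself. -/
lemma exists_isoRep_eq (hO : S.IsTransitive O) (X : O) {M : Type u}
    [AddCommGroup M] [Module ℂ M] (ρ : S.stab X.1 →* End ℂ M) :
    ∃ (E : EquivFamily.{u} S O) (Φ : E.fiber X ≃ₗ[ℂ] M),
      ∀ k e, Φ (E.isoRep X k e) = ρ k (Φ e) := by
  classical
  choose g₀ hg₀ using fun Y => hO X Y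
  let g : O → S.Kt := fun Y => if Y = X then 1 else g₀ Y
  have hgX : g X = 1 := if_pos rfl
  have hg : ∀ Y : O, S.Ad (g Y) X.1 = Y.1 := by
    intro Y
    simp only [g]
    split_ifs with h
    · rw [h, Ad_one]
    · exact hg₀ Y
  refine ⟨induced g hg ρ, LinearEquiv.refl ℂ M, fun k e => ?_⟩
  change ρ ⟨(g X)⁻¹ * k.1 * g X, _⟩ e = ρ k e
  congr 2
  exact Subtype.ext (by simp [hgX])

end EquivFamily

end CartanSpace

/-! ### The isotropy representations of the lift -/

namespace CartanSpace

variable {ε δ : ℤˣ} {V : Type v} [AddCommGroup V] [Module ℂ V] [FiniteDimensional ℂ V]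
  {V' : Type v} [AddCommGroup V'] [Module ℂ V'] [FiniteDimensional ℂ V']
  {S : CartanSpace ε δ V} {S' : CartanSpace (-ε) (-δ) V'} {T : V →ₗ[ℂ] V'}
  {O : Set (End ℂ V)} {O' : Set (End ℂ V')} {p : ZMod 2}

lemma IsAdmissible.of_equiv {X : End ℂ V} {E F : Type*} [AddCommGroup E] [Module ℂ E]
    [AddCommGroup F] [Module ℂ F] {ρ : S.stab X →* End ℂ E} {τ : S.stab X →* End ℂ F}
    (hτ : IsAdmissible τ p) (Φ : E ≃ₗ[ℂ] F) (hΦ : ∀ k e, Φ (ρ k e) = τ k (Φ e)) :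
    IsAdmissible ρ p where
  nontrivial := by
    have := hτ.nontrivial
    exact Φ.toEquiv.nontrivial
  irreducible := by
    intro G hG
    have hmap : ∀ k, ∀ f ∈ G.map (Φ : E →ₗ[ℂ] F), τ k f ∈ G.map (Φ : E →ₗ[ℂ] F) := by
      rintro k _ ⟨e, he, rfl⟩
      exact ⟨ρ k e, hG k e he, hΦ k e⟩
    rcases hτ.irreducible _ hmap with h | h
    · exact Or.inl (Submodule.map_eq_bot_iff.mp h)
    · right
      rw [eq_top_iff]
      intro e _
      obtain ⟨f, hf, hfe⟩ : Φ e ∈ G.map (Φ : E →ₗ[ℂ] F) := h ▸ Submodule.mem_top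
      rwa [← Φ.injective hfe]
  halfCanonical x k hk e := Φ.injective (by rw [hΦ, hτ.halfCanonical x k hk, map_smul])
  genuine k hk e := Φ.injective (by rw [hΦ, hτ.genuine k hk, map_smul])

lemma IsRegularRep.of_equiv {X : End ℂ V} {E F : Type*} [AddCommGroup E] [Module ℂ E]
    [AddCommGroup F] [Module ℂ F] {ρ : S.stab X →* End ℂ E} {τ : S.stab X →* End ℂ F}
    (hτ : IsRegularRep τ) (Φ : E ≃ₗ[ℂ] F) (hΦ : ∀ k e, Φ (ρ k e) = τ k (Φ e)) :
    IsRegularRep ρ := by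
  intro e φ
  have h1 : (fun k => φ (ρ k e)) = fun k => (φ ∘ₗ (Φ.symm : F →ₗ[ℂ] E)) (τ k (Φ e)) := by
    funext k
    rw [← hΦ]
    simp
  rw [h1]
  exact hτ _ _

/-- The lift of a representation is determined by it up to isomorphism. -/
lemma IsLiftOf.exists_intertwining {χ : S.componentDual} {E E' F F' : Type*} [AddCommGroup E]
    [Module ℂ E] [AddCommGroup E'] [Module ℂ E'] [AddCommGroup F] [Module ℂ F] [AddCommGroup F']
    [Module ℂ F'] {Φ₁ : E ≃ₗ[ℂ] E'} {Φ₂ : F ≃ₗ[ℂ] F'} {ρ : S.stab (S.moment S' T) →* End ℂ E}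
    {ρ' : S'.stab (S.moment' S' T) →* End ℂ E'} {τ : S.stab (S.moment S' T) →* End ℂ F}
    {τ' : S'.stab (S.moment' S' T) →* End ℂ F'} (h₁ : IsLiftOf S S' T χ Φ₁ ρ ρ')
    (hT : T ∈ S.Xcirc S') (h₂ : IsLiftOf S S' T χ Φ₂ τ τ') (Ψ : E' ≃ₗ[ℂ] F')
    (hΨ : ∀ k e, Ψ (ρ' k e) = τ' k (Ψ e)) :
    ∃ Θ : E ≃ₗ[ℂ] F, ∀ k e, Θ (ρ k e) = τ k (Θ e) := by
  refine ⟨(Φ₁.trans Ψ).trans Φ₂.symm, fun k e => Φ₂.injective ?_⟩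
  obtain ⟨k', hk⟩ := exists_isPair_right hT k
  simp only [LinearEquiv.trans_apply]
  rw [LinearEquiv.apply_symm_apply, h₁ k k' hk, h₂ k k' hk, LinearEquiv.apply_symm_apply, ← hΨ,
    Units.smul_def, map_smul]
  rfl

/-- Any two elements of a fiber of the moment map on `𝒳°` differ by an element of `K'`. -/
lemma exists_eq_comp_of_moment_eq (hT : T ∈ S.Xcirc S') {T₂ : V →ₗ[ℂ] V'} (hT₂ : T₂ ∈ S.Xcirc S')
    (h : S.moment S' T₂ = S.moment S' T) :
    ∃ k : S'.Kt, T₂ = (S'.toGL k : V' →ₗ[ℂ] V') ∘ₗ T := by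
  obtain ⟨σ, hσ⟩ := T.exists_rightInverse_of_surjective (LinearMap.range_eq_top.mpr hT.1)
  have hTσ : ∀ w, T (σ w) = w := fun w => LinearMap.congr_fun hσ w
  have hker : LinearMap.ker T = LinearMap.ker T₂ := by
    rw [← S.ker_moment S' hT.1, ← S.ker_moment S' hT₂.1, h]
  set a : End ℂ V' := T₂ ∘ₗ σ with ha
  have haT : ∀ v, a (T v) = T₂ v := by
    intro v
    have h1 : σ (T v) - v ∈ LinearMap.ker T := by rw [LinearMap.mem_ker, map_sub, hTσ, sub_self]
    rw [hker, LinearMap.mem_ker, map_sub] at h1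
    exact sub_eq_zero.mp h1
  obtain ⟨k, hk, hka⟩ := S'.exists_mem_K (a := a)
    (by
      ext w
      obtain ⟨v, rfl⟩ := hT.1 w
      refine S'.eq_of_form_right fun z => ?_
      obtain ⟨u, rfl⟩ := hT.1 z
      rw [Module.End.mul_apply, S'.form_dagger, haT, haT, Module.End.one_apply, ← form_adj, ← form_adj]
      exact congrArg (S.form u) (LinearMap.congr_fun h v))
    (by
      ext w
      obtain ⟨v, rfl⟩ := hT.1 w
      have hd := unit_mul_self δ
      have e1 := hT.2 v
      have e2 := hT₂.2 v
      have h3 : ∀ (R : V →ₗ[ℂ] V'), ((δ : ℤ) : ℂ) • S'.L (R v) = Complex.I • R (S.L v) →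
          S'.L (R v) = (((δ : ℤ) : ℂ) * Complex.I) • R (S.L v) := by
        intro R hR
        rw [mul_smul, ← hR, smul_smul, hd, one_smul]
      rw [Module.End.mul_apply, Module.End.mul_apply, haT, h3 T e1, map_smul, haT, h3 T₂ e2])
  obtain ⟨k', hk'⟩ := exists_toK ⟨k, hk⟩
  refine ⟨k', LinearMap.ext fun v => ?_⟩
  have h3 : S'.toGL k' = k := congrArg Subtype.val hk'
  rw [LinearMap.comp_apply, h3, hka, haT]

/-- If `a T = b T`, then `a` and `b` differ by the kernel of `K̃' → K'`, which acts trivially on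
`ς' ⊗ E'`. -/
lemma varsigma_act_eq {E' : EquivFamily.{v} S' O'} (hE' : E'.IsGenuine p) (hT : Function.Surjective T)
    (hp : ((if ε = 1 then finrank ℂ V else finrank ℂ V' : ℕ) : ZMod 2) = p) {a b : S'.Kt}
    (h : (S'.toGL a : V' →ₗ[ℂ] V') ∘ₗ T = (S'.toGL b : V' →ₗ[ℂ] V') ∘ₗ T) {Y Z : O'}
    (ha : S'.Ad a Y.1 = Z.1) (hb : S'.Ad b Y.1 = Z.1) (e : E'.fiber Y) :
    (S.varsigmaK' S' a : ℂ) • E'.act a ha e = (S.varsigmaK' S' b : ℂ) • E'.act b hb e := by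
  have hz : S'.toK (b⁻¹ * a) = 1 := by
    rw [map_mul, map_inv, inv_mul_eq_one]
    refine Subtype.ext (LinearEquiv.ext fun w => ?_)
    obtain ⟨v, rfl⟩ := hT w
    exact (LinearMap.congr_fun h v).symm
  have hzY : S'.Ad (b⁻¹ * a) Y.1 = Y.1 := by rw [Ad_mul, ha, Ad_inv hb]
  have h1 : (S.varsigmaK' S' (b⁻¹ * a) : ℂ) • E'.act (b⁻¹ * a) hzY e = e := by
    rcases eq_or_isCoverSign hz with h1 | h1
    · rw [E'.act_eq_self hzY h1, h1, map_one, Units.val_one, one_smul]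
    · have hε : ε = 1 := by have := h1.1.1; rwa [neg_inj] at this
      rw [if_pos hε] at hp
      rw [hE' _ _ hzY h1, varsigmaK', varsigma_of_isCoverSign h1,
        neg_one_zpow_eq (p := p) (by rw [cast_sign_sub', hp]), smul_smul]
      push_cast
      rw [← mul_pow, neg_mul_neg, one_mul, one_pow, one_smul]
  conv_rhs => rw [← h1]
  rw [map_smul, E'.act_act hzY hb ha (by group), smul_smul, ← Units.val_mul, ← map_mul,
    mul_inv_cancel_left]

section Eval

variable {E' : EquivFamily.{v} S' O'} (h' : S.moment' S' T ∈ O') (hT : T ∈ S.Xcirc S')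

/-- The point `T` of the fiber of the moment map at `X = T^⋆ T`. -/
def DescFiber.base : DescFiber S S' O' (S.moment S' T) := ⟨T, hT, rfl, h'⟩

lemma DescFiber.exists_eq_comp (T₂ : DescFiber S S' O' (S.moment S' T)) :
    ∃ k : S'.Kt, T₂.1 = (S'.toGL k : V' →ₗ[ℂ] V') ∘ₗ (DescFiber.base h' hT).1 :=
  exists_eq_comp_of_moment_eq hT T₂.2.1 T₂.2.2.1

/-- Evaluation of sections at `T`. -/
def evalAt : liftFiber S E' (S.moment S' T) →ₗ[ℂ] E'.fiber ⟨S.moment' S' T, h'⟩ where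
  toFun s := s.1 (DescFiber.base h' hT)
  map_add' _ _ := rfl
  map_smul' _ _ := rfl

/-- A section over the fiber of the moment map is determined by its value at `T`, which may be
prescribed: the ambiguity in `T₂ = k T` is harmless by `varsigma_act_eq`. -/
lemma evalAt_bijective (hE' : E'.IsGenuine p)
    (hp : ((if ε = 1 then finrank ℂ V else finrank ℂ V' : ℕ) : ZMod 2) = p) :
    Function.Bijective (evalAt (E' := E') h' hT) := by
  constructor
  · rw [← LinearMap.ker_eq_bot, LinearMap.ker_eq_bot']
    intro s hs
    apply Subtype.ext
    funext T₂
    obtain ⟨k, hk⟩ := DescFiber.exists_eq_comp h' hT T₂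
    have hs' : s.1 (DescFiber.base h' hT) = 0 := hs
    rw [s.2 k _ _ hk, hs', map_zero, smul_zero]
    rfl
  · suffices hs : ∀ e : E'.fiber (DescFiber.base h' hT).target,
        ∃ s : liftFiber S E' (S.moment S' T), s.1 (DescFiber.base h' hT) = e from hs
    intro e
    choose f hf using DescFiber.exists_eq_comp (O' := O') h' hT
    refine ⟨⟨fun T₂ => (S.varsigmaK' S' (f T₂) : ℂ) •
      E'.act (f T₂) (DescFiber.target_translate (f T₂) (hf T₂)) e, ?_⟩, ?_⟩
    · intro k T₁ T₂ hk
      have h1 : T₂.1 = (S'.toGL (k * f T₁) : V' →ₗ[ℂ] V') ∘ₗ (DescFiber.base h' hT).1 := by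
        rw [hk, hf T₁]
        ext v
        simp
      have h2 := DescFiber.target_translate _ h1
      change (S.varsigmaK' S' (f T₂) : ℂ) • E'.act _ _ e = _
      rw [map_smul, E'.act_act _ (DescFiber.target_translate k hk) h2 rfl, smul_smul,
        ← Units.val_mul, ← map_mul]
      exact varsigma_act_eq hE' hT.1 hp ((hf T₂).symm.trans h1) _ _ e
    · change (S.varsigmaK' S' (f (DescFiber.base h' hT)) : ℂ) • E'.act _ _ e = e
      have h1 := hf (DescFiber.base h' hT)
      have h2 := varsigma_act_eq (S := S) hE' hT.1 hp (a := f (DescFiber.base h' hT)) (b := 1)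
        (by rw [map_one]; exact h1.symm) (DescFiber.target_translate _ h1) (Ad_one S' _) e
      rw [map_one, Units.val_one, one_smul, E'.act_one] at h2
      exact h2

/-- The fiber of the lift at `X = T^⋆ T` is the fiber of `E'` at `X' = T T^⋆`. -/
def evalEquiv (hE' : E'.IsGenuine p)
    (hp : ((if ε = 1 then finrank ℂ V else finrank ℂ V' : ℕ) : ZMod 2) = p) :
    liftFiber S E' (S.moment S' T) ≃ₗ[ℂ] E'.fiber ⟨S.moment' S' T, h'⟩ :=
  LinearEquiv.ofBijective _ (evalAt_bijective h' hT hE' hp)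

/-- The isotropy representation of `χ ⊗ ϑ(E')` at `T^⋆ T` is the lift of that of `E'` at `T T^⋆`. -/
lemma isLiftOf_thetaLift (h : S.moment S' T ∈ O) (χ : S.componentDual) (hE' : E'.IsGenuine p)
    (hp : ((if ε = 1 then finrank ℂ V else finrank ℂ V' : ℕ) : ZMod 2) = p) :
    IsLiftOf S S' T χ (evalEquiv h' hT hE' hp)
      (((thetaLift S O E').twist χ).isoRep ⟨S.moment S' T, h⟩)
      (E'.isoRep ⟨S.moment' S' T, h'⟩) := by
  intro k k' hk s
  have h1 := thetaLift_isotropy E' (X := ⟨S.moment S' T, h⟩) (DescFiber.base h' hT) k.1 k.2 k'.1 hk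
    k'.2 s
  refine (congrArg (fun e => (χ.1 (S.toK k.1) : ℂ) • e) h1).trans ?_
  rw [Units.smul_def, Units.val_mul, Units.val_mul, mul_smul, mul_smul]
  rfl

end Eval

/-! ### Lifting and descent of admissible orbit data -/

section Lift

variable (hO : S.IsTransitive O) (hO' : S'.IsTransitive O') (hT : T ∈ S.Xcirc S')
  (h : S.moment S' T ∈ O) (h' : S.moment' S' T ∈ O')
  (hp : ((if ε = 1 then finrank ℂ V else finrank ℂ V' : ℕ) : ZMod 2) = p)

include hO hO' hT h h' hp

theorem isAOD_thetaLift (χ : S.componentDual) {E' : EquivFamily.{v} S' O'} (hE' : E'.IsAOD p) :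
    ((thetaLift S O E').twist χ).IsAOD p := by
  have h1 := isLiftOf_thetaLift h' hT h χ hE'.genuine hp
  obtain ⟨hfin, hadm⟩ := hE'.isAdmissible_isoRep hO' ⟨_, h'⟩
  have : FiniteDimensional ℂ (((thetaLift S O E').twist χ).fiber ⟨S.moment S' T, h⟩) :=
    (evalEquiv h' hT hE'.genuine hp).symm.finiteDimensional
  exact EquivFamily.isAOD_of_isoRep hO ⟨_, h⟩ (h1.isAdmissible hT hp hadm)
    (h1.isRegularRep hT (hE'.algebraic ⟨_, h'⟩).2)

theorem thetaLift_congr (χ : S.componentDual) {E' F' : EquivFamily.{v} S' O'} (hE' : E'.IsAOD p)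
    (hF' : F'.IsAOD p) (hEF : E'.Equivalent F') :
    ((thetaLift S O E').twist χ).Equivalent ((thetaLift S O F').twist χ) := by
  have h1 := isLiftOf_thetaLift h' hT h χ hE'.genuine hp
  have h2 := isLiftOf_thetaLift h' hT h χ hF'.genuine hp
  obtain ⟨Φ, hΦ⟩ := hEF.isoRep ⟨_, h'⟩
  obtain ⟨Θ, hΘ⟩ := h1.exists_intertwining hT h2 Φ hΦ
  exact EquivFamily.equivalent_of_isoRep hO ⟨_, h⟩ Θ hΘ

/-- The isotropy representation of an admissible orbit datum descends; the descended representation is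
algebraic by `IsAdmissible.isRegularRep`, and induces the bundle `E'`. -/
theorem exists_thetaLift_equivalent (hX : IsNilpotent (S.moment S' T))
    (hcol : HasColumnParity (S.moment S' T) p) {E : EquivFamily.{v} S O} (hE : E.IsAOD p) :
    ∃ (χ : S.componentDual) (E' : EquivFamily.{v} S' O'), E'.IsAOD p ∧
      ((thetaLift S O E').twist χ).Equivalent E := by
  obtain ⟨hfin, hadm⟩ := hE.isAdmissible_isoRep hO ⟨_, h⟩
  obtain ⟨χ, ρ', hlift, hρ'⟩ := IsAdmissible.exists_descent (T := T) hadm hT hp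
  have hreg := IsAdmissible.isRegularRep _ rfl (S.moment'_mem_lieP S' hT) (isNilpotent_moment' hX)
    (hcol.moment' hT.1) hρ'
  obtain ⟨E', Φ, hΦ⟩ := EquivFamily.exists_isoRep_eq hO' ⟨_, h'⟩ ρ'
  have hE'fin : FiniteDimensional ℂ (E'.fiber ⟨_, h'⟩) := Φ.symm.finiteDimensional
  have hE' : E'.IsAOD p := EquivFamily.isAOD_of_isoRep hO' ⟨_, h'⟩ (hρ'.of_equiv Φ hΦ)
    (hreg.of_equiv Φ hΦ)
  obtain ⟨Θ, hΘ⟩ := (isLiftOf_thetaLift h' hT h χ hE'.genuine hp).exists_intertwining hT hlift Φ hΦ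
  exact ⟨χ, E', hE', EquivFamily.equivalent_of_isoRep hO ⟨_, h⟩ Θ hΘ⟩

end Lift

end CartanSpace

namespace CartanSpace

variable {ε δ : ℤˣ} {V : Type v} [AddCommGroup V] [Module ℂ V] [FiniteDimensional ℂ V]
  {V' : Type v} [AddCommGroup V'] [Module ℂ V'] [FiniteDimensional ℂ V']
  {S : CartanSpace ε δ V} {S' : CartanSpace (-ε) (-δ) V'} {T : V →ₗ[ℂ] V'}
  {O : Set (End ℂ V)} {O' : Set (End ℂ V')} {p : ZMod 2}

/-- Lifting, combined with twisting by characters of the component group, exhausts the admissible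
orbit data. -/
theorem exists_surjective_lift (hO : S.IsTransitive O) (hO' : S'.IsTransitive O')
    (hT : T ∈ S.Xcirc S') (h : S.moment S' T ∈ O) (h' : S.moment' S' T ∈ O')
    (hp : ((if ε = 1 then finrank ℂ V else finrank ℂ V' : ℕ) : ZMod 2) = p)
    (hX : IsNilpotent (S.moment S' T)) (hcol : HasColumnParity (S.moment S' T) p) :
    ∃ f : S.componentDual × AOD.{v} S' O' p → AOD.{v} S O p,
      (∀ (χ : S.componentDual) (E' : EquivFamily.{v} S' O') (hE' : E'.IsAOD p),
        ∃ hE : ((thetaLift S O E').twist χ).IsAOD p, f (χ, AOD.mk E' hE') = AOD.mk _ hE) ∧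
      Function.Surjective f := by
  refine ⟨fun q => Quotient.liftOn q.2
    (fun E' => AOD.mk _ (isAOD_thetaLift hO hO' hT h h' hp q.1 E'.2)) fun E' F' hEF =>
      Quotient.sound (thetaLift_congr hO hO' hT h h' hp q.1 E'.2 F'.2 hEF),
    fun χ E' hE' => ⟨isAOD_thetaLift hO hO' hT h h' hp χ hE', rfl⟩, fun q => ?_⟩
  induction q using Quotient.inductionOn with
  | _ E =>
  obtain ⟨χ, E', hE', hEq⟩ := exists_thetaLift_equivalent hO hO' hT h h' hp hX hcol E.2
  exact ⟨(χ, AOD.mk E' hE'), Quotient.sound hEq⟩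

/-! ### Uniqueness for quaternionic groups -/

/-- The `K`-orbit of `X`. -/
def orbit (S : CartanSpace ε δ V) (X : End ℂ V) : Set (End ℂ V) := {Y | ∃ k ∈ S.K, Y = k.conj X}

lemma mem_orbit_self (X : End ℂ V) : X ∈ S.orbit X :=
  ⟨1, S.K.one_mem, by ext v; rfl⟩

lemma isTransitive_orbit (X : End ℂ V) : S.IsTransitive (S.orbit X) := by
  have key : ∀ Y : S.orbit X, ∃ g, S.Ad g X = Y.1 := by
    rintro ⟨_, k, hk, rfl⟩
    obtain ⟨g, hg⟩ := exists_toK ⟨k, hk⟩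
    refine ⟨g, ?_⟩
    have h3 : S.toGL g = k := congrArg Subtype.val hg
    rw [Ad, h3]
  intro Y Z
  obtain ⟨a, ha⟩ := key Y
  obtain ⟨b, hb⟩ := key Z
  exact ⟨b * a⁻¹, by rw [Ad_mul, Ad_inv ha, hb]⟩

/-- Over a point, for a group which is not real symplectic, there is only the trivial line bundle. -/
lemma exists_unique_aod_of_subsingleton [Subsingleton V] (hS : ¬ S.IsRealSymplectic)
    (X : End ℂ V) : ∃ E : AOD.{v} S (S.orbit X) p, ∀ F, F = E := by
  have hO := S.isTransitive_orbit X
  set X₀ : S.orbit X := ⟨X, mem_orbit_self X⟩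
  have hone : ∀ k : S.stab X₀.1, k = 1 := by
    intro k
    have hk1 : S.toK k.1 = 1 := Subtype.ext (LinearEquiv.ext fun v => Subsingleton.elim _ _)
    rcases eq_or_isCoverSign hk1 with h | h
    · exact Subtype.ext h
    · exact absurd h.1 hS
  obtain ⟨E, Φ, hΦ⟩ := EquivFamily.exists_isoRep_eq hO X₀
    (1 : S.stab X₀.1 →* End ℂ (ULift.{v} ℂ))
  have hfin : FiniteDimensional ℂ (E.fiber X₀) := Φ.symm.finiteDimensional
  have hadm : IsAdmissible (X := X₀.1) (1 : S.stab X₀.1 →* End ℂ (ULift.{v} ℂ)) p :=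
    { nontrivial := inferInstance
      irreducible := by
        intro F _
        by_cases hF : F = ⊥
        · exact Or.inl hF
        · right
          obtain ⟨f, hf, hf0⟩ := Submodule.exists_mem_ne_zero_of_ne_bot hF
          have hf1 : f.down ≠ 0 := fun h => hf0 (ULift.ext _ _ h)
          rw [eq_top_iff]
          intro e _
          have he : e = (e.down / f.down) • f :=
            ULift.ext _ _ (by simp [hf1])
          rw [he]
          exact F.smul_mem _ hf
      halfCanonical := by
        intro x k _ e
        have hx : S.adStab X₀.1 x = 0 := by
          ext y v
          exact Subsingleton.elim _ _
        rw [dgamma, hx, map_zero, zero_div, Complex.exp_zero, one_smul]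
        rfl
      genuine := fun k hk => absurd hk.1 hS }
  have hreg : IsRegularRep (X := X₀.1) (1 : S.stab X₀.1 →* End ℂ (ULift.{v} ℂ)) :=
    fun e φ => regular_const (φ e)
  have hE : E.IsAOD p := EquivFamily.isAOD_of_isoRep hO X₀ (hadm.of_equiv Φ hΦ) (hreg.of_equiv Φ hΦ)
  refine ⟨AOD.mk E hE, fun q => ?_⟩
  induction q using Quotient.inductionOn with
  | _ F =>
  obtain ⟨hFfin, hF⟩ := F.2.isAdmissible_isoRep hO X₀
  have hFone : ∀ k e, F.1.isoRep X₀ k e = e := fun k e => by rw [hone k, map_one]; rfl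
  have := hF.nontrivial
  obtain ⟨e₀, he₀⟩ := exists_ne (0 : F.1.fiber X₀)
  have hspan : (ℂ ∙ e₀) = ⊤ := by
    refine (hF.irreducible (ℂ ∙ e₀) fun k e he => by rwa [hFone]).resolve_left ?_
    rwa [Submodule.span_singleton_eq_bot]
  have hdim : finrank ℂ (F.1.fiber X₀) = finrank ℂ (E.fiber X₀) := by
    have h1 := finrank_span_singleton (K := ℂ) he₀
    rw [hspan, finrank_top] at h1
    rw [h1, Φ.finrank_eq]
    simp
  refine Quotient.sound (EquivFamily.equivalent_of_isoRep hO X₀ (LinearEquiv.ofFinrankEq _ _ hdim)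
    fun k e => ?_)
  rw [hFone, hone k, map_one]
  rfl

/-- For a quaternionic group there are no nontrivial characters of the component group, so that an
iterated descent to `V = 0` gives existence and uniqueness. -/
theorem exists_unique_aod :
    ∀ (n : ℕ) {ε δ : ℤˣ} {V : Type v} [AddCommGroup V] [Module ℂ V] [FiniteDimensional ℂ V]
      {S : CartanSpace ε δ V} {X : End ℂ V}, finrank ℂ V = n → ε * δ = -1 → X ∈ S.lieP →
      IsNilpotent X → HasColumnParity X p → ∃ E : AOD.{v} S (S.orbit X) p, ∀ F, F = E := by
  intro n
  induction n using Nat.strong_induction_on with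
  | _ n ih =>
  intro ε δ V _ _ _ S X hn hεδ hXp hX hcol
  rcases Nat.eq_zero_or_pos n with h0 | hpos
  · subst h0
    have hsub : Subsingleton V := finrank_zero_iff.mp hn
    refine exists_unique_aod_of_subsingleton (fun h => ?_) X
    rw [h.1, h.2] at hεδ
    exact absurd hεδ (by decide)
  · obtain ⟨V', _, _, _, S', T, hT, rfl⟩ := S.exists_moment_eq hXp
    have h1 := finrank_ker_pos hX (by rw [hn]; exact hpos)
    rw [S.ker_moment S' hT.1] at h1
    obtain ⟨E', hE'⟩ := ih (finrank ℂ V') (by rw [← hn, finrank_eq_add hT.1]; omega) (S := S') rfl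
      (by rw [neg_mul_neg, hεδ]) (S.moment'_mem_lieP S' hT) (isNilpotent_moment' hX)
      (hcol.moment' hT.1)
    obtain ⟨f, -, hf⟩ := exists_surjective_lift (isTransitive_orbit (S.moment S' T))
      (isTransitive_orbit (S.moment' S' T)) hT (mem_orbit_self _) (mem_orbit_self _)
      (hcol.finrank hT.1 hX (by rw [hn]; exact hpos)) hX hcol
    refine ⟨f (1, E'), fun F => ?_⟩
    obtain ⟨⟨χ, F'⟩, rfl⟩ := hf F
    have hχ : χ = 1 := Subtype.ext (MonoidHom.ext fun k => componentDual_eq_one χ k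
      fun h2 h3 => by rw [h2, h3] at hεδ; exact absurd hεδ (by decide))
    rw [hχ, hE' F']

lemma isNilpotent_of_mem_orbit {X Y : End ℂ V} (hX : IsNilpotent X) (hY : Y ∈ S.orbit X) :
    IsNilpotent Y := by
  obtain ⟨k, -, rfl⟩ := hY
  exact hX.map (k.conjRingEquiv)

end CartanSpace

end

theorem mainTheorem9 {ε δ : ℤˣ} {V : Type v} [AddCommGroup V] [Module ℂ V]
    [FiniteDimensional ℂ V] (S : EESpace ε δ V) (p : ZMod 2)
    (𝒪 : Set (Module.End ℂ V)) (h𝒪 : 𝒪 ∈ S.complexNilOrbitsP p)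
    (O : Set (Module.End ℂ V)) (hO : O ∈ S.nilOrbits) (hO𝒪 : O ⊆ 𝒪) :
    (∀ (V' : Type v) [AddCommGroup V'] [Module ℂ V'] [FiniteDimensional ℂ V']
      (S' : EESpace (-ε) (-δ) V') (O' : Set (Module.End ℂ V')),
      O' ∈ S'.nilOrbits →
      S.IsDescent S'.toCartanSpace O O' →
      ((if ε = 1 then Module.finrank ℂ V else Module.finrank ℂ V' : ℕ) : ZMod 2) = p →
      ∃ f : S.componentDual × CartanSpace.AOD.{v} S'.toCartanSpace O' p →
          CartanSpace.AOD.{v} S.toCartanSpace O p,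
        (∀ (χ : S.componentDual) (E' : CartanSpace.EquivFamily.{v} S'.toCartanSpace O')
          (hE' : E'.IsAOD p),
          ∃ hE : ((CartanSpace.thetaLift S.toCartanSpace O E').twist χ).IsAOD p,
            f (χ, CartanSpace.AOD.mk E' hE') = CartanSpace.AOD.mk _ hE) ∧
        Function.Surjective f) ∧
    (ε * δ = -1 → ∃ E : CartanSpace.AOD.{v} S.toCartanSpace O p, ∀ F, F = E) := by
  obtain ⟨X, hXp, hX, rfl⟩ := hO
  have hcol : ∀ Y ∈ S.orbit X, CartanSpace.HasColumnParity Y p := fun Y hY =>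
    (h𝒪.2 Y (hO𝒪 hY)).1
  constructor
  · rintro V' _ _ _ S' _ ⟨X', -, -, rfl⟩ ⟨T, hT, h, h'⟩ hp
    exact CartanSpace.exists_surjective_lift (CartanSpace.isTransitive_orbit X)
      (CartanSpace.isTransitive_orbit X') hT h h' hp (CartanSpace.isNilpotent_of_mem_orbit hX h)
      (hcol _ h)
  · intro hεδ
    exact CartanSpace.exists_unique_aod _ rfl hεδ hXp hX (hcol X (CartanSpace.mem_orbit_self X))
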